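/- **Setting.** A $d$-dimensional weighted pure simplicial complex $(X,\Pi)$ on $[n]$ is a family of $d$-subsets of $[n]$ (top faces) with a probability distribution $\Pi$ of full support on it. $X(i)$ is the set of $i$-element subsets of top faces, $\Pi_d=\Pi$ and $\Pi_i(x)=\frac1{i+1}\sum_{y\in X(i+1),\,y\supset x}\Pi_{i+1}(y)$; expectation, variance and inner products on $C_i=\{f:X(i)\to\mathbb R\}$ are taken with respect to $\Pi_i$. The link of $s\in X(i)$ is $X_s=\{t\setminus s: s\subseteq t\in X\}$ with the normalized distribution. $(X,\Pi)$ is a two-sided $\gamma$-local-spectral expander ($\gamma\ge0$) if for all $i\le d-2$ and $s\in X(i)$ all non-trivial eigenvalues of the (weighted) random walk on the graph $(X_s(1),X_s(2))$ have absolute value at most $\gamma$. Let $$U_kf(y)=\tfrac1{k+1}\sum_{x\subset y}f(x),\qquad D_{k+1}f(x)=\tfrac1{k+1}\sum_{y\supset x}\tfrac{\Pi_{k+1}(y)}{\Pi_k(x)}f(y),\qquad U^k_i=U_{k-1}\cdots U_i,\quad D^k_i=D_{i+1}\cdots D_k .$$ A $k$-dimensional pure walk of height $h(Y)$ is a composition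 $Y=Z_{2h(Y)}\circ\dots\circ Z_1:C_k\to C_k$ of $h(Y)$ down and $h(Y)$ up operators that stays in the levels $0,\dots,d$. A $k$-dimensional HD-walk is an affine combination $M=\sum_Y\alpha_YY$ of pure walks that is self-adjoint with non-negative transition probabilities; $w(M)=\sum|\alpha_Y|$, and $h(M)$ is the largest height of a $Y$ with $\alpha_Y\ne0$. It is complete if for every $N$ there are $n_0>N$ and $d_0\le n_0$ such that $\sum_Y\alpha_YY$ is also an HD-walk over the complete complex $J(n_0,d_0)$ (all $d_0$-subsets of $[n_0]$, uniform distribution). Put $\lambda_\ell(M)=\sum_Y\alpha_Y\lambda_\ell(Y)$, where $\lambda_\ell(Y)=\prod_{s=1}^{h(Y)}\bigl(1-\frac{\ell}{\max\{\ell,\,i_s-2s+k+1\}}\bigr)$ and $i_1<\dots<i_{h(Y)}$ are the positions of the down operators in $Y$. For constants $A,B>0$ let $c_{\max}=\max_{0\le\ell\le k}A\gamma\, w(M)h(M)(k+h(M))\binom k\ell$, let $\lambda_{\rm dif}$ be the smallest distance between distinct values among $\lambda_0(M),\dots,\lambda_k(M)$, $e=B(k+1)\frac{\max_i|\lambda_i(M)|}{\lambda_{\rm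 dif}^{1/2}}c_{\max}^{1/2}$ (with $e=0$ if all the $\lambda_i(M)$ coincide), and $I_{\lambda_i}=[\lambda_i(M)-e,\lambda_i(M)+e]$. We say that the eigenstrip intervals are disjoint if $c_{\max}\le\lambda_{\rm dif}/(4(k+1))$ and $I_{\lambda_i}\cap I_{\lambda_j}=\emptyset$ whenever $\lambda_i(M)\ne\lambda_j(M)$ (no condition if all the $\lambda_i(M)$ coincide). With the eigenstrips $W^i=\mathrm{Span}\{\varphi: M\varphi=\mu\varphi,\ \mu\in I_{\lambda_i}\}$, the stripped threshold rank $R_\delta(M)$ is the number of $i\in\{0,\dots,k\}$ such that $W^i$ contains an eigenvector of $M$ with eigenvalue $>\delta$. For $S\subseteq X(k)$ let $\alpha=\mathbb E[\mathbf 1_S]$ be its density and $\phi(S)=\mathbb E_{v\sim\Pi_k|_S}\bigl[\sum_{y\in X(k)\setminus S}M(v,y)\bigr]$ its expansion. $S$ is $(\varepsilon_1,\dots,\varepsilon_r)$-$\ell_2$-pseudorandom if $\mathrm{Var}(D^k_i\mathbf 1_S)\le\varepsilon_i\alpha$, and $(\varepsilon_1,\dots,\varepsilon_r)$-$\ell_\infty$-pseudorandom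 if $\|D^k_i\mathbf 1_S-\alpha\|_\infty\le\varepsilon_i$, for all $1\le i\le r$. **Theorem.** There are absolute constants $A,B,C>0$ such that the following two statements hold. (1) Let $(X,\Pi)$ be a two-sided $\gamma$-local-spectral expander, $M$ a complete $k$-dimensional HD-walk on it, let $\gamma$ be small enough that the eigenstrip intervals are disjoint, let $\delta>0$ and $r=\max\{R_\delta(M)-1,0\}$. Let $S\subseteq X(k)$ be a non-empty set of density $\alpha$ that is $(\varepsilon_1,\dots,\varepsilon_r)$-$\ell_2$-pseudorandom or $(\varepsilon_1,\dots,\varepsilon_r)$-$\ell_\infty$-pseudorandom, where $\varepsilon_i\le1$ for every $1\le i\le r$ with $\lambda_i(M)<\delta$. Then $$\phi(S)\ \ge\ 1-\alpha-(1-\alpha)\delta-c\gamma-\sum_{i=1}^r(\lambda_i(M)-\delta)\binom ki\varepsilon_i,\qquad c=w(M)\,h(M)^2\,2^{Ck}.$$ (2) The bound in (1) is tight. Let $0\le t\le k$ and $2k-t\le d$. There is a complete $M=\sum_Y\alpha_YY$ that for every $n\ge d$ is an HD-walk on $J(n,d)$ and equals there the partial-swap walk $S_k^{k-t}$ (the canonical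 walk $D^{2k-t}_kU^{2k-t}_k$ restricted to pairs of faces with exactly $t$ common vertices and renormalized), and for which the following holds. For every $\eta>0$, for all sufficiently large $m$, for all sufficiently small $\delta>0$ (depending on $m$), and for all sufficiently large $n$ (depending on $m,\delta$) with $m\mid n$, there are $\gamma\ge0$ and $\varepsilon_1,\dots,\varepsilon_r\le1$, $r=\max\{R_\delta(M)-1,0\}$, such that $J(n,d)$ is a two-sided $\gamma$-local-spectral expander, the eigenstrip intervals are disjoint, the set $B_m=\binom{[n/m]}{k}$ of $k$-faces is non-empty and both $(\varepsilon_1,\dots,\varepsilon_r)$-$\ell_2$- and $(\varepsilon_1,\dots,\varepsilon_r)$-$\ell_\infty$-pseudorandom, and $$1-\phi(B_m)\ \ge\ (1-\eta)\,(1-L),$$ where $L$ is the lower bound of (1) for $S=B_m$, with the same constant $C$. -/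

import Mathlib

open Finset

/-! ### Weighted pure simplicial complexes -/

/-- A `d`-dimensional weighted pure simplicial complex on the vertex set `[n]`: a family of
`d`-element sets (the top level faces), with a probability distribution of full support on it. -/
structure WeightedComplex (n d : ℕ) where
  top : Finset (Finset (Fin n))
  card_top : ∀ t ∈ top, t.card = d
  weight : Finset (Fin n) → ℝ
  weight_pos : ∀ t ∈ top, 0 < weight t
  weight_sum : ∑ t ∈ top, weight t = 1

namespace WeightedComplex

variable {n d : ℕ}

/-- `X(i)`: the `i`-element sets that lie in some top level face. -/
def level (X : WeightedComplex n d) (i : ℕ) : Finset (Finset (Fin n)) :=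
  univ.filter fun s => s.card = i ∧ ∃ t ∈ X.top, s ⊆ t

/-- The type of `i`-faces. -/
abbrev Face (X : WeightedComplex n d) (i : ℕ) : Type := {s : Finset (Fin n) // s ∈ X.level i}

/-- `C_i`: the real functions on `X(i)`. -/
abbrev Fn (X : WeightedComplex n d) (i : ℕ) : Type := X.Face i → ℝ

/-- The distribution `Π_i(s)` induced on the level `i = |s|`: draw a top level face, then a uniformly
random `i`-element subset of it. The theorems `prob_top` and `prob_eq_sum` show that it is the one
given by `Π_d = Π` and `Π_i(s) = (1/(i+1)) ∑ Π_{i+1}(y)`, the sum over `y ∈ X(i+1)`, `y ⊃ s`. -/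
noncomputable def prob (X : WeightedComplex n d) (s : Finset (Fin n)) : ℝ :=
  (∑ t ∈ X.top with s ⊆ t, X.weight t) / (d.choose s.card : ℝ)

theorem prob_top (X : WeightedComplex n d) {t : Finset (Fin n)} (ht : t ∈ X.top) :
    X.prob t = X.weight t := by
  have h : (X.top.filter fun u => t ⊆ u) = {t} := by
    ext u
    simp only [mem_filter, mem_singleton]
    constructor
    · rintro ⟨hu, htu⟩
      exact (eq_of_subset_of_card_le htu (by rw [X.card_top u hu, X.card_top t ht])).symm
    · rintro rfl
      exact ⟨ht, Subset.rfl⟩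
  simp [prob, h, X.card_top t ht]

theorem prob_eq_sum (X : WeightedComplex n d) {i : ℕ} (hi : i < d) {s : Finset (Fin n)}
    (hs : s ∈ X.level i) :
    X.prob s = (1 / ((i : ℝ) + 1)) * ∑ y ∈ X.level (i + 1) with s ⊆ y, X.prob y := by
  have hsc : s.card = i := (mem_filter.mp hs).2.1
  have hcard : ∀ y ∈ (X.level (i + 1)).filter (fun y => s ⊆ y), y.card = i + 1 := fun y hy =>
    (mem_filter.mp (mem_filter.mp hy).1).2.1
  have h1 : ∑ y ∈ X.level (i + 1) with s ⊆ y, X.prob y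
      = (∑ y ∈ X.level (i + 1) with s ⊆ y, ∑ t ∈ X.top with y ⊆ t, X.weight t)
        / (d.choose (i + 1) : ℝ) := by
    rw [Finset.sum_div]
    refine Finset.sum_congr rfl fun y hy => ?_
    rw [prob, hcard y hy]
  have h2 : (∑ y ∈ X.level (i + 1) with s ⊆ y, ∑ t ∈ X.top with y ⊆ t, X.weight t)
      = ((d - i : ℕ) : ℝ) * ∑ t ∈ X.top with s ⊆ t, X.weight t := by
    rw [Finset.sum_comm' (t' := X.top.filter fun t => s ⊆ t)
      (s' := fun t => (X.level (i + 1)).filter fun y => s ⊆ y ∧ y ⊆ t)]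
    · rw [Finset.mul_sum]
      refine Finset.sum_congr rfl fun t ht => ?_
      obtain ⟨htop, hst⟩ := mem_filter.mp ht
      rw [Finset.sum_const, nsmul_eq_mul]
      congr 2
      have : ((X.level (i + 1)).filter fun y => s ⊆ y ∧ y ⊆ t)
          = (t \ s).image (fun v => insert v s) := by
        ext y
        simp only [mem_filter, level, mem_univ, true_and, mem_image, mem_sdiff]
        constructor
        · rintro ⟨⟨hy, _⟩, hsy, hyt⟩
          obtain ⟨v, hv⟩ := Finset.card_eq_one.mp
            (show (y \ s).card = 1 by rw [card_sdiff_of_subset hsy]; omega)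
          have hvy : v ∈ y \ s := by rw [hv]; exact mem_singleton_self v
          refine ⟨v, ⟨hyt (mem_sdiff.mp hvy).1, (mem_sdiff.mp hvy).2⟩, ?_⟩
          rw [← sdiff_union_of_subset hsy, hv, insert_eq]
        · rintro ⟨v, ⟨hvt, hvs⟩, rfl⟩
          have := insert_subset hvt hst
          exact ⟨⟨by rw [card_insert_of_notMem hvs, hsc], t, htop, this⟩, subset_insert _ _, this⟩
      rw [this, card_image_of_injOn, card_sdiff_of_subset hst, X.card_top t htop, hsc]
      intro v hv w hw hvw
      have hv' := (mem_sdiff.mp hv).2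
      have : v ∈ insert w s := by
        have h : insert v s = insert w s := hvw
        rw [← h]; exact mem_insert_self v s
      exact (mem_insert.mp this).resolve_right hv'
    · intro y t
      simp only [mem_filter]
      constructor
      · rintro ⟨⟨hy, hsy⟩, ht, hyt⟩
        exact ⟨⟨hy, hsy, hyt⟩, ht, hsy.trans hyt⟩
      · rintro ⟨⟨hy, hsy, hyt⟩, ht, _⟩
        exact ⟨⟨hy, hsy⟩, ht, hyt⟩
  have h3 : ((d.choose (i + 1) : ℕ) : ℝ) * ((i : ℝ) + 1) = (d.choose i : ℝ) * ((d - i : ℕ) : ℝ) := by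
    exact_mod_cast Nat.choose_succ_right_eq d i
  have hc1 : ((d.choose (i + 1) : ℕ) : ℝ) ≠ 0 := by
    exact_mod_cast (Nat.choose_pos (by omega : i + 1 ≤ d)).ne'
  have hc0 : ((d.choose i : ℕ) : ℝ) ≠ 0 := by
    exact_mod_cast (Nat.choose_pos hi.le).ne'
  have hi1 : (i : ℝ) + 1 ≠ 0 := by positivity
  rw [h1, h2, prob, hsc]
  field_simp
  linear_combination (∑ t ∈ X.top with s ⊆ t, X.weight t) * h3

/-- The expectation of a function on `X(i)` under `Π_i`. -/
noncomputable def expect (X : WeightedComplex n d) {i : ℕ} (f : X.Fn i) : ℝ :=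
  ∑ s, X.prob s.1 * f s

/-- The inner product on `C_i`. -/
noncomputable def inner (X : WeightedComplex n d) {i : ℕ} (f g : X.Fn i) : ℝ :=
  X.expect fun s => f s * g s

/-- The variance of a function on `X(i)` under `Π_i`. -/
noncomputable def var (X : WeightedComplex n d) {i : ℕ} (f : X.Fn i) : ℝ :=
  X.expect (fun s => f s ^ 2) - X.expect f ^ 2

/-! ### Links and local-spectral expansion -/

/-- The link `X_s = {t \ s : t ∈ X, t ⊇ s}` of an `i`-face `s`, with the normalized distribution. -/
noncomputable def link (X : WeightedComplex n d) {i : ℕ} (s : X.Face i) :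
    WeightedComplex n (d - i) where
  top := (X.top.filter fun t => s.1 ⊆ t).image fun t => t \ s.1
  card_top := by
    intro u hu
    obtain ⟨t, ht, rfl⟩ := mem_image.mp hu
    obtain ⟨htop, hst⟩ := mem_filter.mp ht
    rw [card_sdiff_of_subset hst, X.card_top t htop, (mem_filter.mp s.2).2.1]
  weight u := X.weight (u ∪ s.1) / ∑ t ∈ X.top with s.1 ⊆ t, X.weight t
  weight_pos := by
    intro u hu
    obtain ⟨t, ht, rfl⟩ := mem_image.mp hu
    obtain ⟨htop, hst⟩ := mem_filter.mp ht
    rw [sdiff_union_of_subset hst]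
    exact div_pos (X.weight_pos t htop)
      (sum_pos (fun t' ht' => X.weight_pos t' (mem_filter.mp ht').1) ⟨t, ht⟩)
  weight_sum := by
    rw [← Finset.sum_div, sum_image]
    · rw [sum_congr rfl fun t ht => by rw [sdiff_union_of_subset (mem_filter.mp ht).2]]
      obtain ⟨t, htop, hst⟩ := (mem_filter.mp s.2).2.2
      exact div_self (sum_pos (fun t' ht' => X.weight_pos t' (mem_filter.mp ht').1)
        ⟨t, mem_filter.mpr ⟨htop, hst⟩⟩).ne'
    · intro t ht t' ht' h
      have h : t \ s.1 = t' \ s.1 := h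
      rw [← sdiff_union_of_subset (mem_filter.mp ht).2, h,
        sdiff_union_of_subset (mem_filter.mp ht').2]

/-- The weights of the edges of the underlying graph `(X(1), X(2))`, with the weights `Π_2`. -/
noncomputable def edgeWeight (X : WeightedComplex n d) (u v : {v : Fin n // {v} ∈ X.level 1}) : ℝ :=
  if ({u.1, v.1} : Finset (Fin n)) ∈ X.level 2 then X.prob {u.1, v.1} else 0

end WeightedComplex

/-- A graph with (symmetric, non-negative) edge weights `w` is a two-sided `γ`-spectral expander if
the random walk with transition probabilities proportional to `w` has second largest eigenvalue in
absolute value at most `γ`: every eigenvector that is orthogonal to the constant function, with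
respect to the stationary distribution (proportional to the weighted degree), has an eigenvalue of
absolute value at most `γ`. -/
def IsTwoSidedSpectralExpander {U : Type} [Fintype U] (w : U → U → ℝ) (γ : ℝ) : Prop :=
  ∀ (μ : ℝ) (f : U → ℝ), f ≠ 0 → ∑ u, (∑ v, w u v) * f u = 0 →
    (∀ u, ∑ v, w u v / (∑ v', w u v') * f v = μ * f u) → |μ| ≤ γ

/-- Two-sided `γ`-local-spectral expansion: for `i ≤ d - 2`, the graph underlying the link of every
`i`-face is a two-sided `γ`-spectral expander. -/
def WeightedComplex.IsLocalSpectralExpander {n d : ℕ} (X : WeightedComplex n d) (γ : ℝ) : Prop :=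
  ∀ i : ℕ, i + 2 ≤ d → ∀ s : X.Face i, IsTwoSidedSpectralExpander (X.link s).edgeWeight γ

/-! ### Averaging operators -/

namespace WeightedComplex

variable {n d : ℕ}

/-- The up operator `U_k : C_k → C_{k+1}`. -/
noncomputable def up (X : WeightedComplex n d) (k : ℕ) : X.Fn k →ₗ[ℝ] X.Fn (k + 1) where
  toFun f y := (1 / ((k : ℝ) + 1)) * ∑ x : X.Face k with x.1 ⊆ y.1, f x
  map_add' f g := by
    funext y
    simp [Finset.sum_add_distrib, mul_add]
  map_smul' a f := by
    funext y
    simp only [Pi.smul_apply, smul_eq_mul, RingHom.id_apply, ← Finset.mul_sum]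
    ring

/-- The down operator `D_{k+1} : C_{k+1} → C_k`. -/
noncomputable def down (X : WeightedComplex n d) (k : ℕ) : X.Fn (k + 1) →ₗ[ℝ] X.Fn k where
  toFun f x := (1 / ((k : ℝ) + 1)) *
    ∑ y : X.Face (k + 1) with x.1 ⊆ y.1, X.prob y.1 / X.prob x.1 * f y
  map_add' f g := by
    funext y
    simp [Finset.sum_add_distrib, mul_add]
  map_smul' a f := by
    funext y
    simp only [Pi.smul_apply, smul_eq_mul, RingHom.id_apply, Finset.mul_sum]
    refine Finset.sum_congr rfl fun _ _ => ?_
    ring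

/-- `U^k_i = U_{k-1} ⋯ U_i : C_i → C_k`. -/
noncomputable def upTo (X : WeightedComplex n d) {i k : ℕ} (h : i ≤ k) : X.Fn i →ₗ[ℝ] X.Fn k :=
  Nat.leRec (motive := fun m _ => X.Fn i →ₗ[ℝ] X.Fn m) LinearMap.id
    (fun m _ g => X.up m ∘ₗ g) h

/-- `D^k_i = D_{i+1} ⋯ D_k : C_k → C_i`. -/
noncomputable def downTo (X : WeightedComplex n d) {i k : ℕ} (h : i ≤ k) : X.Fn k →ₗ[ℝ] X.Fn i :=
  Nat.leRec (motive := fun m _ => X.Fn m →ₗ[ℝ] X.Fn i) LinearMap.id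
    (fun m _ g => g ∘ₗ X.down m) h

/-- The transition probability `M(v, y)` of an operator on `C_k`. -/
noncomputable def entry (X : WeightedComplex n d) {k : ℕ} (M : X.Fn k →ₗ[ℝ] X.Fn k)
    (v y : X.Face k) : ℝ :=
  M (Pi.single y 1) v

end WeightedComplex

/-! ### Higher order random walks -/

/-- Formal words in the averaging operators that lead from level `k` to level `m`; the constructors
append one operator on the left. A pure `k`-dimensional walk is a `WalkWord k k`. -/
inductive WalkWord (k : ℕ) : ℕ → Type
  | nil : WalkWord k k
  | up {m : ℕ} (w : WalkWord k m) : WalkWord k (m + 1)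
  | down {m : ℕ} (w : WalkWord k (m + 1)) : WalkWord k m

namespace WalkWord

variable {k : ℕ}

/-- The number of down operators. -/
def height : {m : ℕ} → WalkWord k m → ℕ
  | _, nil => 0
  | _, up w => w.height
  | _, down w => w.height + 1

/-- The highest level that the walk visits. -/
def maxLevel : {m : ℕ} → WalkWord k m → ℕ
  | _, nil => k
  | _, up (m := m) w => max (m + 1) w.maxLevel
  | _, down w => w.maxLevel

/-- The operator that the word denotes on a given complex. -/
noncomputable def op {n d : ℕ} (X : WeightedComplex n d) :
    {m : ℕ} → WalkWord k m → (X.Fn k →ₗ[ℝ] X.Fn m)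
  | _, nil => LinearMap.id
  | _, up (m := m) w => X.up m ∘ₗ op X w
  | _, down (m := m) w => X.down m ∘ₗ op X w

/-- The approximate eigenvalue `λ_ℓ(Y) = ∏ₛ (1 - ℓ / max {ℓ, i_s - 2s + k + 1})`, the product over
the down operators of `Y`, where `i_s` is the position of the `s`-th one. Here
`i_s - 2s + k + 1 = k + (i_s - s) - (s - 1)` is the level from which this operator goes down. -/
noncomputable def approxEigenvalue (l : ℕ) : {m : ℕ} → WalkWord k m → ℝ
  | _, nil => 1
  | _, up w => approxEigenvalue l w
  | _, down (m := m) w => approxEigenvalue l w * (1 - (l : ℝ) / max (l : ℝ) ((m : ℝ) + 1))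

end WalkWord

/-- Formal linear combinations `∑ α_Y Y` of `k`-dimensional pure walks. -/
abbrev WalkComb (k : ℕ) : Type := WalkWord k k →₀ ℝ

namespace WalkComb

variable {k : ℕ}

/-- The operator `∑ α_Y Y` on a given complex. -/
noncomputable def op {n d : ℕ} (X : WeightedComplex n d) (M : WalkComb k) :
    X.Fn k →ₗ[ℝ] X.Fn k :=
  M.sum fun Y a => a • Y.op X

/-- The height `h(M)`: the maximal height of a pure walk with non-zero coefficient. -/
noncomputable def height (M : WalkComb k) : ℕ := M.support.sup WalkWord.height

/-- The weight `w(M) = ∑ |α_Y|`. -/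
noncomputable def weight (M : WalkComb k) : ℝ := M.sum fun _ a => |a|

/-- The approximate eigenvalue `λ_ℓ(M) = ∑ α_Y λ_ℓ(Y)`. -/
noncomputable def approxEigenvalue (M : WalkComb k) (l : ℕ) : ℝ :=
  M.sum fun Y a => a * Y.approxEigenvalue l

/-- `∑ α_Y Y` is a `k`-dimensional HD-walk on `X`: an affine combination of pure walks on `X` (walks
that stay within the levels `0, …, d`) that is self-adjoint and has non-negative transition
probabilities. -/
def IsHDWalk {n d : ℕ} (X : WeightedComplex n d) (M : WalkComb k) : Prop :=
  (M.sum fun _ a => a) = 1 ∧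
  (∀ Y ∈ M.support, Y.maxLevel ≤ d) ∧
  (∀ f g : X.Fn k, X.inner (M.op X f) g = X.inner f (M.op X g)) ∧
  ∀ v y : X.Face k, 0 ≤ X.entry (M.op X) v y

end WalkComb

/-- The complete complex `J(n,d)`: all `d`-subsets of `[n]`, with the uniform distribution. -/
noncomputable def completeComplex (n d : ℕ) (h : d ≤ n) : WeightedComplex n d where
  top := powersetCard d univ
  card_top t ht := (mem_powersetCard.mp ht).2
  weight _ := 1 / (n.choose d : ℝ)
  weight_pos _ _ := by
    have : 0 < n.choose d := Nat.choose_pos h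
    positivity
  weight_sum := by
    have : (n.choose d : ℝ) ≠ 0 := by exact_mod_cast (Nat.choose_pos h).ne'
    simp [this]

/-- The combination `∑ α_Y Y` is complete: for every `n` there are `n₀ > n` and `d` such that it is
also an HD-walk when taken over `J(n₀, d)`. -/
def WalkComb.IsComplete {k : ℕ} (M : WalkComb k) : Prop :=
  ∀ n : ℕ, ∃ n₀ > n, ∃ (d : ℕ) (h : d ≤ n₀), M.IsHDWalk (completeComplex n₀ d h)

/-! ### Eigenstrips and stripped threshold rank -/

namespace WalkComb

variable {k : ℕ}

/-- `c_max`: the maximum over `0 ≤ ℓ ≤ k` of the error `A γ w(M) h(M) (k + h(M)) binom(k, ℓ)` in the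
approximate eigendecomposition of an HD-walk on a `γ`-local-spectral expander; `A` is the constant
hidden in the `O`-notation. -/
noncomputable def errMax (A γ : ℝ) (M : WalkComb k) : ℝ :=
  ⨆ l : Fin (k + 1), A * γ * M.weight * M.height * (k + M.height) * (k.choose l : ℝ)

/-- `λ_dif`: the smallest distance between distinct approximate eigenvalues. -/
noncomputable def eigDif (M : WalkComb k) : ℝ :=
  sInf {x | ∃ i j : Fin (k + 1), M.approxEigenvalue i ≠ M.approxEigenvalue j ∧
    x = |M.approxEigenvalue i - M.approxEigenvalue j|}

/-- `λ_ratio = max |λ_i| / λ_dif^(1/2)`. -/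
noncomputable def eigRatio (M : WalkComb k) : ℝ :=
  (⨆ i : Fin (k + 1), |M.approxEigenvalue i|) / √M.eigDif

/-- The half-width `e = O((k+1) λ_ratio c_max^(1/2))` of the eigenstrip intervals (there are `k + 1`
spaces in the decomposition); `B` is the constant hidden in the `O`-notation. -/
noncomputable def stripWidth (A B γ : ℝ) (M : WalkComb k) : ℝ :=
  B * (k + 1) * M.eigRatio * √(M.errMax A γ)

/-- The eigenstrip interval `I_{λ_i} = [λ_i - e, λ_i + e]`. -/
noncomputable def stripInterval (A B γ : ℝ) (M : WalkComb k) (i : ℕ) : Set ℝ :=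
  Set.Icc (M.approxEigenvalue i - M.stripWidth A B γ) (M.approxEigenvalue i + M.stripWidth A B γ)

/-- `γ` is small enough for eigenstripping, that is `c_max ≤ λ_dif / (4 (k+1))`, and for the
eigenstrip intervals to be disjoint. Equal approximate eigenvalues have the same interval and are not
compared. -/
def EigenstripsDisjoint (A B γ : ℝ) (M : WalkComb k) : Prop :=
  ∀ i j : Fin (k + 1), M.approxEigenvalue i ≠ M.approxEigenvalue j →
    M.errMax A γ ≤ M.eigDif / (4 * (k + 1)) ∧
    Disjoint (M.stripInterval A B γ i) (M.stripInterval A B γ j)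

/-- The eigenstrip `W^i = Span {φ : Mφ = μφ, μ ∈ I_{λ_i}}`. -/
noncomputable def eigenstrip {n d : ℕ} (X : WeightedComplex n d) (A B γ : ℝ) (M : WalkComb k)
    (i : ℕ) : Submodule ℝ (X.Fn k) :=
  Submodule.span ℝ {φ | ∃ μ ∈ M.stripInterval A B γ i, M.op X φ = μ • φ}

/-- The stripped threshold rank `R_δ(M)`: the number of `0 ≤ i ≤ k` whose eigenstrip contains an
eigenvector with eigenvalue greater than `δ`. -/
noncomputable def stRank {n d : ℕ} (X : WeightedComplex n d) (A B γ : ℝ) (M : WalkComb k)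
    (δ : ℝ) : ℕ :=
  Set.ncard {i : Fin (k + 1) | ∃ f ∈ M.eigenstrip X A B γ i, f ≠ 0 ∧
    ∃ μ : ℝ, M.op X f = μ • f ∧ δ < μ}

end WalkComb

/-! ### Pseudorandomness and expansion -/

namespace WeightedComplex

variable {n d k : ℕ}

/-- The indicator function of a set of `k`-faces. -/
def indicator (X : WeightedComplex n d) (S : Finset (X.Face k)) : X.Fn k :=
  fun s => if s ∈ S then 1 else 0

/-- The density of a set of `k`-faces. -/
noncomputable def density (X : WeightedComplex n d) (S : Finset (X.Face k)) : ℝ :=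
  X.expect (X.indicator S)

/-- `(ε_1, …, ε_r)`-`ℓ2`-pseudorandomness: `Var(D^k_i f) ≤ ε_i |E[f]|` for `1 ≤ i ≤ r`. -/
def IsL2Pseudorandom (X : WeightedComplex n d) (f : X.Fn k) (r : ℕ) (ε : ℕ → ℝ) : Prop :=
  ∀ (i : ℕ) (hik : i ≤ k), 1 ≤ i → i ≤ r → X.var (X.downTo hik f) ≤ ε i * |X.expect f|

/-- `(ε_1, …, ε_r)`-`ℓ∞`-pseudorandomness: `‖D^k_i f - E[f]‖_∞ ≤ ε_i` for `1 ≤ i ≤ r`. -/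
def IsLinftyPseudorandom (X : WeightedComplex n d) (f : X.Fn k) (r : ℕ) (ε : ℕ → ℝ) : Prop :=
  ∀ (i : ℕ) (hik : i ≤ k), 1 ≤ i → i ≤ r → ∀ s : X.Face i, |X.downTo hik f s - X.expect f| ≤ ε i

/-- The weighted edge expansion `φ(S)` of a (non-empty) set `S` of `k`-faces with respect to an
operator `M`: the mean of `M(v, X(k) \ S)` for `v` drawn from the restriction of `Π_k` to `S`. -/
noncomputable def expansion (X : WeightedComplex n d) (M : X.Fn k →ₗ[ℝ] X.Fn k)
    (S : Finset (X.Face k)) : ℝ :=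
  ∑ v ∈ S, X.prob v.1 / (∑ u ∈ S, X.prob u.1) * ∑ y ∈ Sᶜ, X.entry M v y

/-- The canonical walk `N^j_k = D^{k+j}_k U^{k+j}_k`. -/
noncomputable def canonicalWalk (X : WeightedComplex n d) (k j : ℕ) : X.Fn k →ₗ[ℝ] X.Fn k :=
  X.downTo (Nat.le_add_right k j) ∘ₗ X.upTo (Nat.le_add_right k j)

/-- The transition probabilities of the partial-swap walk `S^j_k`: the canonical walk `N^j_k`,
restricted to pairs of faces that meet in exactly `k - j` vertices, and normalized. -/
noncomputable def partialSwap (X : WeightedComplex n d) (k j : ℕ) (s s' : X.Face k) : ℝ :=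
  if (s.1 ∩ s'.1).card + j = k then
    X.entry (X.canonicalWalk k j) s s' /
      ∑ u : X.Face k with (s.1 ∩ u.1).card + j = k, X.entry (X.canonicalWalk k j) s u
  else 0

/-- `B_m`: the `k`-faces that are contained in the first `n / m` vertices. -/
def initialFaces (X : WeightedComplex n d) (k m : ℕ) : Finset (X.Face k) :=
  univ.filter fun s => ∀ v ∈ s.1, (v : ℕ) < n / m

end WeightedComplex

/-- The lower bound
`1 - α - (1-α) δ - c γ - ∑_{1 ≤ i ≤ r} (λ_i(M) - δ) binom(k,i) ε_i` with `c = w(M) h(M)² 2^(C k)`. -/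
noncomputable def expansionBound (C γ δ α : ℝ) {k : ℕ} (M : WalkComb k) (r : ℕ) (ε : ℕ → ℝ) : ℝ :=
  1 - α - (1 - α) * δ - (M.weight * (M.height : ℝ) ^ 2 * (2 : ℝ) ^ (C * k)) * γ
    - ∑ i ∈ Icc 1 r, (M.approxEigenvalue i - δ) * (k.choose i : ℝ) * ε i

/-! Commutation. On a local-spectral expander, `down (m+1) ∘ up (m+1)` differs from `1/(m+2) +
(m+1)/(m+2) up m ∘ down m` by an operator of `L²`-norm at most `γ`. The quadratic form of the
difference is a sum over faces of the quadratic forms of the link graphs, each without its constant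
component (`abs_inner_comm_le`, `approxComm`). Moving all down operators to the right therefore
brings a word into a normal form `∑ a_j U^k_j D^k_j`, with one error `γ` per commutation
(`word_normalForm`). On the coefficients, a down operator from level `m+1` multiplies the number `∑
a_j binom(j,l)/binom(k,l)` by `1 - l/max(l,m+1)`, which is the factor in `λ_l(Y)`. Binomial
inversion produces normal forms `π_0, …, π_k` (`proj`) that are self-adjoint and add up to the
identity exactly, with `π_l² ≈ π_l`, `M ≈ ∑ λ_l(M) π_l` and `M π_l ≈ λ_l(M) π_l`.

The bound. For `f = 1_S` put `q_l = ⟨f, π_l f⟩`. Then `q_0 = α²` and `∑ q_l = α` exactly, `q_l ≥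
-O(γ) α`, and `q_l ≤ binom(k,l) (ε_l + O(γ)) α` by pseudorandomness, since `‖D^k_l f‖²` is a
non-negative combination of the `q_i` in which `q_l` has coefficient `1/binom(k,l)`. Hence `1 - φ(S)
= ⟨f, M f⟩/α` is at most `α + (1-α) δ + ∑_{l ≥ 1} (λ_l - δ) q_l/α + O(γ)`, and each level is
estimated separately (`level_contribution_le`).

The true spectrum enters only through `r`. If `l ≤ r` and `λ_l < δ`, a counted strip of index at
least `l` has an eigenvalue above `δ`. Disjointness of the strips and monotonicity of the `λ_i` then
put `λ_l` within `O(γ)` of `δ`. If `l > r` and `λ_l > δ`, some index `i ≤ l` is not counted. For `i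
< l` the projection `π_i` is not small, so `λ_i` is close to the spectrum, and this forces `λ_l - δ
= O(γ)`. For `i = l` the projection may vanish, but then either `λ_l` is close to an eigenvalue in
its strip or `π_l f` is small.

Monotonicity and non-negativity of the `λ_l` come from completeness. On large complete complexes the
probability of moving to a face that shares `t` vertices with the current one tends to the `t`-th
coefficient of the normal form of `∑ λ_l π_l`. So these coefficients are non-negative, and the `λ_l`
are the corresponding combinations of `binom(t,l)/binom(k,l)`, which decrease in `l`.

Tightness. Binomial inversion writes the partial-swap walk as a combination of canonical walks with
`λ_l binom(k,l) = binom(t,l)`. For `B_m` one may take `ε_i = m^{-(k-i)}`, so by the binomial theorem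
`1 - L` is at most about `m^{-(k-t)} (1 + 1/m)^t`, whereas `1 - φ(B_m)` tends to `m^{-(k-t)}` as `n`
grows. -/

/-! ### Coefficients of normal forms -/

/-- Orthogonality of the binomial coefficients. -/
theorem sum_neg_one_pow_choose_mul_choose {K i : ℕ} (hi : i ≤ K) (l : ℕ) :
    ∑ j ∈ range (K + 1), (-1 : ℝ) ^ (i + j) * (i.choose j : ℝ) * (j.choose l : ℝ)
      = if i = l then 1 else 0 := by
  have h1 : ∑ j ∈ range (K + 1), (-1 : ℝ) ^ (i + j) * (i.choose j : ℝ) * (j.choose l : ℝ)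
      = ∑ j ∈ range (i + 1), (-1 : ℝ) ^ (i + j) * (i.choose j : ℝ) * (j.choose l : ℝ) := by
    symm
    apply sum_subset
    · intro x hx; simp at hx ⊢; omega
    · intro x _ hx
      rw [Nat.choose_eq_zero_of_lt (by simpa using hx : i < x)]; simp
  rw [h1]
  rcases lt_or_ge i l with h | h
  · rw [if_neg h.ne]
    refine sum_eq_zero fun j hj => ?_
    rw [Nat.choose_eq_zero_of_lt (show j < l by have := mem_range.mp hj; omega)]; simp
  · obtain ⟨a, rfl⟩ := Nat.exists_eq_add_of_le h
    rw [add_assoc, sum_range_add]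
    have h2 : ∑ x ∈ range l, (-1 : ℝ) ^ (l + a + x) * ((l + a).choose x : ℝ) * (x.choose l : ℝ)
        = 0 := sum_eq_zero fun j hj => by
      rw [Nat.choose_eq_zero_of_lt (mem_range.mp hj)]; simp
    rw [h2, zero_add]
    have h3 : ∀ x ∈ range (a + 1), (-1 : ℝ) ^ (l + a + (l + x)) * ((l + a).choose (l + x) : ℝ) *
        ((l + x).choose l : ℝ) = (-1) ^ a * ((l + a).choose l : ℝ) * ((-1) ^ x * (a.choose x : ℝ)) := by
      intro x hx
      have hx' : x ≤ a := by have := mem_range.mp hx; omega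
      have h4 := Nat.choose_mul (n := l + a) (k := l + x) (s := l) (by omega)
      have h5 : ((l + a).choose (l + x) : ℝ) * ((l + x).choose l : ℝ)
          = ((l + a).choose l : ℝ) * (a.choose x : ℝ) := by
        rw [show l + a - l = a by omega, show l + x - l = x by omega] at h4
        exact_mod_cast h4
      rw [mul_assoc, h5, show l + a + (l + x) = 2 * l + (a + x) by ring, pow_add, pow_mul, pow_add]
      simp; ring
    rw [sum_congr rfl h3, ← mul_sum]
    have h6 : ∑ x ∈ range (a + 1), ((-1 : ℝ) ^ x * (a.choose x : ℝ)) = if a = 0 then 1 else 0 := by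
      have := @Int.alternating_sum_range_choose a
      exact_mod_cast this
    rw [h6]
    rcases Nat.eq_zero_or_pos a with rfl | ha
    · simp
    · rw [if_neg ha.ne', if_neg (by omega), mul_zero]

/-- The action of the down operator `C_{m+1} → C_m` on the coefficients of a normal form. -/
noncomputable def downCoef (m : ℕ) (a : ℕ → ℝ) (j : ℕ) : ℝ :=
  ((m : ℝ) + 1 - j) / (m + 1) * a j + ((j : ℝ) + 1) / (m + 1) * a (j + 1)

/-- The action of a word on the coefficients of a normal form. -/
noncomputable def WalkWord.coef {k : ℕ} : {m : ℕ} → WalkWord k m → (ℕ → ℝ) → ℕ → ℝ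
  | _, nil, a => a
  | _, up w, a => w.coef a
  | _, down (m := m) w, a => downCoef m (w.coef a)

/-- The eigenvalue on the `l`-th level of the normal form with coefficients `a`. -/
noncomputable def coefEigenvalue (k : ℕ) (a : ℕ → ℝ) (l : ℕ) : ℝ :=
  ∑ j ∈ range (k + 1), a j * ((j.choose l : ℝ) / (k.choose l : ℝ))

/-- Coefficients of a normal form of an operator `C_k → C_m`. -/
def IsCoef (k m : ℕ) (a : ℕ → ℝ) : Prop := ∀ j, k < j ∨ m < j → a j = 0

/-- The factor `m + 1 - j` vanishes at `j = m + 1`, so the support shrinks together with the target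
level. -/
theorem IsCoef.downCoef {k m : ℕ} {a : ℕ → ℝ} (h : IsCoef k (m + 1) a) :
    IsCoef k m (downCoef m a) := by
  intro j hj
  rw [_root_.downCoef]
  have h1 : a (j + 1) = 0 := h _ (by omega)
  rw [h1, mul_zero, add_zero]
  rcases eq_or_ne j (m + 1) with rfl | hne
  · push_cast; simp
  · rw [h j (by omega), mul_zero]

theorem WalkWord.isCoef_coef {k : ℕ} {a : ℕ → ℝ} (ha : IsCoef k k a) :
    {m : ℕ} → (w : WalkWord k m) → IsCoef k m (w.coef a)
  | _, nil => ha
  | _, up w => fun j hj => isCoef_coef ha w j (by omega)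
  | _, down w => (isCoef_coef ha w).downCoef

theorem sum_range_shift {k : ℕ} (F : ℕ → ℝ) (h : F (k + 1) = 0) :
    ∑ j ∈ range (k + 1), F (j + 1) = (∑ j ∈ range (k + 1), F j) - F 0 := by
  have h1 := sum_range_succ' F (k + 1)
  have h2 := sum_range_succ F (k + 1)
  linarith

/-- Collected by the old index `j`, the claim is `(m+1-j) binom(j,l) + j binom(j-1,l) = (m+1-l)
binom(j,l)`. This is why the approximate eigenvalue of a word is a product over its down operators.
-/
theorem coefEigenvalue_downCoef {k m : ℕ} {a : ℕ → ℝ} (h : IsCoef k (m + 1) a) {l : ℕ} :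
    coefEigenvalue k (downCoef m a) l
      = coefEigenvalue k a l * (1 - (l : ℝ) / max (l : ℝ) ((m : ℝ) + 1)) := by
  have hm : (m : ℝ) + 1 ≠ 0 := by positivity
  have h1 : coefEigenvalue k (downCoef m a) l = ∑ j ∈ range (k + 1),
      a j * ((((m : ℝ) + 1 - j) / (m + 1) * (j.choose l : ℝ)
        + (j : ℝ) / (m + 1) * ((j - 1).choose l : ℝ)) / (k.choose l : ℝ)) := by
    have h2 := sum_range_shift (k := k) (fun j => (j : ℝ) / (m + 1) * a j *
      (((j - 1).choose l : ℝ) / (k.choose l : ℝ))) (by simp [h (k + 1) (by omega)])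
    simp only [Nat.cast_zero, zero_div, zero_mul, sub_zero, Nat.add_sub_cancel] at h2
    simp only [coefEigenvalue, downCoef, add_mul, sum_add_distrib]
    push_cast at h2
    rw [h2, ← sum_add_distrib]
    exact sum_congr rfl fun j _ => by ring
  rw [h1, coefEigenvalue, sum_mul]
  refine sum_congr rfl fun j _ => ?_
  by_cases hj : m + 1 < j
  · simp [h j (Or.inr hj)]
  rw [mul_assoc]
  congr 1
  refine (fun x y z c (h : x = y * z) => by rw [h]; ring : ∀ x y z c : ℝ, x = y * z → x / c = y / c * z)
    _ _ _ _ ?_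
  rcases le_or_gt l (m + 1) with hl | hl
  · have hl' : (l : ℝ) ≤ (m : ℝ) + 1 := by exact_mod_cast hl
    rw [max_eq_right hl']
    have key : (j : ℝ) * ((j - 1).choose l : ℝ) = ((j : ℝ) - l) * (j.choose l : ℝ) := by
      rcases lt_or_ge j l with h3 | h3
      · rw [Nat.choose_eq_zero_of_lt h3, Nat.choose_eq_zero_of_lt (by omega : j - 1 < l)]; simp
      · rcases Nat.eq_zero_or_pos j with rfl | hj0
        · have : l = 0 := by omega
          subst this; simp
        · obtain ⟨b, rfl⟩ : ∃ b, j = b + 1 := ⟨j - 1, by omega⟩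
          have h4 := Nat.choose_mul_succ_eq b l
          have h5 : ((b.choose l : ℕ) : ℝ) * ((b + 1 : ℕ) : ℝ)
              = ((b + 1).choose l : ℕ) * ((b + 1 - l : ℕ) : ℝ) := by exact_mod_cast h4
          rw [Nat.cast_sub h3] at h5
          rw [Nat.add_sub_cancel]
          linarith
    field_simp
    linear_combination key
  -- Here `j ≤ m + 1 < l`, so both binomials vanish, in agreement with the factor `1 - l/max(l, m+1)
  -- = 0`.
  · have hl' : (m : ℝ) + 1 ≤ l := by exact_mod_cast hl.le
    have hl0 : (l : ℝ) ≠ 0 := by have : 0 < l := by omega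
                                 positivity
    rw [max_eq_left hl', div_self hl0, Nat.choose_eq_zero_of_lt (by omega : j < l),
      Nat.choose_eq_zero_of_lt (by omega : j - 1 < l)]
    simp

theorem WalkWord.coefEigenvalue_coef {k l : ℕ} {a : ℕ → ℝ} (ha : IsCoef k k a) :
    {m : ℕ} → (w : WalkWord k m) →
      coefEigenvalue k (w.coef a) l = w.approxEigenvalue l * coefEigenvalue k a l
  | _, nil => by simp [coef, approxEigenvalue]
  | _, up w => by rw [coef, approxEigenvalue, coefEigenvalue_coef ha w]
  | _, down w => by
    rw [coef, approxEigenvalue, coefEigenvalue_downCoef (isCoef_coef ha w),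
      coefEigenvalue_coef ha w]
    ring

/-- The `l1`-norm of coefficients. -/
noncomputable def coefNorm (k : ℕ) (a : ℕ → ℝ) : ℝ := ∑ j ∈ range (k + 1), |a j|

theorem coefNorm_nonneg (k : ℕ) (a : ℕ → ℝ) : 0 ≤ coefNorm k a :=
  sum_nonneg fun _ _ => abs_nonneg _

/-- A down operator leaves the fraction `(m+1-j)/(m+1)` of the coefficient at `j` in place and moves
the rest to `j - 1`, so no mass is created. This keeps the errors linear in the height. -/
theorem coefNorm_downCoef_le {k m : ℕ} {a : ℕ → ℝ} (h : IsCoef k (m + 1) a) :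
    coefNorm k (downCoef m a) ≤ coefNorm k a := by
  have hm : (0 : ℝ) < (m : ℝ) + 1 := by positivity
  have h2 := sum_range_shift (k := k) (fun j => (j : ℝ) / (m + 1) * |a j|)
    (by simp [h (k + 1) (by omega)])
  simp only [Nat.cast_zero, zero_div, zero_mul, sub_zero] at h2
  push_cast at h2
  have h3 : ∀ j ∈ range (k + 1), |downCoef m a j| ≤
      ((m : ℝ) + 1 - j) / (m + 1) * |a j| + ((j : ℝ) + 1) / (m + 1) * |a (j + 1)| := by
    intro j _
    rw [downCoef]
    refine (abs_add_le _ _).trans ?_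
    rw [abs_mul, abs_mul, abs_of_nonneg (show (0 : ℝ) ≤ ((j : ℝ) + 1) / (m + 1) by positivity)]
    by_cases hj : m + 1 < j
    · simp [h j (Or.inr hj)]
    · have : (j : ℝ) ≤ m + 1 := by exact_mod_cast (not_lt.mp hj)
      rw [abs_of_nonneg (div_nonneg (by linarith) hm.le)]
  refine (sum_le_sum h3).trans ?_
  rw [sum_add_distrib, h2, ← sum_add_distrib, coefNorm]
  refine sum_le_sum fun j _ => le_of_eq ?_
  field_simp
  ring

theorem WalkWord.coefNorm_coef_le {k : ℕ} {a : ℕ → ℝ} (ha : IsCoef k k a) :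
    {m : ℕ} → (w : WalkWord k m) → coefNorm k (w.coef a) ≤ coefNorm k a
  | _, nil => le_rfl
  | _, up w => coefNorm_coef_le ha w
  | _, down w => (coefNorm_downCoef_le (isCoef_coef ha w)).trans (coefNorm_coef_le ha w)

/-- The coefficients of the approximate projection to the `i`-th level. -/
noncomputable def projCoef (k i j : ℕ) : ℝ :=
  (-1 : ℝ) ^ (i + j) * (k.choose i : ℝ) * (i.choose j : ℝ)

theorem isCoef_projCoef {k i : ℕ} (hi : i ≤ k) : IsCoef k k (projCoef k i) := by
  intro j hj
  rw [projCoef, Nat.choose_eq_zero_of_lt (by omega : i < j)]; simp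

/-- The signs in `projCoef` are those of binomial inversion, so the associated operator has
eigenvalue one on its own level and zero on the others. -/
theorem coefEigenvalue_projCoef {k i l : ℕ} (hi : i ≤ k) :
    coefEigenvalue k (projCoef k i) l = if i = l then 1 else 0 := by
  have h := sum_neg_one_pow_choose_mul_choose hi l
  have h1 : coefEigenvalue k (projCoef k i) l = (k.choose i : ℝ) / (k.choose l : ℝ) *
      ∑ j ∈ range (k + 1), (-1 : ℝ) ^ (i + j) * (i.choose j : ℝ) * (j.choose l : ℝ) := by
    rw [coefEigenvalue, mul_sum]
    exact sum_congr rfl fun j _ => by rw [projCoef]; ring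
  rw [h1, h]
  split_ifs with hil
  · subst hil
    have : (k.choose i : ℝ) ≠ 0 := by exact_mod_cast (Nat.choose_pos hi).ne'
    rw [div_self this, one_mul]
  · rw [mul_zero]

/-- The inversion in the other direction: the coefficients of a normal form are determined by its `k
+ 1` eigenvalues. -/
theorem sum_coefEigenvalue_mul_projCoef {k : ℕ} {a : ℕ → ℝ} {j : ℕ} (hj : j ≤ k) :
    ∑ l ∈ range (k + 1), coefEigenvalue k a l * projCoef k l j = a j := by
  have h1 : ∀ l ∈ range (k + 1), coefEigenvalue k a l * projCoef k l j
      = ∑ i ∈ range (k + 1), a i * ((-1) ^ (i + j) *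
        ((-1) ^ (i + l) * (i.choose l : ℝ) * (l.choose j : ℝ))) := by
    intro l hl
    have hl' : l ≤ k := by have := mem_range.mp hl; omega
    have : (k.choose l : ℝ) ≠ 0 := by exact_mod_cast (Nat.choose_pos hl').ne'
    rw [coefEigenvalue, sum_mul]
    refine sum_congr rfl fun i _ => ?_
    rw [projCoef]
    have h2 : (-1 : ℝ) ^ (i + j) * (-1) ^ (i + l) = (-1) ^ (l + j) := by
      rw [← pow_add, show i + j + (i + l) = 2 * i + (l + j) by ring, pow_add, pow_mul]; simp
    rw [← h2]
    field_simp
  rw [sum_congr rfl h1, sum_comm]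
  have h3 : ∀ i ∈ range (k + 1), ∑ l ∈ range (k + 1), a i * ((-1) ^ (i + j) *
        ((-1) ^ (i + l) * (i.choose l : ℝ) * (l.choose j : ℝ))) = if i = j then a i else 0 := by
    intro i hi
    rw [← mul_sum, ← mul_sum,
      sum_neg_one_pow_choose_mul_choose (by have := mem_range.mp hi; omega) j]
    split_ifs with h
    · subst h
      rw [← two_mul, pow_mul]; simp
    · simp
  rw [sum_congr rfl h3, sum_ite_eq' (range (k + 1)) j, if_pos (by simp; omega)]

theorem coefNorm_projCoef_le {k i : ℕ} (hi : i ≤ k) : coefNorm k (projCoef k i) ≤ 4 ^ k := by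
  have h1 : coefNorm k (projCoef k i) = (k.choose i : ℝ) * ∑ j ∈ range (k + 1), (i.choose j : ℝ) := by
    rw [coefNorm, mul_sum]
    refine sum_congr rfl fun j _ => ?_
    rw [projCoef, abs_mul, abs_mul, abs_pow]; simp
  have h2 : ∑ j ∈ range (k + 1), (i.choose j : ℝ) = 2 ^ i := by
    have h3 : ∑ j ∈ range (i + 1), i.choose j = ∑ j ∈ range (k + 1), i.choose j := by
      apply sum_subset
      · intro x hx; simp at hx ⊢; omega
      · intro x _ hx
        exact Nat.choose_eq_zero_of_lt (by simpa using hx)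
    have := Nat.sum_range_choose i
    rw [h3] at this
    exact_mod_cast this
  rw [h1, h2]
  have h4 : (k.choose i : ℝ) ≤ 2 ^ k := by exact_mod_cast Nat.choose_le_two_pow k i
  calc (k.choose i : ℝ) * 2 ^ i ≤ 2 ^ k * 2 ^ k := by
        gcongr; norm_num
    _ = 4 ^ k := by rw [← mul_pow]; norm_num

/-! ### Levels and heights of words; lower and canonical walks. -/

theorem WalkWord.maxLevel_le {k : ℕ} : {m : ℕ} → (w : WalkWord k m) → w.maxLevel ≤ m + w.height
  | _, nil => by simp [maxLevel, height]
  | _, up w => by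
    have := maxLevel_le w
    simp only [maxLevel, height]; omega
  | _, down w => by
    have := maxLevel_le w
    simp only [maxLevel, height]; omega

theorem WalkWord.le_maxLevel {k : ℕ} : {m : ℕ} → (w : WalkWord k m) → k ≤ w.maxLevel ∧ m ≤ w.maxLevel
  | _, nil => by simp [maxLevel]
  | _, up w => by
    have := le_maxLevel w
    simp only [maxLevel]; omega
  | _, down w => by
    have := le_maxLevel w
    simp only [maxLevel]; omega

/-- Append the down operators that lead to the level `j`. -/
def WalkWord.downs {k m : ℕ} (w : WalkWord k m) {j : ℕ} (h : j ≤ m) : WalkWord k j :=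
  Nat.decreasingInduction (motive := fun i _ => WalkWord k i) (fun _ _ w => w.down) w h

/-- Append the up operators that lead to the level `j`. -/
def WalkWord.ups {k m : ℕ} (w : WalkWord k m) {j : ℕ} (h : m ≤ j) : WalkWord k j :=
  Nat.leRec (motive := fun i _ => WalkWord k i) w (fun _ _ w => w.up) h

@[simp] theorem WalkWord.ups_self {k m : ℕ} (w : WalkWord k m) : w.ups le_rfl = w :=
  Nat.leRec_self _ _

@[simp] theorem WalkWord.downs_self {k m : ℕ} (w : WalkWord k m) : w.downs le_rfl = w :=
  Nat.decreasingInduction_self _ _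

theorem WalkWord.ups_succ {k m : ℕ} (w : WalkWord k m) {j : ℕ} (h : m ≤ j) :
    w.ups (h.trans j.le_succ) = (w.ups h).up :=
  Nat.leRec_succ _ _ _

theorem WalkWord.downs_succ_left {k m : ℕ} (w : WalkWord k m) {j : ℕ} (h : j + 1 ≤ m) :
    w.downs (j.le_succ.trans h) = (w.downs h).down :=
  Nat.decreasingInduction_succ_left _ _ _ _

/-- A statement that passes from `w` to `w.up` passes to `w.ups h`. -/
theorem WalkWord.ups_induction {k m : ℕ} (w : WalkWord k m) (P : ∀ i, WalkWord k i → Prop)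
    (h0 : P m w) (h1 : ∀ i (w : WalkWord k i), m ≤ i → P i w → P (i + 1) w.up) {j : ℕ} (h : m ≤ j) :
    P j (w.ups h) := by
  induction j, h using Nat.le_induction with
  | base => rwa [ups_self]
  | succ i hi ih => rw [ups_succ w hi]; exact h1 _ _ hi ih

/-- A statement that passes from `w` to `w.down` passes to `w.downs h`. -/
theorem WalkWord.downs_induction {k m : ℕ} (w : WalkWord k m) (P : ∀ i, WalkWord k i → Prop)
    (h0 : P m w) (h1 : ∀ i (w : WalkWord k (i + 1)), i + 1 ≤ m → P (i + 1) w → P i w.down) {j : ℕ}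
    (h : j ≤ m) : P j (w.downs h) := by
  induction h using Nat.decreasingInduction with
  | self => rwa [downs_self]
  | of_succ i hi ih => rw [downs_succ_left w hi]; exact h1 _ _ hi ih

theorem WalkWord.height_ups {k m : ℕ} (w : WalkWord k m) {j : ℕ} (h : m ≤ j) :
    (w.ups h).height = w.height :=
  w.ups_induction (fun _ v => v.height = w.height) rfl (fun _ _ _ h => h) h

theorem WalkWord.height_downs {k m : ℕ} (w : WalkWord k m) {j : ℕ} (h : j ≤ m) :
    (w.downs h).height + j = w.height + m :=
  w.downs_induction (fun i v => v.height + i = w.height + m) rfl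
    (fun i v _ h => by rw [height]; omega) h

theorem WalkWord.maxLevel_ups {k m : ℕ} (w : WalkWord k m) {j : ℕ} (h : m ≤ j) :
    (w.ups h).maxLevel = max j w.maxLevel :=
  w.ups_induction (fun i v => v.maxLevel = max i w.maxLevel)
    (max_eq_right (w.le_maxLevel).2).symm (fun i v _ h => by rw [maxLevel, h]; omega) h

theorem WalkWord.maxLevel_downs {k m : ℕ} (w : WalkWord k m) {j : ℕ} (h : j ≤ m) :
    (w.downs h).maxLevel = w.maxLevel :=
  w.downs_induction (fun _ v => v.maxLevel = w.maxLevel) rfl (fun _ _ _ h => h) h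

theorem WalkWord.approxEigenvalue_ups {k m : ℕ} (w : WalkWord k m) {j : ℕ} (h : m ≤ j) (l : ℕ) :
    (w.ups h).approxEigenvalue l = w.approxEigenvalue l :=
  w.ups_induction (fun _ v => v.approxEigenvalue l = w.approxEigenvalue l) rfl (fun _ _ _ h => h) h

/-- The factor of the step from `i + 1` to `i` is `binom(i,l)/binom(i+1,l)`, and the product
telescopes. -/
theorem WalkWord.approxEigenvalue_downs {k m : ℕ} (w : WalkWord k m) {j : ℕ} (h : j ≤ m) {l : ℕ}
    (hl : l ≤ m) :
    (w.downs h).approxEigenvalue l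
      = w.approxEigenvalue l * ((j.choose l : ℝ) / (m.choose l : ℝ)) := by
  have hc : (m.choose l : ℝ) ≠ 0 := by exact_mod_cast (Nat.choose_pos hl).ne'
  refine w.downs_induction (fun i v => v.approxEigenvalue l
    = w.approxEigenvalue l * ((i.choose l : ℝ) / (m.choose l : ℝ))) ?_ ?_ h
  · rw [div_self hc, mul_one]
  · intro i v _ hv
    have hi : (i : ℝ) + 1 ≠ 0 := by positivity
    rw [approxEigenvalue, hv]
    have key : ((i + 1).choose l : ℝ) * (1 - (l : ℝ) / max (l : ℝ) ((i : ℝ) + 1))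
        = (i.choose l : ℝ) := by
      rcases le_or_gt l (i + 1) with h | h
      · have h4 := Nat.choose_mul_succ_eq i l
        have h5 : ((i.choose l : ℕ) : ℝ) * ((i + 1 : ℕ) : ℝ)
            = ((i + 1).choose l : ℕ) * ((i + 1 - l : ℕ) : ℝ) := by exact_mod_cast h4
        rw [Nat.cast_sub h] at h5
        push_cast at h5
        rw [max_eq_right (by exact_mod_cast h)]
        field_simp
        linarith
      · rw [Nat.choose_eq_zero_of_lt h, Nat.choose_eq_zero_of_lt (by omega)]; simp
    rw [← key]; ring

/-- The lower walk `U^k_j D^k_j` as a word. -/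
def WalkWord.lower {k j : ℕ} (h : j ≤ k) : WalkWord k k := ((nil (k := k)).downs h).ups h

/-- The canonical walk `D^{k+i}_k U^{k+i}_k` as a word. -/
def WalkWord.canonical (k i : ℕ) : WalkWord k k :=
  ((nil (k := k)).ups (Nat.le_add_right k i)).downs (Nat.le_add_right k i)

theorem WalkWord.height_lower {k j : ℕ} (h : j ≤ k) : (lower h).height = k - j := by
  have := (nil (k := k)).height_downs h
  rw [lower, height_ups]
  simp only [height] at this
  omega

theorem WalkWord.maxLevel_lower {k j : ℕ} (h : j ≤ k) : (lower h).maxLevel = k := by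
  rw [lower, maxLevel_ups, maxLevel_downs, maxLevel]
  omega

theorem WalkWord.approxEigenvalue_lower {k j l : ℕ} (h : j ≤ k) (hl : l ≤ k) :
    (lower h).approxEigenvalue l = (j.choose l : ℝ) / (k.choose l : ℝ) := by
  rw [lower, approxEigenvalue_ups, approxEigenvalue_downs _ _ hl, approxEigenvalue, one_mul]

theorem WalkWord.maxLevel_canonical (k i : ℕ) : (canonical k i).maxLevel = k + i := by
  rw [canonical, maxLevel_downs, maxLevel_ups, maxLevel]
  omega

theorem isCoef_single {k j : ℕ} (h : j ≤ k) : IsCoef k k (Pi.single j 1) := by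
  intro i hi
  exact Pi.single_eq_of_ne (by omega) _

/-- These are the coefficients of the lower walk `U^k_j D^k_j`; the case `j = k` is the identity,
with all eigenvalues equal to one. -/
theorem coefEigenvalue_single {k j l : ℕ} (h : j ≤ k) :
    coefEigenvalue k (Pi.single j 1) l = (j.choose l : ℝ) / (k.choose l : ℝ) := by
  rw [coefEigenvalue, sum_eq_single j]
  · simp
  · intro i _ hi
    rw [Pi.single_eq_of_ne hi, zero_mul]
  · intro hj; exact absurd (mem_range.mpr (by omega)) hj

theorem coefNorm_single {k j : ℕ} (h : j ≤ k) : coefNorm k (Pi.single j 1) = 1 := by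
  rw [coefNorm, sum_eq_single j]
  · simp
  · intro i _ hi
    rw [Pi.single_eq_of_ne hi, abs_zero]
  · intro hj; exact absurd (mem_range.mpr (by omega)) hj

/-! ### Normal forms of words -/

namespace WeightedComplex

variable {n d : ℕ} (X : WeightedComplex n d)

@[simp] theorem upTo_self (i : ℕ) : X.upTo (le_refl i) = LinearMap.id := Nat.leRec_self _ _

@[simp] theorem downTo_self (i : ℕ) : X.downTo (le_refl i) = LinearMap.id := Nat.leRec_self _ _

theorem upTo_succ {i k : ℕ} (h : i ≤ k) :
    X.upTo (h.trans k.le_succ) = X.up k ∘ₗ X.upTo h := Nat.leRec_succ _ _ _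

theorem downTo_succ {i k : ℕ} (h : i ≤ k) :
    X.downTo (h.trans k.le_succ) = X.downTo h ∘ₗ X.down k := Nat.leRec_succ _ _ _

theorem downTo_comp {i j k : ℕ} (hij : i ≤ j) (hjk : j ≤ k) :
    X.downTo hij ∘ₗ X.downTo hjk = X.downTo (hij.trans hjk) := by
  induction k, hjk using Nat.le_induction with
  | base => rw [downTo_self, LinearMap.comp_id]
  | succ k hjk ih => rw [downTo_succ X hjk, ← LinearMap.comp_assoc, ih, downTo_succ X (hij.trans hjk)]

theorem downTo_succ_self (i : ℕ) : X.downTo (Nat.le_succ i) = X.down i := by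
  rw [downTo_succ X le_rfl, downTo_self, LinearMap.id_comp]

theorem upTo_succ_self (i : ℕ) : X.upTo (Nat.le_succ i) = X.up i := by
  rw [upTo_succ X le_rfl, upTo_self, LinearMap.comp_id]

theorem downTo_succ_left {i k : ℕ} (h : i + 1 ≤ k) :
    X.downTo (i.le_succ.trans h) = X.down i ∘ₗ X.downTo h := by
  rw [← downTo_succ_self, downTo_comp]

/-- `U^m_j`, extended by zero. -/
noncomputable def upFrom (j m : ℕ) : X.Fn j →ₗ[ℝ] X.Fn m := if h : j ≤ m then X.upTo h else 0

/-- `D^k_j`, extended by zero. -/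
noncomputable def downFrom (k j : ℕ) : X.Fn k →ₗ[ℝ] X.Fn j := if h : j ≤ k then X.downTo h else 0

theorem upFrom_of_le {j m : ℕ} (h : j ≤ m) : X.upFrom j m = X.upTo h := dif_pos h

theorem upFrom_of_lt {j m : ℕ} (h : m < j) : X.upFrom j m = 0 := dif_neg (by omega)

theorem downFrom_of_le {k j : ℕ} (h : j ≤ k) : X.downFrom k j = X.downTo h := dif_pos h

theorem upFrom_succ {j m : ℕ} (h : j ≤ m) (g : X.Fn j) :
    X.upFrom j (m + 1) g = X.up m (X.upFrom j m g) := by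
  rw [upFrom_of_le X h, upFrom_of_le X (h.trans m.le_succ), upTo_succ X h, LinearMap.comp_apply]

/-- The operator `C_k → C_m` in normal form with coefficients `a`. -/
noncomputable def normalForm (k m : ℕ) (a : ℕ → ℝ) : X.Fn k →ₗ[ℝ] X.Fn m :=
  ∑ j ∈ range (k + 1), a j • (X.upFrom j m ∘ₗ X.downFrom k j)

theorem normalForm_apply (k m : ℕ) (a : ℕ → ℝ) (g : X.Fn k) :
    X.normalForm k m a g = ∑ j ∈ range (k + 1), a j • X.upFrom j m (X.downFrom k j g) := by
  simp [normalForm, LinearMap.sum_apply]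

/-- Seminorms for which the averaging operators up to the level `L` are contractions and commute up
to `γ`. -/
structure ApproxComm (L : ℕ) (γ : ℝ) (p : ∀ m, Seminorm ℝ (X.Fn m)) : Prop where
  nonneg : 0 ≤ γ
  up_le : ∀ m g, m + 1 ≤ L → p (m + 1) (X.up m g) ≤ p m g
  down_le : ∀ m g, m + 1 ≤ L → p m (X.down m g) ≤ p (m + 1) g
  down_up_zero : 1 ≤ L → ∀ g, X.down 0 (X.up 0 g) = g
  comm : ∀ m g, m + 2 ≤ L → p (m + 1) (X.down (m + 1) (X.up (m + 1) g) - (1 / ((m : ℝ) + 2)) • g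
    - (((m : ℝ) + 1) / (m + 2)) • X.up m (X.down m g)) ≤ γ * p (m + 1) g

namespace ApproxComm

variable {X} {L : ℕ} {γ : ℝ} {p : ∀ m, Seminorm ℝ (X.Fn m)}

theorem upTo_le (h : X.ApproxComm L γ p) {j m : ℕ} (hjm : j ≤ m) (hm : m ≤ L) (g : X.Fn j) :
    p m (X.upTo hjm g) ≤ p j g := by
  induction m, hjm using Nat.le_induction with
  | base => simp
  | succ m hjm ih =>
    rw [upTo_succ X hjm]
    exact (h.up_le _ _ hm).trans (ih (by omega))

theorem upFrom_le (h : X.ApproxComm L γ p) {j m : ℕ} (hm : m ≤ L) (g : X.Fn j) :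
    p m (X.upFrom j m g) ≤ p j g := by
  rcases le_or_gt j m with hj | hj
  · rw [upFrom_of_le X hj]; exact h.upTo_le hj hm g
  · rw [upFrom_of_lt X hj]; simp

theorem downTo_le (h : X.ApproxComm L γ p) {j k : ℕ} (hjk : j ≤ k) (hk : k ≤ L) (g : X.Fn k) :
    p j (X.downTo hjk g) ≤ p k g := by
  induction k, hjk using Nat.le_induction with
  | base => simp
  | succ k hjk ih =>
    rw [downTo_succ X hjk]
    exact (ih (by omega) _).trans (h.down_le _ _ hk)

theorem downFrom_le (h : X.ApproxComm L γ p) {j k : ℕ} (hk : k ≤ L) (g : X.Fn k) :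
    p j (X.downFrom k j g) ≤ p k g := by
  rcases le_or_gt j k with hj | hj
  · rw [downFrom_of_le X hj]; exact h.downTo_le hj hk g
  · rw [downFrom, dif_neg (by omega)]; simp

/-- A down operator passes a composition of up operators. -/
theorem down_upFrom (h : X.ApproxComm L γ p) {j m : ℕ} (hjm : j ≤ m) (hm : m + 1 ≤ L) (g : X.Fn j) :
    p m (X.down m (X.upFrom j (m + 1) g) - (((m : ℝ) + 1 - j) / (m + 1)) • X.upFrom j m g
      - ((j : ℝ) / (m + 1)) • X.upFrom (j - 1) m (X.downFrom j (j - 1) g))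
      ≤ ((m : ℝ) + 1 - j) * γ * p j g := by
  induction m, hjm using Nat.le_induction with
  | base =>
    -- The commutation rule starts at level one. On level zero the composition is exactly the
    -- identity, so there is no error.
    rcases j with _ | j
    · have h0 : X.upFrom 0 (0 + 1) g = X.up 0 g := by
        rw [X.upFrom_of_le (Nat.le_succ 0), upTo_succ_self]
      have h1 : X.upFrom 0 0 g = g := by rw [X.upFrom_of_le le_rfl, upTo_self]; rfl
      rw [h0, h.down_up_zero hm, h1]
      simp only [Nat.cast_zero, zero_smul, sub_zero, zero_add, div_one, one_smul, sub_self,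
        map_zero, one_mul]
      exact mul_nonneg h.nonneg (apply_nonneg _ _)
    · have h0 : X.upFrom (j + 1) (j + 1 + 1) g = X.up (j + 1) g := by
        rw [X.upFrom_of_le (Nat.le_succ (j + 1)), upTo_succ_self]
      have h1 : X.upFrom (j + 1) (j + 1) g = g := by rw [X.upFrom_of_le le_rfl, upTo_self]; rfl
      have h2 : X.upFrom j (j + 1) (X.downFrom (j + 1) j g) = X.up j (X.down j g) := by
        rw [X.upFrom_of_le (Nat.le_succ j), X.downFrom_of_le (Nat.le_succ j), upTo_succ_self,
          downTo_succ_self]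
      have := h.comm j g hm
      rw [Nat.add_sub_cancel, h0, h1, h2]
      push_cast
      rw [show (j : ℝ) + 1 + 1 = j + 2 by ring, show (j : ℝ) + 2 - (j + 1) = 1 by ring, one_mul]
      exact this
  | succ m hjm ih =>
    have ih := ih (by omega)
    have hc := h.comm m (X.upFrom j (m + 1) g) hm
    set A := X.upFrom j (m + 1) g with hA
    set E₁ := X.down m A - (((m : ℝ) + 1 - j) / (m + 1)) • X.upFrom j m g
      - ((j : ℝ) / (m + 1)) • X.upFrom (j - 1) m (X.downFrom j (j - 1) g) with hE₁
    have hA' : A = X.up m (X.upFrom j m g) := X.upFrom_succ hjm g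
    have hB : X.upFrom (j - 1) (m + 1) (X.downFrom j (j - 1) g)
        = X.up m (X.upFrom (j - 1) m (X.downFrom j (j - 1) g)) := X.upFrom_succ (by omega) _
    have hE : X.up m E₁ = X.up m (X.down m A) - (((m : ℝ) + 1 - j) / (m + 1)) • A
        - ((j : ℝ) / (m + 1)) • X.upFrom (j - 1) (m + 1) (X.downFrom j (j - 1) g) := by
      rw [hE₁, map_sub, map_sub, map_smul, map_smul, ← hA', ← hB]
    have hm1 : (m : ℝ) + 1 ≠ 0 := by positivity
    have hm2 : (m : ℝ) + 2 ≠ 0 := by positivity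
    -- The new error is one commutation at the top plus the old error carried up. The up operator is
    -- a contraction, so each up operator that is passed costs one more `γ`.
    have hdec : X.down (m + 1) (X.upFrom j (m + 1 + 1) g)
        - ((((m + 1 : ℕ) : ℝ) + 1 - j) / ((m + 1 : ℕ) + 1)) • A
        - ((j : ℝ) / ((m + 1 : ℕ) + 1)) • X.upFrom (j - 1) (m + 1) (X.downFrom j (j - 1) g)
        = (X.down (m + 1) (X.up (m + 1) A) - (1 / ((m : ℝ) + 2)) • A
          - (((m : ℝ) + 1) / (m + 2)) • X.up m (X.down m A))
          + (((m : ℝ) + 1) / (m + 2)) • X.up m E₁ := by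
      rw [hE, X.upFrom_succ (hjm.trans m.le_succ) g, ← hA]
      push_cast
      rw [show (m : ℝ) + 1 + 1 = m + 2 by ring]
      simp only [smul_sub, smul_smul]
      have e1 : ((m : ℝ) + 1) / (m + 2) * ((m + 1 - j) / (m + 1)) = (m + 2 - j) / (m + 2) - 1 / (m + 2) := by
        field_simp; ring
      have e2 : ((m : ℝ) + 1) / (m + 2) * (j / (m + 1)) = j / (m + 2) := by
        field_simp
      rw [e1, e2, sub_smul]
      abel
    rw [hdec]
    have h3 : p (m + 1) ((((m : ℝ) + 1) / (m + 2)) • X.up m E₁) ≤ p m E₁ := by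
      rw [map_smul_eq_mul, Real.norm_of_nonneg (by positivity)]
      have h4 : ((m : ℝ) + 1) / (m + 2) ≤ 1 := by rw [div_le_one (by positivity)]; linarith
      calc _ ≤ 1 * p (m + 1) (X.up m E₁) := by gcongr
        _ ≤ p m E₁ := by rw [one_mul]; exact h.up_le _ _ (by omega)
    have h5 : γ * p (m + 1) A ≤ γ * p j g :=
      mul_le_mul_of_nonneg_left (h.upFrom_le (by omega) g) h.nonneg
    calc _ ≤ _ := map_add_le_add _ _ _
      _ ≤ γ * p j g + ((m : ℝ) + 1 - j) * γ * p j g := add_le_add (hc.trans h5) (h3.trans ih)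
      _ = _ := by push_cast; ring

/-- A down operator acts on normal forms. -/
theorem down_normalForm (h : X.ApproxComm L γ p) {k m : ℕ} (hk : k ≤ L) (hm : m + 1 ≤ L)
    {a : ℕ → ℝ} (ha : IsCoef k (m + 1) a) (g : X.Fn k) :
    p m (X.down m (X.normalForm k (m + 1) a g) - X.normalForm k m (downCoef m a) g)
      ≤ ((m : ℝ) + 1) * γ * coefNorm k a * p k g := by
  -- The coefficients produced by `downCoef` are regrouped by the term they come from, so that the
  -- comparison can be made term by term.
  have h1 : X.normalForm k m (downCoef m a) g = ∑ j ∈ range (k + 1), a j •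
      ((((m : ℝ) + 1 - j) / (m + 1)) • X.upFrom j m (X.downFrom k j g)
      + ((j : ℝ) / (m + 1)) • X.upFrom (j - 1) m (X.downFrom k (j - 1) g)) := by
    rw [normalForm_apply]
    funext s
    have h2 := sum_range_shift (k := k) (fun j => (j : ℝ) / (m + 1) * a j *
      X.upFrom (j - 1) m (X.downFrom k (j - 1) g) s) (by simp [ha (k + 1) (by omega)])
    simp only [Nat.cast_zero, zero_div, zero_mul, sub_zero] at h2
    push_cast at h2
    replace h2 : ∑ j ∈ range (k + 1), ((j : ℝ) + 1) / (m + 1) * a (j + 1) *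
      X.upFrom j m (X.downFrom k j g) s = _ := h2
    simp only [Finset.sum_apply, Pi.smul_apply, Pi.add_apply, smul_eq_mul, downCoef, add_mul,
      sum_add_distrib, mul_add]
    rw [h2]
    congr 1 <;>
      exact sum_congr rfl fun j _ => by ring
  rw [h1, normalForm_apply, map_sum, ← sum_sub_distrib]
  refine (le_sum_of_subadditive _ (map_zero _).le (map_add_le_add _) _ _).trans ?_
  rw [coefNorm, mul_sum, sum_mul]
  refine sum_le_sum fun j hj => ?_
  have hjk : j ≤ k := by have := mem_range.mp hj; omega
  rw [map_smul, ← smul_sub, map_smul_eq_mul, Real.norm_eq_abs]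
  by_cases hjm : m + 1 < j
  · rw [ha j (Or.inr hjm)]; simp
  have key : p m (X.down m (X.upFrom j (m + 1) (X.downFrom k j g))
      - ((((m : ℝ) + 1 - j) / (m + 1)) • X.upFrom j m (X.downFrom k j g)
      + ((j : ℝ) / (m + 1)) • X.upFrom (j - 1) m (X.downFrom k (j - 1) g)))
      ≤ ((m : ℝ) + 1) * γ * p k g := by
    have hγ := h.nonneg
    have hp : p j (X.downFrom k j g) ≤ p k g := h.downFrom_le hk g
    have hp0 : 0 ≤ p k g := apply_nonneg _ _
    rcases Nat.lt_or_ge m j with hmj | hmj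
    · obtain rfl : j = m + 1 := by omega
      have e1 : X.upFrom (m + 1) (m + 1) (X.downFrom k (m + 1) g) = X.downFrom k (m + 1) g := by
        rw [X.upFrom_of_le le_rfl, upTo_self]; rfl
      have e2 : X.upFrom m m (X.downFrom k m g) = X.down m (X.downFrom k (m + 1) g) := by
        rw [X.upFrom_of_le le_rfl, upTo_self, X.downFrom_of_le hjk,
          X.downFrom_of_le (m.le_succ.trans hjk), downTo_succ_left X hjk]; rfl
      rw [e1, X.upFrom_of_lt (Nat.lt_succ_self m), Nat.add_sub_cancel, e2]
      push_cast
      rw [div_self (by positivity), one_smul, LinearMap.zero_apply, smul_zero, zero_add, sub_self,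
        map_zero]
      positivity
    · have hd := h.down_upFrom hmj hm (X.downFrom k j g)
      have e3 : ((j : ℝ) / (m + 1)) • X.upFrom (j - 1) m (X.downFrom j (j - 1) (X.downFrom k j g))
          = ((j : ℝ) / (m + 1)) • X.upFrom (j - 1) m (X.downFrom k (j - 1) g) := by
        rw [X.downFrom_of_le hjk, X.downFrom_of_le (Nat.sub_le j 1),
          X.downFrom_of_le ((Nat.sub_le j 1).trans hjk), ← downTo_comp X (Nat.sub_le j 1) hjk]
        rfl
      rw [e3, sub_sub] at hd
      refine hd.trans ?_
      have : (j : ℝ) ≤ m := by exact_mod_cast hmj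
      gcongr
      have : (0 : ℝ) ≤ j := by positivity
      linarith
  calc |a j| * _ ≤ |a j| * (((m : ℝ) + 1) * γ * p k g) := by gcongr
    _ = _ := by ring

/-- The normal form of a word, applied after an operator in normal form. -/
theorem word_normalForm (h : X.ApproxComm L γ p) {k : ℕ} {a : ℕ → ℝ} (ha : IsCoef k k a) (g : X.Fn k) :
    {m : ℕ} → (w : WalkWord k m) → w.maxLevel ≤ L →
      p m (w.op X (X.normalForm k k a g) - X.normalForm k m (w.coef a) g)
        ≤ (w.height : ℝ) * w.maxLevel * γ * coefNorm k a * p k g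
  | _, .nil, _ => by simp [WalkWord.op, WalkWord.coef, WalkWord.height]
  | _, .up (m := m) w, hw => by
    simp only [WalkWord.maxLevel, max_le_iff] at hw
    have ih := word_normalForm h ha g w hw.2
    -- An up operator prolongs each `U^m_j` exactly. The convention `U^m_{m+1} = 0` would drop the
    -- term `j = m + 1`, but its coefficient is zero.
    have h1 : X.normalForm k (m + 1) (w.coef a) g = X.up m (X.normalForm k m (w.coef a) g) := by
      rw [normalForm_apply, normalForm_apply, map_sum]
      refine sum_congr rfl fun j _ => ?_
      rw [map_smul]
      rcases le_or_gt j m with hj | hj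
      · rw [X.upFrom_succ hj]
      · rw [WalkWord.isCoef_coef ha w j (Or.inr hj), zero_smul, zero_smul]
    simp only [WalkWord.op, WalkWord.coef, WalkWord.height, WalkWord.maxLevel, LinearMap.comp_apply]
    rw [h1, ← map_sub]
    refine (h.up_le _ _ hw.1).trans (ih.trans ?_)
    have := h.nonneg
    have := coefNorm_nonneg k a
    have : 0 ≤ p k g := apply_nonneg _ _
    gcongr
    exact le_max_right _ _
  | _, .down (m := m) w, hw => by
    simp only [WalkWord.maxLevel] at hw
    have ih := word_normalForm h ha g w hw
    have hlev := w.le_maxLevel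
    simp only [WalkWord.op, WalkWord.coef, WalkWord.height, WalkWord.maxLevel, LinearMap.comp_apply]
    have h2 := h.down_normalForm (hlev.1.trans hw) (hlev.2.trans hw) (WalkWord.isCoef_coef ha w) g
    have h3 := h.down_le m (w.op X (X.normalForm k k a g) - X.normalForm k (m + 1) (w.coef a) g)
      (hlev.2.trans hw)
    rw [map_sub] at h3
    -- The new commutation error involves the current coefficients, whose norm has not grown, and a
    -- level bounded by the highest one visited.
    have h4 : ((m : ℝ) + 1) * γ * coefNorm k (w.coef a) * p k g
        ≤ (w.maxLevel : ℝ) * γ * coefNorm k a * p k g := by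
      have := h.nonneg
      have := coefNorm_nonneg k (w.coef a)
      have : 0 ≤ p k g := apply_nonneg _ _
      have h5 : (m : ℝ) + 1 ≤ w.maxLevel := by exact_mod_cast hlev.2
      gcongr
      exact WalkWord.coefNorm_coef_le ha w
    calc _ = p m ((X.down m (w.op X (X.normalForm k k a g))
            - X.down m (X.normalForm k (m + 1) (w.coef a) g))
          + (X.down m (X.normalForm k (m + 1) (w.coef a) g)
            - X.normalForm k m (downCoef m (w.coef a)) g)) := by rw [sub_add_sub_cancel]
      _ ≤ _ := map_add_le_add _ _ _
      _ ≤ _ := add_le_add (h3.trans ih) (h2.trans h4)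
      _ = _ := by push_cast; ring

end ApproxComm

end WeightedComplex

/-! ### Symmetric operators on weighted function spaces -/

/-- The map `f ↦ √π f` to the Euclidean space. -/
noncomputable def weightedToEuclidean {U : Type*} [Fintype U] (π : U → ℝ) :
    (U → ℝ) →ₗ[ℝ] EuclideanSpace ℝ U where
  toFun f := WithLp.toLp 2 fun u => √(π u) * f u
  map_add' f g := by ext u; simp [mul_add]
  map_smul' a f := by ext u; simp; ring

theorem inner_weightedToEuclidean {U : Type*} [Fintype U] {π : U → ℝ} (hπ : ∀ u, 0 ≤ π u)
    (f g : U → ℝ) :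
    inner ℝ (weightedToEuclidean π f) (weightedToEuclidean π g) = ∑ u, π u * (f u * g u) := by
  simp only [weightedToEuclidean, LinearMap.coe_mk, AddHom.coe_mk, PiLp.inner_apply]
  refine sum_congr rfl fun u _ => ?_
  simp only [RCLike.inner_apply, conj_trivial]
  linear_combination f u * g u * Real.mul_self_sqrt (hπ u)

/-- The spectral theorem for an operator that is symmetric with respect to positive weights. -/
theorem exists_weighted_eigenbasis {U : Type*} [Fintype U] {π : U → ℝ} (hπ : ∀ u, 0 < π u)
    (T : (U → ℝ) →ₗ[ℝ] (U → ℝ))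
    (hT : ∀ f g, ∑ u, π u * (T f u * g u) = ∑ u, π u * (f u * T g u)) :
    ∃ (N : ℕ) (b : Fin N → U → ℝ) (μ : Fin N → ℝ), (∀ i, T (b i) = μ i • b i) ∧ (∀ i, b i ≠ 0) ∧
      ∀ f g : U → ℝ, ∑ u, π u * (f u * g u)
        = ∑ i, (∑ u, π u * (b i u * f u)) * (∑ u, π u * (b i u * g u)) := by
  classical
  set Φ := weightedToEuclidean π with hΦ
  have hin := fun f g => inner_weightedToEuclidean (fun u => (hπ u).le) f g
  let Ψ : EuclideanSpace ℝ U →ₗ[ℝ] (U → ℝ) :=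
    { toFun := fun x u => (√(π u))⁻¹ * x u
      map_add' := fun x y => by ext u; simp [mul_add]
      map_smul' := fun a x => by ext u; simp; ring }
  have hΦΨ : ∀ x, Φ (Ψ x) = x := by
    intro x
    ext u
    have : √(π u) ≠ 0 := (Real.sqrt_pos.mpr (hπ u)).ne'
    simp [hΦ, weightedToEuclidean, Ψ, this]
  have hΨΦ : ∀ f, Ψ (Φ f) = f := by
    intro f
    ext u
    have : √(π u) ≠ 0 := (Real.sqrt_pos.mpr (hπ u)).ne'
    simp [hΦ, weightedToEuclidean, Ψ, this]
  -- Conjugation by `√π` turns symmetry for the weights into Euclidean symmetry, where the spectral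
  -- theorem applies.
  have hS : (Φ ∘ₗ T ∘ₗ Ψ).IsSymmetric := by
    intro x y
    have h1 := hin (T (Ψ x)) (Ψ y)
    have h2 := hin (Ψ x) (T (Ψ y))
    rw [hΦΨ] at h1 h2
    simp only [LinearMap.comp_apply]
    rw [h1, h2, hT]
  let v := hS.eigenvectorBasis rfl
  have hv : ∀ i, T (Ψ (v i)) = hS.eigenvalues rfl i • Ψ (v i) := by
    intro i
    have h := hS.apply_eigenvectorBasis rfl i
    simp only [LinearMap.comp_apply] at h
    have h' := congrArg Ψ h
    rw [hΨΦ] at h'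
    rw [h', map_smul]
    rfl
  refine ⟨_, fun i => Ψ (v i), hS.eigenvalues rfl, hv, ?_, ?_⟩
  · intro i hi
    replace hi : Ψ (v i) = 0 := hi
    have : v i = 0 := by rw [← hΦΨ (v i), hi, map_zero]
    exact v.orthonormal.ne_zero i this
  · intro f g
    rw [← hin f g, ← v.sum_inner_mul_inner]
    refine sum_congr rfl fun i _ => ?_
    rw [← hin (Ψ (v i)) f, ← hin (Ψ (v i)) g, hΦΨ, real_inner_comm]

/-- The quadratic form of a symmetric operator is bounded by its eigenvalues. -/
theorem abs_weighted_quadratic_le {U : Type*} [Fintype U] {π : U → ℝ} (hπ : ∀ u, 0 < π u)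
    {T : (U → ℝ) →ₗ[ℝ] (U → ℝ)}
    (hT : ∀ f g, ∑ u, π u * (T f u * g u) = ∑ u, π u * (f u * T g u)) {γ : ℝ}
    (h : ∀ (μ : ℝ) (f : U → ℝ), f ≠ 0 → T f = μ • f → |μ| ≤ γ) (f : U → ℝ) :
    |∑ u, π u * (f u * T f u)| ≤ γ * ∑ u, π u * (f u * f u) := by
  obtain ⟨N, b, μ, hb, hb0, hP⟩ := exists_weighted_eigenbasis hπ T hT
  have h1 : ∀ i, ∑ u, π u * (b i u * T f u) = μ i * ∑ u, π u * (b i u * f u) := by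
    intro i
    rw [← hT, hb, mul_sum]
    refine sum_congr rfl fun u _ => ?_
    simp only [Pi.smul_apply, smul_eq_mul]; ring
  rw [hP f (T f), hP f f, mul_sum]
  refine (abs_sum_le_sum_abs _ _).trans (sum_le_sum fun i _ => ?_)
  rw [h1, show (∑ u, π u * (b i u * f u)) * (μ i * ∑ u, π u * (b i u * f u))
    = μ i * ((∑ u, π u * (b i u * f u)) * (∑ u, π u * (b i u * f u))) by ring, abs_mul,
    abs_of_nonneg (mul_self_nonneg (∑ u, π u * (b i u * f u)))]
  exact mul_le_mul_of_nonneg_right (h _ _ (hb0 i) (hb i)) (mul_self_nonneg _)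

/-- The distance of `c` to the spectrum bounds `T - c` from below. -/
theorem exists_eigenvalue_mul_le {U : Type*} [Fintype U] [Nonempty U] {π : U → ℝ}
    (hπ : ∀ u, 0 < π u) {T : (U → ℝ) →ₗ[ℝ] (U → ℝ)}
    (hT : ∀ f g, ∑ u, π u * (T f u * g u) = ∑ u, π u * (f u * T g u)) (c : ℝ) :
    ∃ (μ : ℝ) (φ : U → ℝ), φ ≠ 0 ∧ T φ = μ • φ ∧ ∀ f : U → ℝ,
      (μ - c) ^ 2 * ∑ u, π u * (f u * f u) ≤ ∑ u, π u * ((T f u - c * f u) * (T f u - c * f u)) := by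
  obtain ⟨N, b, μ, hb, hb0, hP⟩ := exists_weighted_eigenbasis hπ T hT
  have hN : Nonempty (Fin N) := by
    by_contra hN
    have := hP (fun _ => 1) (fun _ => 1)
    rw [not_nonempty_iff] at hN
    simp only [univ_eq_empty, sum_empty, mul_one] at this
    exact absurd this (sum_pos (fun u _ => hπ u) univ_nonempty).ne'
  -- The eigenvalue nearest to `c`; each other eigenvector stretches `T - c` at least as much.
  obtain ⟨i₀, hi₀⟩ := Finite.exists_min fun i => (μ i - c) ^ 2
  refine ⟨μ i₀, b i₀, hb0 _, hb _, fun f => ?_⟩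
  have h1 : ∀ i, ∑ u, π u * (b i u * (T f u - c * f u)) = (μ i - c) * ∑ u, π u * (b i u * f u) := by
    intro i
    have h2 : ∑ u, π u * (b i u * T f u) = μ i * ∑ u, π u * (b i u * f u) := by
      rw [← hT, hb, mul_sum]
      refine sum_congr rfl fun u _ => ?_
      simp only [Pi.smul_apply, smul_eq_mul]; ring
    rw [sub_mul, ← h2, mul_sum, ← sum_sub_distrib]
    exact sum_congr rfl fun u _ => by ring
  rw [hP f f, hP (fun u => T f u - c * f u) (fun u => T f u - c * f u), mul_sum]
  refine sum_le_sum fun i _ => ?_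
  rw [h1]
  have := mul_le_mul_of_nonneg_right (hi₀ i) (mul_self_nonneg (∑ u, π u * (b i u * f u)))
  calc _ ≤ _ := this
    _ = _ := by ring

/-- The quadratic form of the edge weights of a spectral expander, without its component on the
constant functions. -/
theorem IsTwoSidedSpectralExpander.abs_quadratic_le {U : Type} [Fintype U] {w : U → U → ℝ} {γ : ℝ}
    (h : IsTwoSidedSpectralExpander w γ) (hγ : 0 ≤ γ) (hs : ∀ u v, w u v = w v u)
    (hd : ∀ u, 0 < ∑ v, w u v) (f : U → ℝ) :
    |∑ u, ∑ v, w u v * (f u * f v) - (∑ u, (∑ v, w u v) * f u) ^ 2 / ∑ u, ∑ v, w u v|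
      ≤ γ * ∑ u, (∑ v, w u v) * f u ^ 2 := by
  set π : U → ℝ := fun u => ∑ v, w u v with hπ
  set P : ℝ := ∑ u, π u with hP
  -- The random walk minus the projection to the constant functions. Its quadratic form, with the
  -- degrees as weights, is the expression to be bounded.
  let T : (U → ℝ) →ₗ[ℝ] (U → ℝ) :=
    { toFun := fun f u => ∑ v, w u v / π u * f v - (∑ v, π v * f v) / P
      map_add' := fun f g => by
        funext u
        simp only [Pi.add_apply, mul_add, sum_add_distrib, add_div]; ring
      map_smul' := fun a f => by
        funext u
        simp only [Pi.smul_apply, smul_eq_mul, RingHom.id_apply, mul_sub, mul_sum, sum_div]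
        congr 1 <;> exact sum_congr rfl fun v _ => by ring }
  have hT1 : ∀ f g : U → ℝ, ∑ u, π u * (f u * T g u)
      = ∑ u, ∑ v, w u v * (f u * g v) - (∑ u, π u * f u) * (∑ v, π v * g v) / P := by
    intro f g
    have h1 : ∀ u, π u * (f u * T g u) = ∑ v, w u v * (f u * g v)
        - π u * f u * ((∑ v, π v * g v) / P) := by
      intro u
      have : π u ≠ 0 := (hd u).ne'
      simp only [T, LinearMap.coe_mk, AddHom.coe_mk, mul_sub]
      rw [mul_sum, mul_sum]
      congr 1
      · refine sum_congr rfl fun v _ => ?_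
        field_simp
      · ring
    rw [sum_congr rfl fun u _ => h1 u, sum_sub_distrib, ← sum_mul, mul_div_assoc]
  have hT : ∀ f g, ∑ u, π u * (T f u * g u) = ∑ u, π u * (f u * T g u) := by
    intro f g
    rw [sum_congr rfl fun u _ => by rw [mul_comm (T f u)], hT1, hT1, sum_comm]
    congr 1
    · refine sum_congr rfl fun u _ => sum_congr rfl fun v _ => ?_
      rw [hs v u, mul_comm (g v)]
    · ring
  have hspec : ∀ (μ : ℝ) (f : U → ℝ), f ≠ 0 → T f = μ • f → |μ| ≤ γ := by
    intro μ f hf hTf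
    rcases eq_or_ne μ 0 with rfl | hμ
    · simpa using hγ
    obtain ⟨u₀, -⟩ := Function.ne_iff.mp hf
    have hP0 : P ≠ 0 := (sum_pos (fun u _ => hd u) ⟨u₀, mem_univ _⟩).ne'
    -- The image of `T` is orthogonal to the constants, so an eigenvector with nonzero eigenvalue is
    -- as well; on it `T` is the walk itself and the hypothesis applies.
    have horth : ∑ u, π u * f u = 0 := by
      have h1 := hT1 (fun _ => 1) f
      have h2 : ∑ u, ∑ v, w u v * f v = ∑ v, π v * f v := by
        rw [sum_comm]
        refine sum_congr rfl fun v _ => ?_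
        rw [hπ, sum_mul]
        exact sum_congr rfl fun u _ => by rw [hs u v]
      simp only [hTf, Pi.smul_apply, smul_eq_mul, one_mul, mul_one] at h1
      rw [h2, ← hP, mul_div_cancel_left₀ _ hP0, sub_self] at h1
      have h3 : μ * ∑ u, π u * f u = 0 := by
        rw [← h1, mul_sum]; exact sum_congr rfl fun u _ => by ring
      exact (mul_eq_zero.mp h3).resolve_left hμ
    refine h μ f hf horth fun u => ?_
    have h4 := congrFun hTf u
    simp only [T, LinearMap.coe_mk, AddHom.coe_mk, horth, zero_div, sub_zero, Pi.smul_apply,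
      smul_eq_mul] at h4
    exact h4
  have := abs_weighted_quadratic_le hd hT hspec f
  rw [hT1] at this
  rw [sq]
  simpa only [sq] using this

/-! ### Averaging operators and the weighted inner product -/

namespace WeightedComplex

variable {n d : ℕ} (X : WeightedComplex n d)

theorem mem_level {i : ℕ} {s : Finset (Fin n)} :
    s ∈ X.level i ↔ s.card = i ∧ ∃ t ∈ X.top, s ⊆ t := by
  simp [level]

theorem Face.card_eq {X : WeightedComplex n d} {i : ℕ} (s : X.Face i) : s.1.card = i :=
  (X.mem_level.mp s.2).1

theorem le_of_mem_level {i : ℕ} {s : Finset (Fin n)} (h : s ∈ X.level i) : i ≤ d := by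
  obtain ⟨h1, t, ht, hst⟩ := X.mem_level.mp h
  rw [← h1, ← X.card_top t ht]
  exact card_le_card hst

theorem Face.le {X : WeightedComplex n d} {i : ℕ} (s : X.Face i) : i ≤ d := X.le_of_mem_level s.2

theorem mem_level_of_subset {i j : ℕ} {s t : Finset (Fin n)} (ht : t ∈ X.level i) (hst : s ⊆ t)
    (hs : s.card = j) : s ∈ X.level j := by
  obtain ⟨_, u, hu, htu⟩ := X.mem_level.mp ht
  exact X.mem_level.mpr ⟨hs, u, hu, hst.trans htu⟩

/-- The total weight of the top level faces that contain `s`. -/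
noncomputable def mass (s : Finset (Fin n)) : ℝ := ∑ t ∈ X.top with s ⊆ t, X.weight t

theorem prob_eq_mass (s : Finset (Fin n)) : X.prob s = X.mass s / (d.choose s.card : ℝ) := rfl

theorem mass_pos {i : ℕ} {s : Finset (Fin n)} (h : s ∈ X.level i) : 0 < X.mass s := by
  obtain ⟨_, t, ht, hst⟩ := X.mem_level.mp h
  exact sum_pos (fun t ht => X.weight_pos t (mem_filter.mp ht).1) ⟨t, mem_filter.mpr ⟨ht, hst⟩⟩

theorem mass_eq_zero {s : Finset (Fin n)} (h : s ∉ X.level s.card) : X.mass s = 0 := by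
  rw [mass, filter_eq_empty_iff.mpr, sum_empty]
  intro t ht hst
  exact h (X.mem_level.mpr ⟨rfl, t, ht, hst⟩)

theorem mass_empty : X.mass ∅ = 1 := by
  simp [mass, X.weight_sum]

theorem choose_pos_of_mem_level {i : ℕ} {s : Finset (Fin n)} (h : s ∈ X.level i) :
    (0 : ℝ) < d.choose i := by exact_mod_cast Nat.choose_pos (X.le_of_mem_level h)

theorem prob_pos {i : ℕ} (s : X.Face i) : 0 < X.prob s.1 := by
  rw [prob_eq_mass, s.card_eq]
  exact div_pos (X.mass_pos s.2) (X.choose_pos_of_mem_level s.2)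

theorem sum_face {i : ℕ} (P : Finset (Fin n) → Prop) [DecidablePred P] (F : Finset (Fin n) → ℝ) :
    ∑ y : X.Face i with P y.1, F y.1 = ∑ y ∈ X.level i with P y, F y := by
  rw [sum_filter, sum_filter, sum_coe_sort (X.level i) fun y => if P y then F y else 0]

theorem sum_face_univ {i : ℕ} (F : Finset (Fin n) → ℝ) :
    ∑ y : X.Face i, F y.1 = ∑ y ∈ X.level i, F y := sum_coe_sort (X.level i) F

theorem card_filter_subset {k : ℕ} (y : X.Face (k + 1)) :
    ((univ : Finset (X.Face k)).filter fun x => x.1 ⊆ y.1).card = k + 1 := by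
  have h1 : (((univ : Finset (X.Face k)).filter fun x => x.1 ⊆ y.1).map
      (Function.Embedding.subtype _)) = powersetCard k y.1 := by
    ext s
    simp only [mem_map, mem_filter, mem_univ, true_and, Function.Embedding.subtype_apply,
      mem_powersetCard]
    constructor
    · rintro ⟨x, hx, rfl⟩
      exact ⟨hx, Face.card_eq x⟩
    · rintro ⟨hs, hc⟩
      exact ⟨⟨s, X.mem_level_of_subset y.2 hs hc⟩, hs, rfl⟩
  rw [← card_map, h1, card_powersetCard, y.card_eq, Nat.choose_succ_self_right]

theorem up_apply (k : ℕ) (f : X.Fn k) (y : X.Face (k + 1)) :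
    X.up k f y = (1 / ((k : ℝ) + 1)) * ∑ x : X.Face k with x.1 ⊆ y.1, f x := rfl

theorem down_apply (k : ℕ) (f : X.Fn (k + 1)) (x : X.Face k) :
    X.down k f x = (1 / ((k : ℝ) + 1)) *
      ∑ y : X.Face (k + 1) with x.1 ⊆ y.1, X.prob y.1 / X.prob x.1 * f y := rfl

theorem up_const (k : ℕ) (c : ℝ) : X.up k (fun _ => c) = fun _ => c := by
  funext y
  rw [up_apply, sum_const, card_filter_subset, nsmul_eq_mul]
  push_cast
  field_simp

theorem down_const {k : ℕ} (hk : k + 1 ≤ d) (c : ℝ) : X.down k (fun _ => c) = fun _ => c := by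
  funext x
  have h := X.prob_eq_sum hk x.2
  have hx := (X.prob_pos x).ne'
  rw [← X.sum_face (fun y => x.1 ⊆ y)] at h
  rw [down_apply, ← sum_mul, ← sum_div, ← mul_assoc, ← mul_div_assoc, ← h, div_self hx, one_mul]

theorem inner_eq {i : ℕ} (f g : X.Fn i) : X.inner f g = ∑ s, X.prob s.1 * (f s * g s) := rfl

theorem inner_comm {i : ℕ} (f g : X.Fn i) : X.inner f g = X.inner g f := by
  simp only [inner_eq, mul_comm (f _)]

theorem inner_add_left {i : ℕ} (f g h : X.Fn i) :
    X.inner (f + g) h = X.inner f h + X.inner g h := by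
  simp [inner_eq, add_mul, mul_add, sum_add_distrib]

theorem inner_smul_left {i : ℕ} (a : ℝ) (f h : X.Fn i) :
    X.inner (a • f) h = a * X.inner f h := by
  simp only [inner_eq, mul_sum, Pi.smul_apply, smul_eq_mul]
  exact sum_congr rfl fun _ _ => by ring

theorem inner_sub_left {i : ℕ} (f g h : X.Fn i) :
    X.inner (f - g) h = X.inner f h - X.inner g h := by
  simp [inner_eq, sub_mul, mul_sub, sum_sub_distrib]

theorem inner_add_right {i : ℕ} (f g h : X.Fn i) :
    X.inner f (g + h) = X.inner f g + X.inner f h := by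
  rw [inner_comm, inner_add_left, X.inner_comm g, X.inner_comm h]

theorem inner_smul_right {i : ℕ} (a : ℝ) (f h : X.Fn i) :
    X.inner f (a • h) = a * X.inner f h := by
  rw [inner_comm, inner_smul_left, inner_comm]

theorem inner_sub_right {i : ℕ} (f g h : X.Fn i) :
    X.inner f (g - h) = X.inner f g - X.inner f h := by
  rw [inner_comm, inner_sub_left, X.inner_comm g, X.inner_comm h]

theorem inner_sum_right {i : ℕ} {ι : Type*} (s : Finset ι) (f : X.Fn i) (g : ι → X.Fn i) :
    X.inner f (∑ j ∈ s, g j) = ∑ j ∈ s, X.inner f (g j) := by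
  simp only [inner_eq, Finset.sum_apply, mul_sum]
  exact sum_comm

/-- Both sides are the same sum over incident pairs `x ⊂ y` with weight `Π(y)/(k+1)`; the quotient
of probabilities in the down operator makes this so. -/
theorem inner_up (k : ℕ) (f : X.Fn k) (g : X.Fn (k + 1)) :
    X.inner (X.up k f) g = X.inner f (X.down k g) := by
  have h1 : X.inner (X.up k f) g = ∑ y : X.Face (k + 1), ∑ x : X.Face k,
      if x.1 ⊆ y.1 then (1 / ((k : ℝ) + 1)) * (X.prob y.1 * (f x * g y)) else 0 := by
    rw [inner_eq]
    refine sum_congr rfl fun y _ => ?_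
    rw [up_apply, ← sum_filter, mul_sum, sum_mul, mul_sum]
    exact sum_congr rfl fun x _ => by ring
  have h2 : X.inner f (X.down k g) = ∑ x : X.Face k, ∑ y : X.Face (k + 1),
      if x.1 ⊆ y.1 then (1 / ((k : ℝ) + 1)) * (X.prob y.1 * (f x * g y)) else 0 := by
    rw [inner_eq]
    refine sum_congr rfl fun x _ => ?_
    have hx := (X.prob_pos x).ne'
    rw [down_apply, ← sum_filter, mul_sum, mul_sum, mul_sum]
    refine sum_congr rfl fun y _ => ?_
    field_simp
  rw [h1, h2, sum_comm]

theorem inner_upTo {i k : ℕ} (h : i ≤ k) (f : X.Fn i) (g : X.Fn k) :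
    X.inner (X.upTo h f) g = X.inner f (X.downTo h g) := by
  induction k, h using Nat.le_induction with
  | base => simp
  | succ k h ih => rw [upTo_succ X h, downTo_succ X h, LinearMap.comp_apply, inner_up, ih]; rfl

theorem downTo_const {i k : ℕ} (h : i ≤ k) (hk : k ≤ d) (c : ℝ) :
    X.downTo h (fun _ => c) = fun _ => c := by
  induction k, h using Nat.le_induction with
  | base => simp
  | succ k h ih => rw [downTo_succ X h, LinearMap.comp_apply, down_const X hk, ih (by omega)]

theorem upTo_const {i k : ℕ} (h : i ≤ k) (c : ℝ) :
    X.upTo h (fun _ => c) = fun _ => c := by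
  induction k, h using Nat.le_induction with
  | base => simp
  | succ k h ih => rw [upTo_succ X h, LinearMap.comp_apply, ih, up_const]

theorem expect_eq_inner {i : ℕ} (f : X.Fn i) : X.expect f = X.inner (fun _ => 1) f := by
  simp [inner_eq, expect]

theorem expect_downTo {i k : ℕ} (h : i ≤ k) (f : X.Fn k) :
    X.expect (X.downTo h f) = X.expect f := by
  rw [expect_eq_inner, ← inner_upTo, upTo_const, ← expect_eq_inner]

theorem inner_self_nonneg {i : ℕ} (f : X.Fn i) : 0 ≤ X.inner f f := by
  rw [inner_eq]
  exact sum_nonneg fun s _ => mul_nonneg (X.prob_pos s).le (mul_self_nonneg _)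

/-- The seminorm of `L²(Π_i)`. -/
noncomputable def l2 (i : ℕ) : Seminorm ℝ (X.Fn i) :=
  (normSeminorm ℝ (EuclideanSpace ℝ (X.Face i))).comp (weightedToEuclidean fun s => X.prob s.1)

theorem inner_eq_real_inner {i : ℕ} (f g : X.Fn i) : X.inner f g
    = Inner.inner ℝ (weightedToEuclidean (fun s : X.Face i => X.prob s.1) f)
      (weightedToEuclidean (fun s : X.Face i => X.prob s.1) g) := by
  rw [inner_weightedToEuclidean fun s => (X.prob_pos s).le]; rfl

theorem l2_sq {i : ℕ} (f : X.Fn i) : X.l2 i f ^ 2 = X.inner f f := by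
  rw [inner_eq_real_inner, real_inner_self_eq_norm_sq]; rfl

theorem abs_inner_le {i : ℕ} (f g : X.Fn i) : |X.inner f g| ≤ X.l2 i f * X.l2 i g := by
  rw [inner_eq_real_inner]
  exact abs_real_inner_le_norm _ _

theorem inner_le {i : ℕ} (f g : X.Fn i) : X.inner f g ≤ X.l2 i f * X.l2 i g :=
  (le_abs_self _).trans (X.abs_inner_le f g)

theorem l2_pos {i : ℕ} {f : X.Fn i} (hf : f ≠ 0) : 0 < X.l2 i f := by
  obtain ⟨s, hs⟩ := Function.ne_iff.mp hf
  have h1 : 0 < X.inner f f := sum_pos' (fun s _ => mul_nonneg (X.prob_pos s).le (mul_self_nonneg _))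
    ⟨s, mem_univ _, mul_pos (X.prob_pos s) (mul_self_pos.mpr hs)⟩
  rw [← l2_sq] at h1
  exact lt_of_le_of_ne (apply_nonneg _ _) fun h => by rw [← h] at h1; simp at h1

theorem sq_up_le (k : ℕ) (f : X.Fn k) (y : X.Face (k + 1)) :
    X.up k f y ^ 2 ≤ X.up k (fun x => f x ^ 2) y := by
  have h := sq_sum_le_card_mul_sum_sq (s := (univ : Finset (X.Face k)).filter fun x => x.1 ⊆ y.1)
    (f := f)
  rw [card_filter_subset] at h
  rw [up_apply, up_apply, mul_pow]
  push_cast at h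
  calc _ ≤ (1 / ((k : ℝ) + 1)) ^ 2 * (((k : ℝ) + 1) * ∑ x : X.Face k with x.1 ⊆ y.1, f x ^ 2) := by
        gcongr
    _ = _ := by field_simp

/-- Jensen's inequality `(U f)² ≤ U(f²)`, followed by `E[U g] = E[g]`, which is adjointness together
with `D 1 = 1`. -/
theorem l2_up_le (k : ℕ) (hk : k + 1 ≤ d) (f : X.Fn k) : X.l2 (k + 1) (X.up k f) ≤ X.l2 k f := by
  refine le_of_sq_le_sq ?_ (apply_nonneg _ _)
  rw [l2_sq, l2_sq]
  have h1 : X.inner (X.up k f) (X.up k f) ≤ X.inner (X.up k fun x => f x ^ 2) fun _ => 1 := by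
    simp only [inner_eq]
    refine sum_le_sum fun y _ => mul_le_mul_of_nonneg_left ?_ (X.prob_pos y).le
    have := X.sq_up_le k f y
    rw [mul_one, ← sq]
    exact this
  refine h1.trans (le_of_eq ?_)
  rw [inner_up, down_const X hk]
  simp [inner_eq, sq]

/-- By duality: `‖D f‖² = ⟨U D f, f⟩ ≤ ‖D f‖ ‖f‖`. -/
theorem l2_down_le (k : ℕ) (hk : k + 1 ≤ d) (f : X.Fn (k + 1)) :
    X.l2 k (X.down k f) ≤ X.l2 (k + 1) f := by
  have h1 : X.l2 k (X.down k f) ^ 2 ≤ X.l2 k (X.down k f) * X.l2 (k + 1) f := by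
    rw [l2_sq, ← inner_up]
    refine (X.inner_le _ _).trans ?_
    gcongr
    exact X.l2_up_le k hk _
  rcases (apply_nonneg (X.l2 k) (X.down k f)).eq_or_lt with h | h
  · rw [← h]; exact apply_nonneg _ _
  · rw [sq] at h1
    exact le_of_mul_le_mul_left h1 h

/-- The only face of level zero is the empty set, so `g` is constant. -/
theorem down_up_zero (hd : 1 ≤ d) (g : X.Fn 0) : X.down 0 (X.up 0 g) = g := by
  have h1 : ∀ x y : X.Face 0, x = y := fun x y => Subtype.ext (by
    rw [card_eq_zero.mp x.card_eq, card_eq_zero.mp y.card_eq])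
  funext x
  have h2 : g = fun _ => g x := funext fun y => by rw [h1 y x]
  rw [h2, up_const, down_const X hd]

/-- A bound of a quadratic form of a symmetric operator bounds the operator. -/
theorem l2_le_of_abs_inner_le {i : ℕ} (T : X.Fn i →ₗ[ℝ] X.Fn i)
    (hT : ∀ f g, X.inner (T f) g = X.inner f (T g)) {γ : ℝ}
    (h : ∀ f, |X.inner f (T f)| ≤ γ * X.inner f f) (g : X.Fn i) : X.l2 i (T g) ≤ γ * X.l2 i g := by
  rcases (apply_nonneg (X.l2 i) g).eq_or_lt with h0 | h0
  · have hg : g = 0 := by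
      by_contra hg
      exact (X.l2_pos hg).ne h0
    subst hg
    simp
  have hγ : 0 ≤ γ := by
    have h1 := (abs_nonneg _).trans (h g)
    rw [← l2_sq] at h1
    exact nonneg_of_mul_nonneg_left h1 (by positivity)
  have hsp : ∀ (μ : ℝ) (f : X.Fn i), f ≠ 0 → (T ∘ₗ T) f = μ • f → |μ| ≤ γ ^ 2 := by
    intro μ f hf hTf
    -- `T² f = μ f` with `μ = ρ²`, and one of `T f ± ρ f` is an eigenvector of `T`
    have hf0 := X.l2_pos hf
    have hμ : μ * X.l2 i f ^ 2 = X.l2 i (T f) ^ 2 := by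
      rw [l2_sq, l2_sq, ← inner_smul_right, ← hTf, hT]; rfl
    have hμ0 : 0 ≤ μ := by
      by_contra hneg
      have : μ * X.l2 i f ^ 2 < 0 := mul_neg_of_neg_of_pos (not_le.mp hneg) (by positivity)
      rw [hμ] at this
      exact absurd this (not_lt.mpr (by positivity))
    have eig : ∀ (ρ : ℝ) (u : X.Fn i), u ≠ 0 → T u = ρ • u → |ρ| ≤ γ := by
      intro ρ u hu hTu
      have h1 := h u
      have h2 : 0 < X.inner u u := by rw [← l2_sq]; have := X.l2_pos hu; positivity
      rw [hTu, inner_smul_right, abs_mul, abs_of_pos h2] at h1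
      exact le_of_mul_le_mul_right h1 h2
    have hs : √μ * √μ = μ := Real.mul_self_sqrt hμ0
    have hTT : T (T f) = μ • f := hTf
    rw [abs_of_nonneg hμ0, ← hs, sq]
    have key : √μ ≤ γ := by
      by_cases hu : T f + √μ • f = 0
      · have := eig (-√μ) f hf (by rw [eq_neg_of_add_eq_zero_left hu, neg_smul])
        rwa [abs_neg, abs_of_nonneg (Real.sqrt_nonneg _)] at this
      · have := eig (√μ) _ hu (by
          rw [map_add, map_smul, hTT, smul_add, smul_smul, hs, add_comm])
        rwa [abs_of_nonneg (Real.sqrt_nonneg _)] at this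
    exact mul_le_mul key key (Real.sqrt_nonneg _) hγ
  have hb := abs_weighted_quadratic_le (π := fun s : X.Face i => X.prob s.1) X.prob_pos
    (T := T ∘ₗ T) (fun f g => by
      have h1 := hT (T f) g
      rw [hT f (T g)] at h1
      exact h1) hsp g
  replace hb : |X.inner g (T (T g))| ≤ γ ^ 2 * X.inner g g := hb
  rw [← hT, ← l2_sq, ← l2_sq, ← mul_pow, abs_of_nonneg (by positivity)] at hb
  exact le_of_sq_le_sq hb (by positivity)

end WeightedComplex

/-! ### Links and the approximate commutation of the averaging operators -/

/-- A set of size `i + 1` with a marked element is a set of size `i` with a new element. This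
reindexing localizes sums over faces to links. -/
theorem sum_powersetCard_succ_sum {V : Type*} [Fintype V] [DecidableEq V] (i : ℕ)
    (F : Finset V → V → ℝ) :
    ∑ x ∈ powersetCard (i + 1) (univ : Finset V), ∑ u ∈ x, F (x.erase u) u
      = ∑ s ∈ powersetCard i (univ : Finset V), ∑ u ∈ sᶜ, F s u := by
  rw [sum_sigma', sum_sigma']
  refine sum_bij' (fun p _ => ⟨p.1.erase p.2, p.2⟩) (fun p _ => ⟨insert p.2 p.1, p.2⟩) ?_ ?_ ?_ ?_ ?_
  · rintro ⟨x, u⟩ h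
    simp only [mem_sigma, mem_powersetCard, subset_univ, true_and, mem_compl, mem_erase] at h ⊢
    rw [card_erase_of_mem h.2, h.1]
    simp
  · rintro ⟨s, u⟩ h
    simp only [mem_sigma, mem_powersetCard, subset_univ, true_and, mem_compl] at h ⊢
    rw [card_insert_of_notMem h.2, h.1]
    simp
  · rintro ⟨x, u⟩ h
    simp only [mem_sigma, mem_powersetCard, subset_univ, true_and] at h
    simp [insert_erase h.2]
  · rintro ⟨s, u⟩ h
    simp only [mem_sigma, mem_compl] at h
    simp [erase_insert h.2]
  · rintro ⟨x, u⟩ h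
    rfl

/-! ### Masses, and the weighted graph underlying a link. -/

namespace WeightedComplex

variable {n d : ℕ} (X : WeightedComplex n d)

theorem mass_mono_eq_zero {s t : Finset (Fin n)} (h : X.mass s = 0) (hst : s ⊆ t) :
    X.mass t = 0 := by
  by_contra ht
  have h1 : t ∈ X.level t.card := by
    by_contra h2
    exact ht (X.mass_eq_zero h2)
  exact (X.mass_pos (X.mem_level_of_subset h1 hst rfl)).ne' h

theorem insert_subset_insert_insert {V : Type*} [DecidableEq V] (u v : V) (s : Finset V) :
    insert v s ⊆ insert v (insert u s) := insert_subset_insert _ (subset_insert _ _)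

/-- A top face that contains `s` is counted once for each of its `d - |s|` vertices outside `s`. -/
theorem sum_mass_insert (s : Finset (Fin n)) :
    ∑ v ∈ sᶜ, X.mass (insert v s) = ((d : ℝ) - s.card) * X.mass s := by
  have h1 : ∑ v ∈ sᶜ, X.mass (insert v s)
      = ∑ t ∈ X.top with s ⊆ t, ∑ v ∈ t \ s, X.weight t := by
    simp only [mass]
    refine sum_comm' fun v t => ?_
    simp only [mem_compl, mem_filter, insert_subset_iff, mem_sdiff]
    tauto
  rw [h1, mass, mul_sum]
  refine sum_congr rfl fun t ht => ?_
  obtain ⟨ht, hst⟩ := mem_filter.mp ht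
  rw [sum_const, card_sdiff_of_subset hst, nsmul_eq_mul, X.card_top t ht, Nat.cast_sub]
  rw [← X.card_top t ht]; exact card_le_card hst

theorem link_mass {i : ℕ} (s : X.Face i) {t : Finset (Fin n)} (ht : Disjoint t s.1) :
    (X.link s).mass t = X.mass (t ∪ s.1) / X.mass s.1 := by
  have hinj : ∀ a ∈ X.top.filter (fun t => s.1 ⊆ t), ∀ b ∈ X.top.filter (fun t => s.1 ⊆ t),
      a \ s.1 = b \ s.1 → a = b := by
    intro a ha b hb hab
    rw [← sdiff_union_of_subset (mem_filter.mp ha).2, hab,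
      sdiff_union_of_subset (mem_filter.mp hb).2]
  have hR : X.mass (t ∪ s.1)
      = ∑ a ∈ X.top with s.1 ⊆ a, if t ⊆ a \ s.1 then X.weight a else 0 := by
    rw [mass, sum_filter, sum_filter]
    refine sum_congr rfl fun a _ => ?_
    by_cases hs : s.1 ⊆ a
    · have : t ⊆ a \ s.1 ↔ t ∪ s.1 ⊆ a := by
        rw [subset_sdiff, union_subset_iff]
        exact ⟨fun h => ⟨h.1, hs⟩, fun h => ⟨h.1, ht⟩⟩
      simp only [this, if_pos hs]
    · rw [if_neg hs, if_neg fun h => hs (subset_union_right.trans h)]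
  rw [hR, sum_div, mass, sum_filter]
  change ∑ a ∈ (X.top.filter fun t => s.1 ⊆ t).image (fun t => t \ s.1),
    (if t ⊆ a then X.weight (a ∪ s.1) / ∑ t ∈ X.top with s.1 ⊆ t, X.weight t else 0) = _
  rw [sum_image hinj]
  refine sum_congr rfl fun a ha => ?_
  rw [sdiff_union_of_subset (mem_filter.mp ha).2, ite_div, zero_div]
  rfl

theorem mem_link_level {i j : ℕ} (s : X.Face i) {t : Finset (Fin n)} :
    t ∈ (X.link s).level j ↔ t.card = j ∧ Disjoint t s.1 ∧ t ∪ s.1 ∈ X.level (j + i) := by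
  have htop : (X.link s).top = (X.top.filter fun t => s.1 ⊆ t).image fun t => t \ s.1 := rfl
  simp only [mem_level, htop, mem_image, mem_filter]
  constructor
  · rintro ⟨hc, _, ⟨a, ⟨ha, hsa⟩, rfl⟩, hta⟩
    rw [subset_sdiff] at hta
    exact ⟨hc, hta.2, by rw [card_union_of_disjoint hta.2, hc, s.card_eq], a, ha,
      union_subset hta.1 hsa⟩
  · rintro ⟨hc, hd, _, a, ha, hta⟩
    rw [union_subset_iff] at hta
    exact ⟨hc, a \ s.1, ⟨a, ⟨ha, hta.2⟩, rfl⟩, subset_sdiff.mpr ⟨hta.1, hd⟩⟩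

theorem mem_link_level_one {i : ℕ} (s : X.Face i) {v : Fin n} :
    {v} ∈ (X.link s).level 1 ↔ v ∉ s.1 ∧ insert v s.1 ∈ X.level (i + 1) := by
  rw [mem_link_level, add_comm 1 i, ← insert_eq]
  simp

/-- For `u = v` the set `{u, v}` has one element and is not an edge. The absence of loops is used
later to bound the probability of a vertex. -/
theorem link_edgeWeight {i : ℕ} (s : X.Face i) (u v : {v : Fin n // {v} ∈ (X.link s).level 1}) :
    (X.link s).edgeWeight u v = if u.1 = v.1 then 0 else
      X.mass (insert v.1 (insert u.1 s.1)) / (X.mass s.1 * ((d - i).choose 2 : ℝ)) := by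
  have hu := ((X.mem_link_level_one s).mp u.2).1
  have hv := ((X.mem_link_level_one s).mp v.2).1
  rw [edgeWeight]
  split_ifs with h1 h2 h2
  · have := (mem_level _ |>.mp h1).1
    simp [h2] at this
  · rw [prob_eq_mass, link_mass, card_pair h2, div_div]
    · congr 2
      ext w; simp only [mem_union, mem_insert, mem_singleton]; tauto
    · simp [hu, hv]
  · rfl
  · have hd : Disjoint ({u.1, v.1} : Finset (Fin n)) s.1 := by simp [hu, hv]
    have hun : ({u.1, v.1} : Finset (Fin n)) ∪ s.1 = insert v.1 (insert u.1 s.1) := by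
      ext w; simp only [mem_union, mem_insert, mem_singleton]; tauto
    rw [mem_link_level, hun] at h1
    have hc : (insert v.1 (insert u.1 s.1)).card = 2 + i := by
      rw [← hun, card_union_of_disjoint hd, card_pair h2, s.card_eq]
    rw [X.mass_eq_zero, zero_div]
    rw [hc]
    exact fun h => h1 ⟨card_pair h2, hd, h⟩

/-- A vertex outside `s` that is not in the link has `mass (insert v s) = 0`, so sums may run over
all vertices outside `s`. -/
theorem sum_link_vertices {i : ℕ} (s : X.Face i) (F : Fin n → ℝ)
    (hF : ∀ v, X.mass (insert v s.1) = 0 → F v = 0) :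
    ∑ v : {v : Fin n // {v} ∈ (X.link s).level 1}, F v.1 = ∑ v ∈ s.1ᶜ, F v := by
  rw [← sum_subtype (univ.filter fun v => {v} ∈ (X.link s).level 1) (by simp) F]
  refine sum_subset ?_ ?_
  · intro v hv
    exact mem_compl.mpr ((X.mem_link_level_one s).mp (mem_filter.mp hv).2).1
  · intro v hv hv'
    rw [mem_compl] at hv
    refine hF v (X.mass_eq_zero ?_)
    rw [card_insert_of_notMem hv, s.card_eq]
    exact fun h => hv' (mem_filter.mpr ⟨mem_univ _, (X.mem_link_level_one s).mpr ⟨hv, h⟩⟩)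

/-- The quadratic form of the graph underlying a link. -/
theorem IsLocalSpectralExpander.abs_link_quadratic_le {X : WeightedComplex n d} {γ : ℝ}
    (h : X.IsLocalSpectralExpander γ) (hγ : 0 ≤ γ) {i : ℕ} (hi : i + 2 ≤ d) (s : X.Face i)
    (f : Fin n → ℝ) :
    |∑ u ∈ s.1ᶜ, ∑ v ∈ (insert u s.1)ᶜ, X.mass (insert v (insert u s.1)) * (f u * f v)
      - ((d : ℝ) - i - 1) / (d - i) * ((∑ u ∈ s.1ᶜ, X.mass (insert u s.1) * f u) ^ 2 / X.mass s.1)|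
      ≤ γ * (((d : ℝ) - i - 1) * ∑ u ∈ s.1ᶜ, X.mass (insert u s.1) * f u ^ 2) := by
  have hms := X.mass_pos s.2
  have hch : (0 : ℝ) < (d - i).choose 2 := by
    exact_mod_cast Nat.choose_pos (by omega : 2 ≤ d - i)
  have hdi : (0 : ℝ) < (d : ℝ) - i - 1 := by
    have : (i : ℝ) + 2 ≤ d := by exact_mod_cast hi
    linarith
  set c := X.mass s.1 * ((d - i).choose 2 : ℝ) with hc
  have hc0 : 0 < c := mul_pos hms hch
  -- sums over the neighbours of `u`
  have hnb : ∀ (u : {v : Fin n // {v} ∈ (X.link s).level 1}) (F : Fin n → ℝ),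
      ∑ v, (X.link s).edgeWeight u v * F v.1
        = (∑ v ∈ (insert u.1 s.1)ᶜ, X.mass (insert v (insert u.1 s.1)) * F v) / c := by
    intro u F
    have h1 := X.sum_link_vertices s
      (fun v => (if u.1 = v then 0 else X.mass (insert v (insert u.1 s.1)) / c) * F v) (by
        intro v hv
        split_ifs with huv
        · simp
        · rw [X.mass_mono_eq_zero hv (insert_subset_insert_insert u.1 v s.1)]; simp)
    rw [sum_congr rfl fun v _ => by rw [link_edgeWeight], h1, sum_div]
    have hu := ((X.mem_link_level_one s).mp u.2).1
    have : (insert u.1 s.1)ᶜ = s.1ᶜ.erase u.1 := by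
      ext w; simp only [mem_compl, mem_insert, mem_erase]; tauto
    rw [this, ← add_sum_erase (s.1ᶜ) _ (mem_compl.mpr hu)]
    simp only [if_true, zero_mul, zero_add]
    refine sum_congr rfl fun v hv => ?_
    rw [if_neg fun h => (mem_erase.mp hv).1 h.symm]
    ring
  have hdeg : ∀ u : {v : Fin n // {v} ∈ (X.link s).level 1}, ∑ v, (X.link s).edgeWeight u v
      = ((d : ℝ) - i - 1) * X.mass (insert u.1 s.1) / c := by
    intro u
    have h1 := hnb u fun _ => 1
    simp only [mul_one] at h1
    have hu := ((X.mem_link_level_one s).mp u.2).1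
    rw [h1, sum_mass_insert, card_insert_of_notMem hu, s.card_eq]
    push_cast
    ring
  have hpos : ∀ u : {v : Fin n // {v} ∈ (X.link s).level 1}, 0 < ∑ v, (X.link s).edgeWeight u v := by
    intro u
    rw [hdeg]
    exact div_pos (mul_pos hdi (X.mass_pos ((X.mem_link_level_one s).mp u.2).2)) hc0
  have hsymm : ∀ u v, (X.link s).edgeWeight u v = (X.link s).edgeWeight v u := by
    intro u v
    rw [link_edgeWeight, link_edgeWeight]
    rw [insert_comm]; simp only [eq_comm]
  have hq := (h i hi s).abs_quadratic_le hγ hsymm hpos fun u => f u.1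
  have e1 : ∑ u, ∑ v, (X.link s).edgeWeight u v * (f u.1 * f v.1)
      = (∑ u ∈ s.1ᶜ, ∑ v ∈ (insert u s.1)ᶜ, X.mass (insert v (insert u s.1)) * (f u * f v)) / c := by
    rw [sum_congr rfl fun u _ => hnb u fun v => f u.1 * f v, ← sum_div]
    rw [X.sum_link_vertices s fun u => ∑ v ∈ (insert u s.1)ᶜ,
      X.mass (insert v (insert u s.1)) * (f u * f v)]
    intro u hu
    refine sum_eq_zero fun v _ => ?_
    rw [X.mass_mono_eq_zero hu (subset_insert v _), zero_mul]
  have e2 : ∀ F : Fin n → ℝ, ∑ u, (∑ v, (X.link s).edgeWeight u v) * F u.1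
      = ((d : ℝ) - i - 1) * (∑ u ∈ s.1ᶜ, X.mass (insert u s.1) * F u) / c := by
    intro F
    rw [← X.sum_link_vertices s (fun u => X.mass (insert u s.1) * F u)
      (fun v hv => by rw [hv, zero_mul]), mul_sum, sum_div]
    refine sum_congr rfl fun u _ => ?_
    rw [hdeg]; ring
  have e3 := e2 fun _ => 1
  simp only [mul_one] at e3
  rw [sum_mass_insert, s.card_eq] at e3
  rw [e1, e2 f, e3, e2 fun u => f u ^ 2] at hq
  set Q := ∑ u ∈ s.1ᶜ, ∑ v ∈ (insert u s.1)ᶜ, X.mass (insert v (insert u s.1)) * (f u * f v)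
  set R := ∑ u ∈ s.1ᶜ, X.mass (insert u s.1) * f u
  set S := ∑ u ∈ s.1ᶜ, X.mass (insert u s.1) * f u ^ 2
  have hdi' : (d : ℝ) - i ≠ 0 := by linarith
  -- The normalization `c` of the edge weights is common to all terms and cancels, leaving an
  -- inequality between masses.
  have e4 : Q / c - (((d : ℝ) - i - 1) * R / c) ^ 2 / (((d : ℝ) - i - 1) * ((d - i) * X.mass s.1) / c)
      = (Q - ((d : ℝ) - i - 1) / (d - i) * (R ^ 2 / X.mass s.1)) / c := by
    field_simp
  rw [e4, abs_div, abs_of_pos hc0, div_le_iff₀ hc0] at hq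
  refine hq.trans (le_of_eq ?_)
  field_simp

end WeightedComplex

/-! ### Localization of the quadratic forms of the averaging operators. -/

namespace WeightedComplex

variable {n d : ℕ} (X : WeightedComplex n d)

/-- A function on faces, extended by zero to all sets of vertices. -/
noncomputable def extend {i : ℕ} (g : X.Fn i) (s : Finset (Fin n)) : ℝ :=
  if h : s ∈ X.level i then g ⟨s, h⟩ else 0

variable {X}

theorem extend_coe {i : ℕ} (g : X.Fn i) (s : X.Face i) : X.extend g s.1 = g s := by
  rw [extend, dif_pos s.2]

theorem level_subset_powersetCard (i : ℕ) : X.level i ⊆ powersetCard i univ := fun _ hs =>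
  mem_powersetCard.mpr ⟨subset_univ _, (X.mem_level.mp hs).1⟩

theorem sum_level_eq {i : ℕ} (F : Finset (Fin n) → ℝ) (hF : ∀ s, X.mass s = 0 → F s = 0) :
    ∑ s : X.Face i, F s.1 = ∑ s ∈ powersetCard i univ, F s := by
  rw [sum_face_univ]
  refine sum_subset (level_subset_powersetCard i) fun s hs hs' => hF s (X.mass_eq_zero ?_)
  rwa [(mem_powersetCard.mp hs).2]

theorem inner_self_eq_mass {i : ℕ} (g : X.Fn i) :
    (d.choose i : ℝ) * X.inner g g = ∑ x ∈ powersetCard i univ, X.mass x * X.extend g x ^ 2 := by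
  rw [← sum_level_eq (X := X) (fun x => X.mass x * X.extend g x ^ 2) (fun s hs => by rw [hs, zero_mul]), inner_eq,
    mul_sum]
  refine sum_congr rfl fun x _ => ?_
  have := (X.choose_pos_of_mem_level x.2).ne'
  rw [extend_coe, prob_eq_mass, x.card_eq]
  field_simp

theorem sum_subfaces {i : ℕ} (g : X.Fn i) (y : X.Face (i + 1)) :
    ∑ x : X.Face i with x.1 ⊆ y.1, g x = ∑ u ∈ y.1, X.extend g (y.1.erase u) := by
  refine (sum_bij (fun u (_ : u ∈ y.1) => (⟨y.1.erase u, X.mem_level_of_subset y.2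
    (erase_subset _ _) (by rw [card_erase_of_mem ‹_›, y.card_eq]; rfl)⟩ : X.Face i)) ?_ ?_ ?_ ?_).symm
  · intro u hu
    simp [erase_subset]
  · intro u hu v hv huv
    exact (erase_inj y.1 hu).mp (congrArg Subtype.val huv)
  · intro x hx
    have hxy := (mem_filter.mp hx).2
    obtain ⟨u, hu⟩ := card_eq_one.mp (show (y.1 \ x.1).card = 1 by
      rw [card_sdiff_of_subset hxy, y.card_eq, Face.card_eq x]; omega)
    have huy : u ∈ y.1 \ x.1 := by rw [hu]; exact mem_singleton_self u
    refine ⟨u, (mem_sdiff.mp huy).1, Subtype.ext ?_⟩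
    change y.1.erase u = x.1
    rw [erase_eq, ← hu, Finset.sdiff_sdiff_eq_self hxy]
  · intro u hu
    rw [extend, dif_pos]

theorem sum_superfaces {i : ℕ} (x : X.Face i) (F : Finset (Fin n) → ℝ)
    (hF : ∀ s, X.mass s = 0 → F s = 0) :
    ∑ y : X.Face (i + 1) with x.1 ⊆ y.1, F y.1 = ∑ u ∈ x.1ᶜ, F (insert u x.1) := by
  rw [X.sum_face (fun y => x.1 ⊆ y)]
  have h1 : ∑ y ∈ X.level (i + 1) with x.1 ⊆ y, F y
      = ∑ y ∈ powersetCard (i + 1) univ with x.1 ⊆ y, F y := by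
    refine sum_subset (filter_subset_filter _ (level_subset_powersetCard _)) fun s hs hs' => ?_
    rw [mem_filter] at hs hs'
    refine hF s (X.mass_eq_zero ?_)
    rw [(mem_powersetCard.mp hs.1).2]
    exact fun h => hs' ⟨h, hs.2⟩
  rw [h1]
  refine (sum_bij (fun u _ => insert u x.1) ?_ ?_ ?_ ?_).symm
  · intro u hu
    rw [mem_compl] at hu
    simp [card_insert_of_notMem hu, x.card_eq]
  · intro u hu v hv huv
    exact (insert_inj (mem_compl.mp hu)).mp huv
  · intro y hy
    obtain ⟨hy1, hy2⟩ := mem_filter.mp hy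
    obtain ⟨u, hu⟩ := card_eq_one.mp (show (y \ x.1).card = 1 by
      rw [card_sdiff_of_subset hy2, (mem_powersetCard.mp hy1).2, x.card_eq]; omega)
    have huy : u ∈ y \ x.1 := by rw [hu]; exact mem_singleton_self u
    refine ⟨u, mem_compl.mpr (mem_sdiff.mp huy).2, ?_⟩
    rw [insert_eq, ← hu, sdiff_union_of_subset hy2]
  · intro u hu
    rfl

/-- The down operator with denominators cleared: in terms of masses it is the sum over the vertices
of the link. -/
theorem down_eq_mass {i : ℕ} (g : X.Fn (i + 1)) (x : X.Face i) :
    ((d : ℝ) - i) * X.mass x.1 * X.down i g x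
      = ∑ u ∈ x.1ᶜ, X.mass (insert u x.1) * X.extend g (insert u x.1) := by
  rw [← sum_superfaces x (fun s => X.mass s * X.extend g s) (fun s hs => by rw [hs, zero_mul]), down_apply, mul_sum,
    mul_sum]
  refine sum_congr rfl fun y _ => ?_
  have hid : i + 1 ≤ d := y.le
  have h3 : ((d.choose (i + 1) : ℕ) : ℝ) * ((i : ℝ) + 1) = (d.choose i : ℝ) * ((d : ℝ) - i) := by
    rw [← Nat.cast_sub (by omega)]
    exact_mod_cast Nat.choose_succ_right_eq d i
  have hm := (X.mass_pos x.2).ne'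
  have h1 := (X.choose_pos_of_mem_level x.2).ne'
  have h2 := (X.choose_pos_of_mem_level y.2).ne'
  rw [extend_coe, prob_eq_mass, prob_eq_mass, y.card_eq, x.card_eq]
  have h4 : (i : ℝ) + 1 ≠ 0 := by positivity
  field_simp
  linear_combination -(X.mass y.1 * g y) * h3

/-- Expansion of the square in `‖U g‖²`. The diagonal pairs give `‖g‖²`; the remaining pairs are
distinct `m`-faces `x` and `(insert v x).erase u` of a common `(m+1)`-face. -/
theorem inner_up_self {m : ℕ} (hm : m + 1 ≤ d) (g : X.Fn m) :
    ((m : ℝ) + 1) * (d - m) * (d.choose m) * X.inner (X.up m g) (X.up m g)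
      = (d - m) * (d.choose m * X.inner g g) + ∑ x ∈ powersetCard m univ, ∑ v ∈ xᶜ,
        ∑ u ∈ x, X.mass (insert v x) * (X.extend g x * X.extend g ((insert v x).erase u)) := by
  have h3 : ((d.choose (m + 1) : ℕ) : ℝ) * ((m : ℝ) + 1) = (d.choose m : ℝ) * ((d : ℝ) - m) := by
    rw [← Nat.cast_sub (by omega)]
    exact_mod_cast Nat.choose_succ_right_eq d m
  have h1 : ((m : ℝ) + 1) * (d - m) * (d.choose m) * X.inner (X.up m g) (X.up m g)
      = ∑ y ∈ powersetCard (m + 1) univ, X.mass y * (∑ u ∈ y, X.extend g (y.erase u)) ^ 2 := by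
    rw [← sum_level_eq (X := X) (fun y => X.mass y * (∑ u ∈ y, X.extend g (y.erase u)) ^ 2)
      (fun s hs => by rw [hs, zero_mul]), inner_eq, mul_sum]
    refine sum_congr rfl fun y _ => ?_
    have h2 := (X.choose_pos_of_mem_level y.2).ne'
    have h4 : (m : ℝ) + 1 ≠ 0 := by positivity
    rw [up_apply, sum_subfaces, prob_eq_mass, y.card_eq]
    field_simp
    linear_combination -(X.mass y.1 * (∑ u ∈ y.1, X.extend g (y.1.erase u)) ^ 2) * h3
  have h2 : ∀ y ∈ powersetCard (m + 1) (univ : Finset (Fin n)),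
      X.mass y * (∑ u ∈ y, X.extend g (y.erase u)) ^ 2
      = ∑ v ∈ y, X.mass (insert v (y.erase v)) * (X.extend g (y.erase v) *
        ∑ u ∈ insert v (y.erase v), X.extend g ((insert v (y.erase v)).erase u)) := by
    intro y _
    rw [sq, sum_mul, mul_sum]
    refine sum_congr rfl fun v hv => ?_
    rw [insert_erase hv]
  rw [h1, sum_congr rfl h2, sum_powersetCard_succ_sum m (fun x v => X.mass (insert v x) *
    (X.extend g x * ∑ u ∈ insert v x, X.extend g ((insert v x).erase u))), inner_self_eq_mass,
    mul_sum, ← sum_add_distrib]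
  refine sum_congr rfl fun x hx => ?_
  have h5 := X.sum_mass_insert x
  rw [(mem_powersetCard.mp hx).2] at h5
  rw [← mul_assoc, ← h5, sum_mul, ← sum_add_distrib]
  refine sum_congr rfl fun v hv => ?_
  rw [mem_compl] at hv
  rw [sum_insert hv, erase_insert hv, mul_add, mul_add, ← mul_sum, ← mul_sum]
  ring

/-- The walk `D_{m+1} U_m` and the walk `U_{m-1} D_m`, up to laziness, have similar quadratic forms. -/
theorem IsLocalSpectralExpander.abs_inner_comm_le {γ : ℝ} (h : X.IsLocalSpectralExpander γ)
    (hγ : 0 ≤ γ) {j : ℕ} (hj : j + 2 ≤ d) (g : X.Fn (j + 1)) :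
    |X.inner (X.up (j + 1) g) (X.up (j + 1) g) - 1 / ((j : ℝ) + 2) * X.inner g g
      - ((j : ℝ) + 1) / (j + 2) * X.inner (X.down j g) (X.down j g)| ≤ γ * X.inner g g := by
  set Q : Finset (Fin n) → ℝ := fun s => ∑ u ∈ sᶜ, ∑ v ∈ (insert u s)ᶜ,
    X.mass (insert v (insert u s)) * (X.extend g (insert u s) * X.extend g (insert v s)) with hQ
  set R : Finset (Fin n) → ℝ := fun s => ∑ u ∈ sᶜ, X.mass (insert u s) * X.extend g (insert u s)
    with hR
  set S : Finset (Fin n) → ℝ := fun s => ∑ u ∈ sᶜ, X.mass (insert u s) * X.extend g (insert u s) ^ 2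
    with hS
  have hjd : (j : ℝ) + 2 ≤ d := by exact_mod_cast hj
  have hK : (0 : ℝ) < d.choose (j + 1) := by exact_mod_cast Nat.choose_pos (by omega)
  set K : ℝ := Nat.cast (d.choose (j + 1)) with hKdef
  have hup := inner_up_self (by omega) g
  have hQ0 : ∀ s, X.mass s = 0 → Q s = 0 := by
    intro s hs
    refine sum_eq_zero fun u _ => sum_eq_zero fun v _ => ?_
    rw [X.mass_mono_eq_zero hs ((subset_insert _ _).trans (subset_insert _ _)), zero_mul]
  have hS0 : ∀ s, X.mass s = 0 → S s = 0 := by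
    intro s hs
    refine sum_eq_zero fun u _ => ?_
    rw [X.mass_mono_eq_zero hs (subset_insert _ _), zero_mul]
  -- Two distinct faces in a common `(j+2)`-face meet in a `j`-face `s`. Grouped by `s`, the
  -- off-diagonal pairs form the quadratic form of the link graph of `s`.
  have eQ : ∑ x ∈ powersetCard (j + 1) univ, ∑ v ∈ xᶜ, ∑ u ∈ x, X.mass (insert v x) *
      (X.extend g x * X.extend g ((insert v x).erase u)) = ∑ s : X.Face j, Q s.1 := by
    rw [sum_level_eq Q hQ0, ← sum_powersetCard_succ_sum j (fun s u => ∑ v ∈ (insert u s)ᶜ,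
      X.mass (insert v (insert u s)) * (X.extend g (insert u s) * X.extend g (insert v s)))]
    refine sum_congr rfl fun x _ => ?_
    rw [sum_comm]
    refine sum_congr rfl fun u hu => ?_
    rw [insert_erase hu]
    refine sum_congr rfl fun v hv => ?_
    rw [mem_compl] at hv
    rw [erase_insert_of_ne fun h : v = u => hv (h ▸ hu)]
  have eS : ∑ s : X.Face j, S s.1 = ((j : ℝ) + 1) * (K * X.inner g g) := by
    rw [sum_level_eq S hS0, inner_self_eq_mass, mul_sum,
      ← sum_powersetCard_succ_sum j (fun s u => X.mass (insert u s) * X.extend g (insert u s) ^ 2)]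
    refine sum_congr rfl fun x hx => ?_
    rw [sum_congr rfl fun u hu => by rw [insert_erase hu], sum_const, (mem_powersetCard.mp hx).2,
      nsmul_eq_mul]
    push_cast; rfl
  -- The constant components of the localized functions assemble to `‖D g‖²`, because `R s` is a
  -- multiple of `D g (s)`.
  have eR : ((j : ℝ) + 1) * (d - j) * K * X.inner (X.down j g) (X.down j g)
      = ∑ s : X.Face j, R s.1 ^ 2 / X.mass s.1 := by
    rw [inner_eq, mul_sum]
    refine sum_congr rfl fun s _ => ?_
    have hm := (X.mass_pos s.2).ne'
    have hc := (X.choose_pos_of_mem_level s.2).ne'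
    have h3 : K * ((j : ℝ) + 1) = (d.choose j : ℝ) * ((d : ℝ) - j) := by
      rw [hKdef, ← Nat.cast_sub (by omega)]
      exact_mod_cast Nat.choose_succ_right_eq d j
    simp only [hR]
    rw [← down_eq_mass, prob_eq_mass, s.card_eq]
    field_simp
    linear_combination ((d - j) * X.down j g s ^ 2) * h3
  have hlink : |∑ s : X.Face j, (Q s.1 - ((d : ℝ) - j - 1) / (d - j) * (R s.1 ^ 2 / X.mass s.1))|
      ≤ γ * (((d : ℝ) - j - 1) * (((j : ℝ) + 1) * (K * X.inner g g))) := by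
    rw [← eS, mul_sum, mul_sum]
    exact (abs_sum_le_sum_abs _ _).trans
      (sum_le_sum fun s _ => h.abs_link_quadratic_le hγ hj s fun u => X.extend g (insert u s.1))
  rw [sum_sub_distrib, ← mul_sum, ← eR] at hlink
  rw [eQ, ← hKdef] at hup
  push_cast at hup
  set A := X.inner (X.up (j + 1) g) (X.up (j + 1) g)
  set B := X.inner (X.down j g) (X.down j g)
  set G := X.inner g g with hG
  have hd1 : (0 : ℝ) < d - j - 1 := by linarith
  have hd2 : (0 : ℝ) < (d : ℝ) - j := by linarith
  have hc : 0 < ((j : ℝ) + 2) * (d - j - 1) * K := by positivity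
  -- The dimension-dependent factors cancel and leave the coefficients `1/(j+2)` and `(j+1)/(j+2)`.
  -- The resulting bound is `γ (j+1)/(j+2)`, slightly better than needed.
  have key : ∑ s : X.Face j, Q s.1
      - ((d : ℝ) - j - 1) / (d - j) * (((j : ℝ) + 1) * (d - j) * K * B)
      = (((j : ℝ) + 2) * (d - j - 1) * K)
        * (A - 1 / ((j : ℝ) + 2) * G - ((j : ℝ) + 1) / (j + 2) * B) := by
    field_simp
    linear_combination -hup
  rw [key, abs_mul, abs_of_pos hc] at hlink
  have hG0 : 0 ≤ G := X.inner_self_nonneg g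
  refine le_of_mul_le_mul_left (hlink.trans ?_) hc
  have : (0 : ℝ) ≤ γ * ((d - j - 1) * (K * G)) := by positivity
  nlinarith

/-- On a local-spectral expander, the averaging operators commute approximately in `L²`. -/
theorem IsLocalSpectralExpander.approxComm {γ : ℝ} (h : X.IsLocalSpectralExpander γ)
    (hγ : 0 ≤ γ) : X.ApproxComm d γ X.l2 where
  nonneg := hγ
  up_le m g hm := X.l2_up_le m hm g
  down_le m g hm := X.l2_down_le m hm g
  down_up_zero hd g := X.down_up_zero hd g
  comm j g hj := by
    let E : X.Fn (j + 1) →ₗ[ℝ] X.Fn (j + 1) := X.down (j + 1) ∘ₗ X.up (j + 1)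
      - (1 / ((j : ℝ) + 2)) • LinearMap.id - (((j : ℝ) + 1) / (j + 2)) • (X.up j ∘ₗ X.down j)
    have hE : ∀ f, E f = X.down (j + 1) (X.up (j + 1) f) - (1 / ((j : ℝ) + 2)) • f
      - (((j : ℝ) + 1) / (j + 2)) • X.up j (X.down j f) := fun f => rfl
    rw [← hE]
    have hi : ∀ f f', X.inner f (E f') = X.inner (X.up (j + 1) f) (X.up (j + 1) f')
        - 1 / ((j : ℝ) + 2) * X.inner f f'
        - ((j : ℝ) + 1) / (j + 2) * X.inner (X.down j f) (X.down j f') := by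
      intro f f'
      have e1 := X.inner_up (j + 1) f (X.up (j + 1) f')
      have e2 : X.inner f (X.up j (X.down j f')) = X.inner (X.down j f) (X.down j f') := by
        rw [inner_comm, inner_up, inner_comm]
      rw [hE, inner_sub_right, inner_sub_right, inner_smul_right, inner_smul_right, e1, e2]
    -- The commutation error is self-adjoint, so a bound on its quadratic form is a bound on its
    -- norm.
    refine X.l2_le_of_abs_inner_le E ?_ ?_ g
    · intro f f'
      rw [X.inner_comm, hi, hi, X.inner_comm f', X.inner_comm (X.up (j + 1) f'),
        X.inner_comm (X.down j f')]
    · intro f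
      rw [hi]
      exact h.abs_inner_comm_le hγ hj f

/-- In a local-spectral expander, the vertices of a link have a small probability. -/
theorem IsLocalSpectralExpander.prob_le {γ : ℝ} (h : X.IsLocalSpectralExpander γ)
    (hγ : 0 ≤ γ) {i : ℕ} (hi : i + 2 ≤ d) (x : X.Face i) (s : X.Face (i + 1)) (hxs : x.1 ⊆ s.1) :
    X.prob s.1 ≤ ((i : ℝ) + 1) * γ * X.prob x.1 := by
  obtain ⟨v, hv⟩ := card_eq_one.mp (show (s.1 \ x.1).card = 1 by
    rw [card_sdiff_of_subset hxs, s.card_eq, x.card_eq]; omega)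
  have hvs : v ∈ s.1 \ x.1 := by rw [hv]; exact mem_singleton_self v
  have hvx := (mem_sdiff.mp hvs).2
  have hs : s.1 = insert v x.1 := by rw [insert_eq, ← hv, sdiff_union_of_subset hxs]
  have hq := h.abs_link_quadratic_le hγ hi x fun u => if u = v then 1 else 0
  -- The test function is the indicator of the single vertex `v` of the link. There are no loops, so
  -- its quadratic form is zero and only the constant component, of order `mass(s)²/mass(x)`,
  -- remains.
  have h1 : ∑ u ∈ x.1ᶜ, ∑ w ∈ (insert u x.1)ᶜ, X.mass (insert w (insert u x.1)) *
      ((if u = v then (1 : ℝ) else 0) * if w = v then 1 else 0) = 0 := by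
    refine sum_eq_zero fun u _ => sum_eq_zero fun w hw => ?_
    by_cases h2 : u = v
    · have : w ≠ v := fun h3 => by simp [h2, h3] at hw
      simp [this]
    · simp [h2]
  have hvx' : v ∈ x.1ᶜ := mem_compl.mpr hvx
  rw [h1] at hq
  simp only [mul_ite, mul_one, mul_zero, ite_pow, one_pow, ne_eq, OfNat.ofNat_ne_zero,
    not_false_eq_true, zero_pow, sum_ite_eq', hvx', if_true, zero_sub, abs_neg] at hq
  rw [← hs] at hq
  have hms := X.mass_pos s.2
  have hmx := X.mass_pos x.2
  have hid : (i : ℝ) + 2 ≤ d := by exact_mod_cast hi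
  have hd1 : (0 : ℝ) < (d : ℝ) - i - 1 := by linarith
  have hd2 : (0 : ℝ) < (d : ℝ) - i := by linarith
  rw [abs_of_nonneg (by positivity)] at hq
  have h4 : X.mass s.1 ≤ γ * ((d - i) * X.mass x.1) := by
    have h5 : ((d : ℝ) - i - 1) / (d - i) * (X.mass s.1 ^ 2 / X.mass x.1)
        = ((d - i - 1) * X.mass s.1) * (X.mass s.1 / ((d - i) * X.mass x.1)) := by
      field_simp
    rw [h5, show γ * (((d : ℝ) - i - 1) * X.mass s.1) = ((d - i - 1) * X.mass s.1) * γ by ring] at hq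
    have h6 := le_of_mul_le_mul_left hq (by positivity)
    rwa [div_le_iff₀ (by positivity)] at h6
  have h3 : ((d.choose (i + 1) : ℕ) : ℝ) * ((i : ℝ) + 1) = (d.choose i : ℝ) * ((d : ℝ) - i) := by
    rw [← Nat.cast_sub (by omega)]
    exact_mod_cast Nat.choose_succ_right_eq d i
  have hc1 := X.choose_pos_of_mem_level s.2
  have hc0 := X.choose_pos_of_mem_level x.2
  rw [prob_eq_mass, prob_eq_mass, s.card_eq, x.card_eq, div_le_iff₀ hc1]
  calc X.mass s.1 ≤ _ := h4
    _ = γ * X.mass x.1 * ((d.choose i : ℝ) * ((d : ℝ) - i)) / d.choose i := by field_simp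
    _ = _ := by rw [← h3]; ring

end WeightedComplex

/-! ### Approximate projections -/

namespace WeightedComplex

variable {n d : ℕ} (X : WeightedComplex n d)

theorem op_ups {k m j : ℕ} (w : WalkWord k m) (h : m ≤ j) :
    (w.ups h).op X = X.upTo h ∘ₗ w.op X := by
  induction j, h using Nat.le_induction with
  | base => simp
  | succ j h ih => rw [WalkWord.ups_succ w h, WalkWord.op, ih, upTo_succ X h, LinearMap.comp_assoc]

theorem op_downs {k m j : ℕ} (w : WalkWord k m) (h : j ≤ m) :
    (w.downs h).op X = X.downTo h ∘ₗ w.op X := by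
  induction h using Nat.decreasingInduction with
  | self => simp
  | of_succ i hi ih =>
    rw [WalkWord.downs_succ_left w hi, WalkWord.op, ih, downTo_succ_left X hi, LinearMap.comp_assoc]

theorem op_lower {k j : ℕ} (h : j ≤ k) :
    (WalkWord.lower h).op X = X.upTo h ∘ₗ X.downTo h := by
  rw [WalkWord.lower, op_ups, op_downs]; rfl

theorem op_canonical (k i : ℕ) : (WalkWord.canonical k i).op X = X.canonicalWalk k i := by
  rw [WalkWord.canonical, op_downs, op_ups]; rfl

theorem op_const {k : ℕ} (c : ℝ) : {m : ℕ} → (w : WalkWord k m) → w.maxLevel ≤ d →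
    w.op X (fun _ => c) = fun _ => c
  | _, .nil, _ => rfl
  | _, .up w, h => by
    rw [WalkWord.maxLevel, max_le_iff] at h
    rw [WalkWord.op, LinearMap.comp_apply, op_const c w h.2, up_const]
  | _, .down w, h => by
    rw [WalkWord.maxLevel] at h
    rw [WalkWord.op, LinearMap.comp_apply, op_const c w h, down_const X (w.le_maxLevel.2.trans h)]

theorem comb_op_apply {k : ℕ} (M : WalkComb k) (f : X.Fn k) :
    M.op X f = M.sum fun Y a => a • Y.op X f := by
  simp [WalkComb.op, Finsupp.sum, LinearMap.sum_apply]

theorem comb_op_const {k : ℕ} {M : WalkComb k} (h1 : (M.sum fun _ a => a) = 1)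
    (h2 : ∀ Y ∈ M.support, Y.maxLevel ≤ d) (c : ℝ) : M.op X (fun _ => c) = fun _ => c := by
  rw [comb_op_apply, Finsupp.sum, sum_congr rfl fun Y hY => by rw [op_const X c Y (h2 Y hY)],
    ← sum_smul]
  rw [Finsupp.sum] at h1
  rw [h1, one_smul]

theorem normalForm_single {k j : ℕ} (h : j ≤ k) (g : X.Fn k) :
    X.normalForm k k (Pi.single j 1) g = X.upTo h (X.downTo h g) := by
  rw [normalForm_apply, sum_eq_single j]
  · rw [Pi.single_eq_same, one_smul, upFrom_of_le X h, downFrom_of_le X h]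
  · intro i _ hi
    rw [Pi.single_eq_of_ne hi, zero_smul]
  · intro hj; exact absurd (mem_range.mpr (by omega)) hj

/-- Since `U^k_j` is the adjoint of `D^k_j`, a normal form only sees the restrictions to lower
levels; in particular it is self-adjoint. -/
theorem inner_normalForm {k : ℕ} (a : ℕ → ℝ) (f g : X.Fn k) :
    X.inner f (X.normalForm k k a g)
      = ∑ j ∈ range (k + 1), a j * X.inner (X.downFrom k j f) (X.downFrom k j g) := by
  rw [normalForm_apply, inner_sum_right]
  refine sum_congr rfl fun j hj => ?_
  have h : j ≤ k := by have := mem_range.mp hj; omega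
  rw [inner_smul_right, upFrom_of_le X h, downFrom_of_le X h, inner_comm, inner_upTo,
    X.inner_comm]

theorem inner_normalForm_left {k : ℕ} (a : ℕ → ℝ) (f g : X.Fn k) :
    X.inner (X.normalForm k k a f) g = X.inner f (X.normalForm k k a g) := by
  rw [inner_comm, inner_normalForm, inner_normalForm]
  exact sum_congr rfl fun j _ => by rw [inner_comm]

/-- The approximate projection to the `i`-th level of `C_k`. -/
noncomputable def proj (k i : ℕ) : X.Fn k →ₗ[ℝ] X.Fn k := X.normalForm k k (projCoef k i)

/-- An exact identity, valid on every complex: it is linear algebra in the coefficients and needs no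
commutation. -/
theorem normalForm_eq_sum_proj {k : ℕ} {m : ℕ} (a : ℕ → ℝ) (g : X.Fn k) :
    X.normalForm k m a g
      = ∑ l ∈ range (k + 1), coefEigenvalue k a l • X.normalForm k m (projCoef k l) g := by
  simp only [normalForm_apply, smul_sum, smul_smul]
  rw [sum_comm]
  refine sum_congr rfl fun j hj => ?_
  rw [← sum_smul, sum_coefEigenvalue_mul_projCoef (by have := mem_range.mp hj; omega)]

/-- The identity is the normal form whose eigenvalues are all one. -/
theorem sum_proj {k : ℕ} (g : X.Fn k) : ∑ l ∈ range (k + 1), X.proj k l g = g := by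
  have h := X.normalForm_eq_sum_proj (m := k) (Pi.single k 1) g
  rw [normalForm_single X le_rfl, upTo_self, downTo_self] at h
  simp only [LinearMap.id_apply] at h
  conv_rhs => rw [h]
  refine sum_congr rfl fun l hl => ?_
  have hl' : l ≤ k := by have := mem_range.mp hl; omega
  rw [coefEigenvalue_single le_rfl, div_self (by exact_mod_cast (Nat.choose_pos hl').ne'), one_smul,
    proj]

theorem inner_proj_left {k i : ℕ} (f g : X.Fn k) :
    X.inner (X.proj k i f) g = X.inner f (X.proj k i g) := X.inner_normalForm_left _ f g

/-- The error factor of the approximate eigendecomposition. -/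
noncomputable def _root_.WalkComb.errCoef {k : ℕ} (M : WalkComb k) : ℝ :=
  M.weight * M.height * (k + M.height)

theorem _root_.WalkComb.weight_nonneg {k : ℕ} (M : WalkComb k) : 0 ≤ M.weight :=
  sum_nonneg fun _ _ => abs_nonneg _

theorem _root_.WalkComb.errCoef_nonneg {k : ℕ} (M : WalkComb k) : 0 ≤ M.errCoef := by
  have := M.weight_nonneg
  rw [WalkComb.errCoef]; positivity

variable {X} {L : ℕ} {γ : ℝ} {p : ∀ m, Seminorm ℝ (X.Fn m)}

/-- Each pure walk multiplies the eigenvalues of the coefficients by `λ_l(Y)`, so the combination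
multiplies them by `λ_l(M)`. Applied to the identity this gives `M ≈ ∑ λ_l π_l`; applied to
`projCoef` it gives `M π_i ≈ λ_i π_i`. -/
theorem ApproxComm.comb_normalForm (h : X.ApproxComm L γ p) {k : ℕ} (M : WalkComb k)
    (hM : ∀ Y ∈ M.support, Y.maxLevel ≤ L) {a : ℕ → ℝ} (ha : IsCoef k k a) (g : X.Fn k) :
    p k (M.op X (X.normalForm k k a g)
      - ∑ l ∈ range (k + 1), (M.approxEigenvalue l * coefEigenvalue k a l) • X.proj k l g)
      ≤ M.errCoef * γ * coefNorm k a * p k g := by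
  have h1 : ∑ l ∈ range (k + 1), (M.approxEigenvalue l * coefEigenvalue k a l) • X.proj k l g
      = M.sum fun Y c => c • X.normalForm k k (Y.coef a) g := by
    simp only [WalkComb.approxEigenvalue, Finsupp.sum, sum_mul, sum_smul]
    rw [sum_comm]
    refine sum_congr rfl fun Y _ => ?_
    rw [X.normalForm_eq_sum_proj (Y.coef a), smul_sum]
    refine sum_congr rfl fun l _ => ?_
    rw [Y.coefEigenvalue_coef ha, smul_smul, proj, mul_assoc]
  rw [h1, comb_op_apply, Finsupp.sum, Finsupp.sum, ← sum_sub_distrib]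
  refine (le_sum_of_subadditive _ (map_zero _).le (map_add_le_add _) _ _).trans ?_
  rw [WalkComb.errCoef, WalkComb.weight, Finsupp.sum, sum_mul, sum_mul, sum_mul, sum_mul, sum_mul]
  refine sum_le_sum fun Y hY => ?_
  rw [← smul_sub, map_smul_eq_mul, Real.norm_eq_abs]
  have h2 := h.word_normalForm ha g Y (hM Y hY)
  have hh : (Y.height : ℝ) ≤ M.height := by
    exact_mod_cast le_sup (f := WalkWord.height) hY
  have hl : (Y.maxLevel : ℝ) ≤ k + M.height := by
    have : (Y.maxLevel : ℝ) ≤ k + Y.height := by exact_mod_cast Y.maxLevel_le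
    linarith
  have := h.nonneg
  have := coefNorm_nonneg k a
  have : 0 ≤ p k g := apply_nonneg _ _
  calc _ ≤ |M Y| * ((Y.height : ℝ) * Y.maxLevel * γ * coefNorm k a * p k g) := by gcongr
    _ ≤ |M Y| * ((M.height : ℝ) * (k + M.height) * γ * coefNorm k a * p k g) := by gcongr
    _ = _ := by ring

theorem ApproxComm.comb_sub_sum (h : X.ApproxComm L γ p) {k : ℕ} (M : WalkComb k)
    (hM : ∀ Y ∈ M.support, Y.maxLevel ≤ L) (g : X.Fn k) :
    p k (M.op X g - ∑ l ∈ range (k + 1), M.approxEigenvalue l • X.proj k l g)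
      ≤ M.errCoef * γ * p k g := by
  have h1 := h.comb_normalForm M hM (isCoef_single le_rfl) g
  rw [normalForm_single X le_rfl, upTo_self, downTo_self, coefNorm_single le_rfl, mul_one] at h1
  rw [sum_congr rfl fun l hl => by
    rw [← mul_one (M.approxEigenvalue l), ← div_self (show (k.choose l : ℝ) ≠ 0 by
      exact_mod_cast (Nat.choose_pos (by have := mem_range.mp hl; omega)).ne'),
      ← coefEigenvalue_single le_rfl]]
  exact h1

theorem ApproxComm.comb_proj (h : X.ApproxComm L γ p) {k i : ℕ} (hi : i ≤ k) (M : WalkComb k)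
    (hM : ∀ Y ∈ M.support, Y.maxLevel ≤ L) (g : X.Fn k) :
    p k (M.op X (X.proj k i g) - M.approxEigenvalue i • X.proj k i g)
      ≤ M.errCoef * γ * 4 ^ k * p k g := by
  have h1 := h.comb_normalForm M hM (isCoef_projCoef hi) g
  rw [sum_eq_single i (by
      intro l _ hl
      rw [coefEigenvalue_projCoef hi, if_neg hl.symm, mul_zero, zero_smul])
    (fun hj => absurd (mem_range.mpr (by omega)) hj), coefEigenvalue_projCoef hi, if_pos rfl,
    mul_one] at h1
  refine h1.trans ?_
  have := h.nonneg
  have := M.errCoef_nonneg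
  have : 0 ≤ p k g := apply_nonneg _ _
  gcongr
  exact coefNorm_projCoef_le hi

theorem ApproxComm.proj_le (h : X.ApproxComm L γ p) {k i : ℕ} (hk : k ≤ L) (hi : i ≤ k) (g : X.Fn k) :
    p k (X.proj k i g) ≤ 4 ^ k * p k g := by
  rw [proj, normalForm_apply]
  refine (le_sum_of_subadditive _ (map_zero _).le (map_add_le_add _) _ _).trans ?_
  refine le_trans ?_ (mul_le_mul_of_nonneg_right (coefNorm_projCoef_le hi) (apply_nonneg _ _))
  rw [coefNorm, sum_mul]
  refine sum_le_sum fun j _ => ?_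
  rw [map_smul_eq_mul, Real.norm_eq_abs]
  gcongr
  exact (h.upFrom_le hk _).trans (h.downFrom_le hk _)

/-- The outer `π_i` is a combination of the words `U^k_j D^k_j`, each of which multiplies the inner
`π_i` by nearly `binom(j,i)/binom(k,i)`; weighted by `projCoef` these factors add up to one. Both
copies contribute a coefficient norm `4^k`, hence `16^k`. -/
theorem ApproxComm.proj_proj (h : X.ApproxComm L γ p) {k i : ℕ} (hk : k ≤ L) (hi : i ≤ k)
    (g : X.Fn k) :
    p k (X.proj k i (X.proj k i g) - X.proj k i g) ≤ (k : ℝ) ^ 2 * 16 ^ k * γ * p k g := by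
  have h1 : X.proj k i g = ∑ j ∈ range (k + 1), (projCoef k i j) •
      if hj : j ≤ k then X.normalForm k k ((WalkWord.lower hj).coef (projCoef k i)) g else 0 := by
    have h2 : ∀ j ∈ range (k + 1), (projCoef k i j) •
      (if hj : j ≤ k then X.normalForm k k ((WalkWord.lower hj).coef (projCoef k i)) g else 0)
      = (projCoef k i j * ((j.choose i : ℝ) / (k.choose i : ℝ))) • X.proj k i g := by
      intro j hj
      have hj' : j ≤ k := by have := mem_range.mp hj; omega
      rw [dif_pos hj', normalForm_eq_sum_proj, sum_eq_single i, mul_smul]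
      · rw [WalkWord.coefEigenvalue_coef (isCoef_projCoef hi), coefEigenvalue_projCoef hi,
          if_pos rfl, mul_one, WalkWord.approxEigenvalue_lower hj' hi, proj]
      · intro l _ hl
        rw [WalkWord.coefEigenvalue_coef (isCoef_projCoef hi), coefEigenvalue_projCoef hi,
          if_neg hl.symm, mul_zero, zero_smul]
      · intro hj; exact absurd (mem_range.mpr (by omega)) hj
    rw [sum_congr rfl h2, ← sum_smul]
    have := coefEigenvalue_projCoef (l := i) hi
    rw [if_pos rfl, coefEigenvalue] at this
    rw [this, one_smul]
  have h3 : X.proj k i (X.proj k i g) = ∑ j ∈ range (k + 1), (projCoef k i j) •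
      if hj : j ≤ k then (WalkWord.lower hj).op X (X.proj k i g) else 0 := by
    conv_lhs => rw [proj, normalForm_apply]
    refine sum_congr rfl fun j hj => ?_
    have hj' : j ≤ k := by have := mem_range.mp hj; omega
    rw [dif_pos hj', op_lower, upFrom_of_le X hj', downFrom_of_le X hj']
    rfl
  have hdiff : X.proj k i (X.proj k i g) - X.proj k i g = ∑ j ∈ range (k + 1), ((projCoef k i j) •
      (if hj : j ≤ k then (WalkWord.lower hj).op X (X.proj k i g) else 0) - (projCoef k i j) •
      if hj : j ≤ k then X.normalForm k k ((WalkWord.lower hj).coef (projCoef k i)) g else 0) := by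
    rw [sum_sub_distrib, ← h3, ← h1]
  rw [hdiff]
  have hγ := h.nonneg
  have hp : 0 ≤ p k g := apply_nonneg _ _
  refine (le_sum_of_subadditive _ (map_zero _).le (map_add_le_add _) _ _).trans ?_
  have h4 : ∀ j ∈ range (k + 1), p k ((projCoef k i j) •
      (if hj : j ≤ k then (WalkWord.lower hj).op X (X.proj k i g) else 0) - (projCoef k i j) •
      if hj : j ≤ k then X.normalForm k k ((WalkWord.lower hj).coef (projCoef k i)) g else 0)
      ≤ |projCoef k i j| * ((k : ℝ) ^ 2 * 4 ^ k * γ * p k g) := by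
    intro j hj
    have hj' : j ≤ k := by have := mem_range.mp hj; omega
    rw [dif_pos hj', dif_pos hj', ← smul_sub, map_smul_eq_mul, Real.norm_eq_abs]
    have h5 := h.word_normalForm (isCoef_projCoef hi) g (WalkWord.lower hj')
      (by rwa [WalkWord.maxLevel_lower])
    rw [WalkWord.maxLevel_lower, WalkWord.height_lower] at h5
    have h6 : ((k - j : ℕ) : ℝ) ≤ k := by exact_mod_cast Nat.sub_le k j
    have h7 := coefNorm_projCoef_le hi
    have h8 := coefNorm_nonneg k (projCoef k i)
    refine mul_le_mul_of_nonneg_left (h5.trans ?_) (abs_nonneg _)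
    calc ((k - j : ℕ) : ℝ) * k * γ * coefNorm k (projCoef k i) * p k g
        ≤ (k : ℝ) * k * γ * 4 ^ k * p k g := by gcongr
      _ = _ := by ring
  refine (sum_le_sum h4).trans ?_
  rw [← sum_mul]
  have h7 := coefNorm_projCoef_le hi
  rw [coefNorm] at h7
  calc _ ≤ (4 : ℝ) ^ k * ((k : ℝ) ^ 2 * 4 ^ k * γ * p k g) := by gcongr
    _ = _ := by rw [show (16 : ℝ) = 4 * 4 by norm_num, mul_pow]; ring

end WeightedComplex

/-! ### The levels of an expander are non-trivial -/

namespace WeightedComplex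

variable {n d : ℕ} {X : WeightedComplex n d}

theorem l2_single_sq {i : ℕ} (s : X.Face i) : X.l2 i (Pi.single s 1) ^ 2 = X.prob s.1 := by
  rw [l2_sq, inner_eq, sum_eq_single s]
  · simp
  · intro t _ ht
    simp [ht]
  · simp

/-- On a subface `x` of `s` the value of `D 1_s` is `Π(s)/((i+1) Π(x)) ≤ γ`, and `‖D 1_s‖²` is
`Π(s)` times the average of these values. -/
theorem IsLocalSpectralExpander.l2_down_single_le {γ : ℝ} (h : X.IsLocalSpectralExpander γ)
    (hγ : 0 ≤ γ) {i : ℕ} (hi : i + 2 ≤ d) (s : X.Face (i + 1)) :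
    X.l2 i (X.down i (Pi.single s 1)) ≤ √γ * X.l2 (i + 1) (Pi.single s 1) := by
  refine le_of_sq_le_sq ?_ (by positivity)
  rw [mul_pow, Real.sq_sqrt hγ, l2_single_sq, l2_sq, inner_comm, ← inner_up, inner_eq,
    sum_eq_single s]
  · have hi1 : (0 : ℝ) < (i : ℝ) + 1 := by positivity
    rw [Pi.single_eq_same, mul_one, up_apply, mul_comm]
    refine mul_le_mul_of_nonneg_right ?_ (X.prob_pos s).le
    have h1 : ∀ x ∈ (univ : Finset (X.Face i)).filter (fun x => x.1 ⊆ s.1),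
        X.down i (Pi.single s 1) x ≤ γ := by
      intro x hx
      have hxs := (mem_filter.mp hx).2
      rw [down_apply, sum_eq_single s]
      · rw [Pi.single_eq_same, mul_one]
        have := h.prob_le hγ hi x s hxs
        rw [one_div_mul_eq_div, div_le_iff₀ hi1, div_le_iff₀ (X.prob_pos x)]
        linarith
      · intro t _ ht
        rw [Pi.single_eq_of_ne ht, mul_zero]
      · intro hs; simp [hxs] at hs
    have h2 := sum_le_card_nsmul _ _ _ h1
    rw [card_filter_subset, nsmul_eq_mul] at h2
    push_cast at h2
    rw [one_div_mul_eq_div, div_le_iff₀ hi1]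
    linarith
  · intro t _ ht
    rw [Pi.single_eq_of_ne ht, mul_zero, mul_zero]
  · simp

theorem IsLocalSpectralExpander.l2_downTo_single_le {γ : ℝ} (h : X.IsLocalSpectralExpander γ)
    (hγ : 0 ≤ γ) {i m : ℕ} (hi : i + 1 ≤ d) (hm : m < i) (s : X.Face i) :
    X.l2 m (X.downTo hm.le (Pi.single s 1)) ≤ √γ * X.l2 i (Pi.single s 1) := by
  obtain ⟨i, rfl⟩ : ∃ i', i = i' + 1 := ⟨i - 1, by omega⟩
  rw [downTo_succ X (Nat.lt_succ_iff.mp hm)]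
  exact ((h.approxComm hγ).downTo_le _ (by omega) _).trans (h.l2_down_single_le hγ hi s)

/-- In the normal form of `D^k_i U^k_i` all terms except the last pass through a lower level, where
the point mass has become small, and their coefficients have total size at most one. The last term
is a multiple of the identity. -/
theorem IsLocalSpectralExpander.l2_downTo_upTo_single_le {γ : ℝ} (h : X.IsLocalSpectralExpander γ)
    (hγ : 0 ≤ γ) {i k : ℕ} (hik : i < k) (hk : k ≤ d) (s : X.Face i) :
    X.l2 i (X.downTo hik.le (X.upTo hik.le (Pi.single s 1))
      - (1 / (k.choose i : ℝ)) • (Pi.single s 1 : X.Fn i))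
      ≤ (√γ + (k : ℝ) ^ 2 * γ) * X.l2 i (Pi.single s 1) := by
  have hA := h.approxComm hγ
  set e : X.Fn i := Pi.single s 1 with he
  set N := X.l2 i e with hN
  have hN0 : 0 ≤ N := apply_nonneg _ _
  let w : WalkWord i i := ((WalkWord.nil (k := i)).ups hik.le).downs hik.le
  have hmax : w.maxLevel = k := by
    simp only [w, WalkWord.maxLevel_downs, WalkWord.maxLevel_ups, WalkWord.maxLevel]; omega
  have hh : w.height + i = k := by
    simp only [w, WalkWord.height_downs, WalkWord.height_ups, WalkWord.height]; omega
  have hop : w.op X e = X.downTo hik.le (X.upTo hik.le e) := by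
    simp only [w, op_downs, op_ups]; rfl
  have h1 := hA.word_normalForm (isCoef_single (le_refl i)) e w (by omega)
  rw [normalForm_single X le_rfl, upTo_self, downTo_self, coefNorm_single le_rfl, hmax] at h1
  simp only [LinearMap.id_apply] at h1
  rw [hop] at h1
  set c := w.coef (Pi.single i 1) with hc
  have hc1 : coefNorm i c ≤ 1 := by
    rw [← coefNorm_single (le_refl i)]
    exact WalkWord.coefNorm_coef_le (isCoef_single le_rfl) w
  -- The eigenvalue on level `i` involves only the last coefficient, because `binom(j,i) = 0` for `j
  -- < i`.
  have hci : c i = 1 / (k.choose i : ℝ) := by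
    have h2 := WalkWord.coefEigenvalue_coef (l := i) (isCoef_single (le_refl i)) w
    rw [coefEigenvalue_single le_rfl, coefEigenvalue, sum_range_succ, sum_eq_zero, zero_add] at h2
    · simp only [w, WalkWord.approxEigenvalue_downs _ _ hik.le, WalkWord.approxEigenvalue_ups,
        WalkWord.approxEigenvalue, Nat.choose_self, Nat.cast_one, div_one, mul_one, one_mul] at h2
      exact h2
    · intro j hj
      rw [Nat.choose_eq_zero_of_lt (mem_range.mp hj)]; simp
  have hsplit : X.normalForm i i c e
      = ∑ j ∈ range i, c j • X.upFrom j i (X.downFrom i j e) + (1 / (k.choose i : ℝ)) • e := by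
    rw [normalForm_apply, sum_range_succ, hci, upFrom_of_le X le_rfl, downFrom_of_le X le_rfl,
      upTo_self, downTo_self]
    rfl
  have h3 : X.l2 i (∑ j ∈ range i, c j • X.upFrom j i (X.downFrom i j e)) ≤ √γ * N := by
    refine (le_sum_of_subadditive _ (map_zero _).le (map_add_le_add _) _ _).trans ?_
    have h4 : ∀ j ∈ range i, X.l2 i (c j • X.upFrom j i (X.downFrom i j e)) ≤ |c j| * (√γ * N) := by
      intro j hj
      have hj' : j < i := mem_range.mp hj
      rw [map_smul_eq_mul, Real.norm_eq_abs]
      refine mul_le_mul_of_nonneg_left ((hA.upFrom_le (by omega) _).trans ?_) (abs_nonneg _)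
      rw [downFrom_of_le X hj'.le]
      exact h.l2_downTo_single_le hγ (by omega) hj' s
    refine (sum_le_sum h4).trans ?_
    rw [← sum_mul]
    have h5 : ∑ j ∈ range i, |c j| ≤ 1 := by
      refine le_trans ?_ hc1
      rw [coefNorm, sum_range_succ]
      linarith [abs_nonneg (c i)]
    calc _ ≤ 1 * (√γ * N) := by gcongr
      _ = _ := one_mul _
  have h6 : (w.height : ℝ) * k * γ * 1 * N ≤ (k : ℝ) ^ 2 * γ * N := by
    have : (w.height : ℝ) ≤ k := by exact_mod_cast (by omega : w.height ≤ k)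
    rw [mul_one, sq]
    gcongr
  have h7 : X.downTo hik.le (X.upTo hik.le e) - (1 / (k.choose i : ℝ)) • e
      = (X.downTo hik.le (X.upTo hik.le e) - X.normalForm i i c e)
        + ∑ j ∈ range i, c j • X.upFrom j i (X.downFrom i j e) := by
    rw [hsplit]; abel
  rw [h7]
  calc _ ≤ _ := map_add_le_add _ _ _
    _ ≤ (k : ℝ) ^ 2 * γ * N + √γ * N := add_le_add (h1.trans h6) h3
    _ = _ := by ring

/-- On a good expander, the approximate projection to a level `i < k` is not small. -/
theorem IsLocalSpectralExpander.exists_le_l2_proj {γ : ℝ} (h : X.IsLocalSpectralExpander γ)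
    (hγ : 0 ≤ γ) {i k : ℕ} (hik : i < k) (hk : k ≤ d) (hγk : γ ≤ 1 / (2 ^ k) ^ 10)
    (s : X.Face i) :
    ∃ ψ : X.Fn k, ψ ≠ 0 ∧ 1 / (2 * 4 ^ k) * X.l2 k ψ ≤ X.l2 k (X.proj k i ψ) := by
  have hA := h.approxComm hγ
  set e : X.Fn i := Pi.single s 1 with he
  set N := X.l2 i e with hN
  have hN0 : 0 < N := X.l2_pos (Pi.single_ne_zero_iff.mpr one_ne_zero)
  set ψ := X.upTo hik.le e with hψ
  have hψN : X.l2 k ψ ≤ N := hA.upTo_le _ hk _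
  -- All estimates are made in powers of `x = 2^{-k} ≤ 1/2`, with `x ≤ 1/binom(k,i)`; the hypothesis
  -- `γ ≤ x^10` makes the error `τ` at most `x^4`.
  set x : ℝ := 1 / 2 ^ k with hx
  have hx0 : 0 < x := by positivity
  have hx2 : x ≤ 1 / 2 := by
    rw [hx]
    refine one_div_le_one_div_of_le (by norm_num) ?_
    calc (2 : ℝ) = 2 ^ 1 := by norm_num
      _ ≤ 2 ^ k := pow_le_pow_right₀ (by norm_num) (by omega)
  have hγx : γ ≤ x ^ 10 := by rw [hx, div_pow, one_pow]; exact hγk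
  have hsγ : √γ ≤ x ^ 5 := by
    rw [Real.sqrt_le_left (by positivity), ← pow_mul]
    exact hγx
  have hkx : (k : ℝ) * x ≤ 1 := by
    rw [hx, mul_one_div, div_le_one (by positivity)]
    exact_mod_cast Nat.lt_two_pow_self.le
  set τ := √γ + (k : ℝ) ^ 2 * γ with hτ
  have hτ0 : 0 ≤ τ := by positivity
  have hτx : τ ≤ x ^ 4 := by
    have h1 : (k : ℝ) ^ 2 * γ ≤ x ^ 8 := by
      calc (k : ℝ) ^ 2 * γ ≤ (k : ℝ) ^ 2 * x ^ 10 := by gcongr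
        _ = ((k : ℝ) * x) ^ 2 * x ^ 8 := by ring
        _ ≤ 1 ^ 2 * x ^ 8 := by gcongr
        _ = x ^ 8 := by ring
    have h2 : x ^ 5 ≤ 1 / 2 * x ^ 4 := by
      rw [pow_succ, mul_comm]; gcongr
    have h3 : x ^ 8 ≤ 1 / 2 * x ^ 4 := by
      calc x ^ 8 = x ^ 4 * x ^ 4 := by ring
        _ ≤ (1 / 2) ^ 4 * x ^ 4 := by gcongr
        _ ≤ 1 / 2 * x ^ 4 := by gcongr; norm_num
    rw [hτ]; linarith
  have hsτ : √γ ≤ τ := le_add_of_nonneg_right (by positivity)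
  set c : ℝ := 1 / (k.choose i : ℝ) with hc
  have hC : (1 : ℝ) ≤ (k.choose i : ℝ) := by exact_mod_cast Nat.choose_pos hik.le
  have hcx : x ≤ c := by
    refine one_div_le_one_div_of_le (by linarith) ?_
    exact_mod_cast Nat.choose_le_two_pow k i
  have hc1 : c ≤ 1 := by rw [hc, div_le_one (by linarith)]; exact hC
  have hmain := h.l2_downTo_upTo_single_le hγ hik hk s
  rw [← he, ← hψ, ← hc, ← hN, ← hτ] at hmain
  -- the part on the level `i`
  have hi : (c - τ) * N ≤ X.l2 i (X.downTo hik.le ψ) := by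
    have h1 : c * N = X.l2 i (c • e) := by
      rw [map_smul_eq_mul, Real.norm_of_nonneg (by positivity)]
    have h2 : X.l2 i (c • e) ≤ X.l2 i (X.downTo hik.le ψ - c • e) + X.l2 i (X.downTo hik.le ψ) := by
      rw [map_sub_rev]
      calc X.l2 i (c • e) = X.l2 i ((c • e - X.downTo hik.le ψ) + X.downTo hik.le ψ) := by
            rw [sub_add_cancel]
        _ ≤ _ := map_add_le_add _ _ _
    linarith
  -- the parts on the lower levels
  have hj : ∀ j (hj : j < i), X.l2 j (X.downTo (hj.le.trans hik.le) ψ) ≤ 2 * τ * N := by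
    intro j hj
    have h1 : X.downTo (hj.le.trans hik.le) ψ
        = X.downTo hj.le (X.downTo hik.le ψ - c • e) + c • X.downTo hj.le e := by
      rw [map_sub, map_smul, sub_add_cancel, ← downTo_comp X hj.le hik.le]; rfl
    rw [h1]
    refine (map_add_le_add _ _ _).trans ?_
    rw [map_smul_eq_mul, Real.norm_of_nonneg (by positivity)]
    have h2 := (hA.downTo_le hj.le (by omega) (X.downTo hik.le ψ - c • e)).trans hmain
    have h3 : X.l2 j (X.downTo hj.le e) ≤ τ * N :=
      (h.l2_downTo_single_le hγ (by omega) hj s).trans (by gcongr)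
    have h4 : c * X.l2 j (X.downTo hj.le e) ≤ 1 * (τ * N) := by gcongr
    linarith
  -- The term `j = i` has the positive coefficient `binom(k,i)` and size about `N²/binom(k,i)`. The
  -- terms `j < i` are of order `τ²`, and those with `j > i` have coefficient zero.
  have hq : 1 / (2 * 4 ^ k) * N ^ 2 ≤ X.inner ψ (X.proj k i ψ) := by
    rw [proj, inner_normalForm]
    have h1 : ∑ j ∈ range (k + 1), projCoef k i j *
        X.inner (X.downFrom k j ψ) (X.downFrom k j ψ) = ∑ j ∈ range (i + 1), projCoef k i j *
        X.inner (X.downFrom k j ψ) (X.downFrom k j ψ) := by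
      symm
      refine sum_subset (fun j => by simp only [mem_range]; omega) fun j _ hj => ?_
      rw [projCoef, Nat.choose_eq_zero_of_lt (show i < j by simpa using hj)]; simp
    rw [h1, sum_range_succ, ← l2_sq, downFrom_of_le X hik.le]
    have h2 : projCoef k i i = k.choose i := by
      rw [projCoef, ← two_mul, pow_mul]; simp
    have h3 : -((k.choose i : ℝ) * (2 ^ k * (2 * τ * N) ^ 2)) ≤ ∑ j ∈ range i, projCoef k i j *
        X.inner (X.downFrom k j ψ) (X.downFrom k j ψ) := by
      have h4 : ∀ j ∈ range i, -((k.choose i : ℝ) * ((i.choose j : ℝ) * (2 * τ * N) ^ 2))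
          ≤ projCoef k i j * X.inner (X.downFrom k j ψ) (X.downFrom k j ψ) := by
        intro j hj'
        have hji := mem_range.mp hj'
        rw [← l2_sq, downFrom_of_le X (hji.le.trans hik.le)]
        have h5 : |projCoef k i j| = (k.choose i : ℝ) * (i.choose j : ℝ) := by
          rw [projCoef, abs_mul, abs_mul, abs_pow]; simp
        have h6 := pow_le_pow_left₀ (apply_nonneg _ _) (hj j hji) 2
        have h7 := neg_abs_le (projCoef k i j)
        have h8 : -|projCoef k i j| * X.l2 j (X.downTo (hji.le.trans hik.le) ψ) ^ 2
            ≤ projCoef k i j * X.l2 j (X.downTo (hji.le.trans hik.le) ψ) ^ 2 :=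
          mul_le_mul_of_nonneg_right h7 (by positivity)
        refine le_trans ?_ h8
        rw [neg_mul, neg_le_neg_iff, h5, mul_assoc]
        gcongr
      refine le_trans ?_ (sum_le_sum h4)
      rw [sum_neg_distrib, neg_le_neg_iff, ← mul_sum, ← sum_mul]
      have h9 : ∑ j ∈ range i, (i.choose j : ℝ) ≤ 2 ^ k := by
        have h10 : ∑ j ∈ range i, i.choose j ≤ 2 ^ k := by
          calc _ ≤ ∑ j ∈ range (i + 1), i.choose j :=
                sum_le_sum_of_subset (range_subset_range.mpr (by omega))
            _ = 2 ^ i := Nat.sum_range_choose i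
            _ ≤ 2 ^ k := Nat.pow_le_pow_right (by norm_num) hik.le
        exact_mod_cast h10
      gcongr
    rw [h2]
    have hcτ : 7 / 8 * x ≤ c - τ := by
      have : x ^ 4 ≤ (1 / 2) ^ 3 * x := by rw [pow_succ]; gcongr
      linarith
    have h4 : (7 / 8 * x * N) ^ 2 ≤ X.l2 i (X.downTo hik.le ψ) ^ 2 := by
      refine pow_le_pow_left₀ (by positivity) (le_trans ?_ hi) 2
      gcongr
    have h5 : (2 : ℝ) ^ k * (2 * τ * N) ^ 2 ≤ 1 / 8 * x ^ 2 * N ^ 2 := by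
      have hxk : (2 : ℝ) ^ k * x = 1 := by rw [hx]; field_simp
      calc (2 : ℝ) ^ k * (2 * τ * N) ^ 2 ≤ (2 : ℝ) ^ k * (2 * x ^ 4 * N) ^ 2 := by gcongr
        _ = ((2 : ℝ) ^ k * x) * (4 * x ^ 5) * x ^ 2 * N ^ 2 := by ring
        _ ≤ 1 * (4 * (1 / 2) ^ 5) * x ^ 2 * N ^ 2 := by rw [hxk]; gcongr
        _ = _ := by norm_num
    have hx4 : 1 / (2 * 4 ^ k) = 1 / 2 * x ^ 2 := by
      rw [hx, div_pow, one_pow, ← pow_mul, mul_comm k 2, pow_mul]; norm_num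
      ring
    rw [hx4]
    have h6 : (k.choose i : ℝ) * (1 / 2 * x ^ 2 * N ^ 2) ≤
        (k.choose i : ℝ) * (X.l2 i (X.downTo hik.le ψ) ^ 2 - 2 ^ k * (2 * τ * N) ^ 2) := by
      refine mul_le_mul_of_nonneg_left ?_ (by linarith)
      have : 0 ≤ x ^ 2 * N ^ 2 := by positivity
      nlinarith
    have h7 : 1 / 2 * x ^ 2 * N ^ 2 ≤ (k.choose i : ℝ) * (1 / 2 * x ^ 2 * N ^ 2) :=
      le_mul_of_one_le_left (by positivity) hC
    linarith
  have hb : 1 / (2 * 4 ^ k) * N ≤ X.l2 k (X.proj k i ψ) := by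
    have h1 : 1 / (2 * 4 ^ k) * N ^ 2 ≤ N * X.l2 k (X.proj k i ψ) :=
      hq.trans ((X.inner_le _ _).trans (by gcongr))
    refine le_of_mul_le_mul_left ?_ hN0
    linarith
  refine ⟨ψ, ?_, le_trans (by gcongr) hb⟩
  intro h0
  rw [h0, map_zero, map_zero] at hb
  have : (0 : ℝ) < 1 / (2 * 4 ^ k) * N := by positivity
  linarith

end WeightedComplex

/-! ### Expansion and the levels of an indicator function -/

namespace WeightedComplex

variable {n d : ℕ} {X : WeightedComplex n d}

theorem op_apply_eq_sum {k : ℕ} (M : X.Fn k →ₗ[ℝ] X.Fn k) (f : X.Fn k) (v : X.Face k) :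
    M f v = ∑ y, X.entry M v y * f y := by
  have h1 : f = ∑ y, f y • (Pi.single y 1 : X.Fn k) := by
    funext s
    simp [Finset.sum_apply, Pi.single_apply]
  conv_lhs => rw [h1, map_sum]
  rw [Finset.sum_apply]
  refine sum_congr rfl fun y _ => ?_
  rw [map_smul, Pi.smul_apply, smul_eq_mul, mul_comm, entry]

theorem face_zero_eq (x : X.Face 0) : x.1 = ∅ := card_eq_zero.mp x.card_eq

theorem expect_zero (f : X.Fn 0) (x : X.Face 0) : X.expect f = f x := by
  rw [expect, sum_eq_single x]
  · rw [prob_eq_mass, face_zero_eq, mass_empty]; simp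
  · intro y _ hy
    exact absurd (Subtype.ext (by rw [face_zero_eq, face_zero_eq])) hy
  · simp

theorem empty_mem_level {k : ℕ} (y : X.Face k) : ∅ ∈ X.level 0 :=
  X.mem_level_of_subset y.2 (empty_subset _) card_empty

theorem expect_const {k : ℕ} (y : X.Face k) (c : ℝ) : X.expect (fun _ : X.Face k => c) = c := by
  rw [← expect_downTo X (Nat.zero_le k), downTo_const X _ y.le, expect_zero _ ⟨∅, empty_mem_level y⟩]

theorem downTo_zero {k : ℕ} (f : X.Fn k) : X.downTo (Nat.zero_le k) f = fun _ => X.expect f := by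
  funext x
  rw [← expect_downTo X (Nat.zero_le k), expect_zero _ x]

theorem sum_mul_indicator {k : ℕ} (S : Finset (X.Face k)) (F : X.Face k → ℝ) :
    ∑ s, F s * X.indicator S s = ∑ s ∈ S, F s := by
  simp only [indicator, mul_ite, mul_one, mul_zero]
  rw [sum_ite_mem, univ_inter]

theorem density_eq {k : ℕ} (S : Finset (X.Face k)) : X.density S = ∑ s ∈ S, X.prob s.1 := by
  rw [density, expect, sum_mul_indicator]

theorem inner_indicator {k : ℕ} (S : Finset (X.Face k)) (f : X.Fn k) :
    X.inner (X.indicator S) f = ∑ s ∈ S, X.prob s.1 * f s := by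
  rw [inner_eq, ← sum_mul_indicator S]
  exact sum_congr rfl fun s _ => by ring

theorem density_pos {k : ℕ} {S : Finset (X.Face k)} (hS : S.Nonempty) : 0 < X.density S := by
  rw [density_eq]
  exact sum_pos (fun s _ => X.prob_pos s) hS

theorem density_le_one {k : ℕ} (S : Finset (X.Face k)) : X.density S ≤ 1 := by
  rcases S.eq_empty_or_nonempty with rfl | ⟨y, _⟩
  · simp [density_eq]
  · rw [← expect_const y 1, density_eq, expect]
    simp only [mul_one]
    exact sum_le_sum_of_subset_of_nonneg (subset_univ _) fun s _ _ => (X.prob_pos s).le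

theorem inner_indicator_self {k : ℕ} (S : Finset (X.Face k)) :
    X.inner (X.indicator S) (X.indicator S) = X.density S := by
  rw [inner_indicator, density_eq]
  exact sum_congr rfl fun s hs => by simp [indicator, hs]

/-- The rows of `M` have sum one, so the mass leaving `S` is one minus the mass staying in `S`. -/
theorem expansion_eq {k : ℕ} {M : X.Fn k →ₗ[ℝ] X.Fn k} (hM : M (fun _ => 1) = fun _ => 1)
    {S : Finset (X.Face k)} (hS : S.Nonempty) :
    X.expansion M S = 1 - X.inner (X.indicator S) (M (X.indicator S)) / X.density S := by
  have hα := (density_pos hS).ne'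
  have h1 : ∀ v, ∑ y ∈ Sᶜ, X.entry M v y = 1 - M (X.indicator S) v := by
    intro v
    have h2 := op_apply_eq_sum M (fun _ => 1) v
    rw [hM] at h2
    have h3 : M (X.indicator S) v = ∑ y ∈ S, X.entry M v y := by
      rw [op_apply_eq_sum, sum_mul_indicator]
    rw [h3, eq_sub_iff_add_eq, sum_compl_add_sum]
    simpa using h2.symm
  rw [expansion, ← density_eq, inner_indicator, sum_congr rfl fun v _ => by rw [h1]]
  rw [eq_sub_iff_add_eq, sum_div, ← sum_add_distrib]
  rw [sum_congr rfl fun v _ => show X.prob v.1 / X.density S * (1 - M (X.indicator S) v)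
    + X.prob v.1 * M (X.indicator S) v / X.density S = X.prob v.1 / X.density S by ring,
    ← sum_div, ← density_eq, div_self hα]

theorem expansion_nonneg {k : ℕ} {M : X.Fn k →ₗ[ℝ] X.Fn k} (hM : ∀ v y, 0 ≤ X.entry M v y)
    (S : Finset (X.Face k)) : 0 ≤ X.expansion M S :=
  sum_nonneg fun v _ => mul_nonneg
    (div_nonneg (X.prob_pos v).le (sum_nonneg fun u _ => (X.prob_pos u).le))
    (sum_nonneg fun y _ => hM v y)

theorem var_eq {i : ℕ} (f : X.Fn i) : X.var f = X.inner f f - X.expect f ^ 2 := by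
  simp only [var, inner, sq]

theorem down_nonneg {i : ℕ} {f : X.Fn (i + 1)} (hf : ∀ s, 0 ≤ f s) (s : X.Face i) :
    0 ≤ X.down i f s := by
  rw [down_apply]
  exact mul_nonneg (by positivity) (sum_nonneg fun y _ =>
    mul_nonneg (div_nonneg (X.prob_pos y).le (X.prob_pos s).le) (hf y))

theorem downTo_nonneg {i k : ℕ} (h : i ≤ k) {f : X.Fn k} (hf : ∀ s, 0 ≤ f s) (s : X.Face i) :
    0 ≤ X.downTo h f s := by
  induction k, h using Nat.le_induction with
  | base => simpa using hf s
  | succ k h ih => rw [downTo_succ X h]; exact ih fun s => down_nonneg hf s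

theorem indicator_nonneg {k : ℕ} (S : Finset (X.Face k)) (s : X.Face k) : 0 ≤ X.indicator S s := by
  rw [indicator]; split_ifs <;> norm_num

/-- A pseudorandom set has small variance on the lower levels. -/
theorem var_downTo_le {k r : ℕ} {ε : ℕ → ℝ} {S : Finset (X.Face k)}
    (h : X.IsL2Pseudorandom (X.indicator S) r ε ∨ X.IsLinftyPseudorandom (X.indicator S) r ε)
    {i : ℕ} (hik : i ≤ k) (h1 : 1 ≤ i) (hir : i ≤ r) :
    X.var (X.downTo hik (X.indicator S)) ≤ ε i * X.density S := by
  have hα0 : 0 ≤ X.density S := by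
    rw [density_eq]; exact sum_nonneg fun s _ => (X.prob_pos s).le
  rcases h with h | h
  · have := h i hik h1 hir
    rwa [← density, abs_of_nonneg hα0] at this
  · have hE : X.expect (X.downTo hik (X.indicator S)) = X.density S := expect_downTo X _ _
    rw [var_eq, hE]
    -- One of the two factors `D f ≥ 0` is bounded pointwise by `α + ε_i`, the other has mean `α`.
    -- This gives `Var ≤ ε_i α` rather than `ε_i²`, so both notions of pseudorandomness yield the
    -- same bound.
    have h2 : X.inner (X.downTo hik (X.indicator S)) (X.downTo hik (X.indicator S))
        ≤ X.inner (X.downTo hik (X.indicator S)) fun _ => X.density S + ε i := by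
      rw [inner_eq, inner_eq]
      refine sum_le_sum fun s _ => mul_le_mul_of_nonneg_left ?_ (X.prob_pos s).le
      refine mul_le_mul_of_nonneg_left ?_ (downTo_nonneg hik (indicator_nonneg S) s)
      have := (abs_le.mp (h i hik h1 hir s)).2
      rw [← density] at this
      linarith
    have h3 : X.inner (X.downTo hik (X.indicator S)) (fun _ => X.density S + ε i)
        = (X.density S + ε i) * X.density S := by
      rw [← hE, inner_eq, expect, mul_sum]
      exact sum_congr rfl fun s _ => by ring
    rw [h3] at h2
    linarith

theorem var_nonneg {i : ℕ} (y : X.Face i) (f : X.Fn i) : 0 ≤ X.var f := by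
  have h1 := X.inner_self_nonneg (f - fun _ => X.expect f)
  have h2 : X.inner (fun _ => X.expect f) (fun _ : X.Face i => X.expect f) = X.expect f ^ 2 := by
    have := expect_const y (X.expect f * X.expect f)
    rw [sq]; exact this
  have h3 : X.inner f (fun _ => X.expect f) = X.expect f * X.expect f := by
    rw [inner_eq]
    conv_rhs => enter [1]; rw [expect]
    rw [sum_mul]
    exact sum_congr rfl fun s _ => by ring
  rw [inner_sub_left, inner_sub_right, inner_sub_right, X.inner_comm (fun _ => X.expect f) f, h2,
    h3] at h1
  rw [var_eq]
  linarith

/-! ### The quadratic forms of the approximate projections -/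

theorem sum_inner_proj {k : ℕ} (f : X.Fn k) :
    ∑ l ∈ range (k + 1), X.inner f (X.proj k l f) = X.inner f f := by
  rw [← inner_sum_right, sum_proj]

/-- Exact, because `projCoef k 0` is supported on `j = 0` and `D^k_0` is the expectation. -/
theorem inner_proj_zero {k : ℕ} (f : X.Fn k) (y : X.Face k) :
    X.inner f (X.proj k 0 f) = X.expect f ^ 2 := by
  rw [proj, inner_normalForm, sum_range_succ', sum_eq_zero, zero_add, downFrom_of_le X (Nat.zero_le k),
    downTo_zero]
  · have := expect_const (⟨∅, empty_mem_level y⟩ : X.Face 0) (X.expect f * X.expect f)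
    rw [sq, projCoef]
    simp only [add_zero, pow_zero, Nat.choose_zero_right, Nat.cast_one, one_mul]
    exact this
  · intro j _
    rw [projCoef]; simp

/-- From `π_i² ≈ π_i` and self-adjointness. So `⟨f, π_i f⟩` is almost a square norm and can be
negative only by an error term. -/
theorem ApproxComm.le_inner_proj {γ : ℝ} (h : X.ApproxComm d γ X.l2) {k i : ℕ} (hk : k ≤ d)
    (hi : i ≤ k) (f : X.Fn k) :
    -((k : ℝ) ^ 2 * 16 ^ k * γ * X.inner f f) ≤ X.inner f (X.proj k i f) - X.l2 k (X.proj k i f) ^ 2 ∧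
    X.inner f (X.proj k i f) - X.l2 k (X.proj k i f) ^ 2 ≤ (k : ℝ) ^ 2 * 16 ^ k * γ * X.inner f f := by
  have h1 : X.inner f (X.proj k i f) - X.l2 k (X.proj k i f) ^ 2
      = -X.inner f (X.proj k i (X.proj k i f) - X.proj k i f) := by
    rw [inner_sub_right, l2_sq, inner_proj_left]; ring
  have h2 := X.abs_inner_le f (X.proj k i (X.proj k i f) - X.proj k i f)
  have h3 : X.l2 k f * X.l2 k (X.proj k i (X.proj k i f) - X.proj k i f)
      ≤ X.l2 k f * ((k : ℝ) ^ 2 * 16 ^ k * γ * X.l2 k f) :=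
    mul_le_mul_of_nonneg_left (h.proj_proj hk hi f) (apply_nonneg _ _)
  have h4 := h2.trans h3
  rw [show X.l2 k f * ((k : ℝ) ^ 2 * 16 ^ k * γ * X.l2 k f)
    = (k : ℝ) ^ 2 * 16 ^ k * γ * X.l2 k f ^ 2 by ring, l2_sq, abs_le] at h4
  rw [h1]
  constructor <;> linarith [h4.1, h4.2]

/-- The decomposition of the lower walk `U^k_i D^k_i` into the `π_l`, without error. -/
theorem inner_downTo_self {k i : ℕ} (hi : i ≤ k) (f : X.Fn k) :
    X.inner (X.downTo hi f) (X.downTo hi f) = ∑ l ∈ range (k + 1),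
      (i.choose l : ℝ) / (k.choose l : ℝ) * X.inner f (X.proj k l f) := by
  have h1 := X.normalForm_eq_sum_proj (m := k) (Pi.single i 1) f
  rw [normalForm_single X hi] at h1
  rw [← inner_upTo, inner_comm, h1, inner_sum_right]
  refine sum_congr rfl fun l _ => ?_
  rw [inner_smul_right, coefEigenvalue_single hi, proj]

/-- The weight of a function on a level is bounded by the variance of its restriction. -/
theorem ApproxComm.inner_proj_le {γ : ℝ} (h : X.ApproxComm d γ X.l2) {k i : ℕ} (hk : k ≤ d)
    (hi : i ≤ k) (hi1 : 1 ≤ i) (f : X.Fn k) (y : X.Face k) :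
    X.inner f (X.proj k i f) ≤ (k.choose i : ℝ) *
      (X.var (X.downTo hi f) + k * ((k : ℝ) ^ 2 * 16 ^ k * γ * X.inner f f)) := by
  set ρ := (k : ℝ) ^ 2 * 16 ^ k * γ * X.inner f f with hρ
  have hρ0 : 0 ≤ ρ := by
    have := h.nonneg
    have := X.inner_self_nonneg f
    positivity
  have hC : (0 : ℝ) < k.choose i := by exact_mod_cast Nat.choose_pos hi
  have hq : ∀ l, l ≤ k → -ρ ≤ X.inner f (X.proj k l f) := fun l hl => by
    have := (h.le_inner_proj hk hl f).1
    have := sq_nonneg (X.l2 k (X.proj k l f))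
    linarith
  have h1 := X.inner_downTo_self hi f
  rw [sum_range_succ', inner_proj_zero f y] at h1
  -- The level zero accounts for the squared mean in the variance, and the level `i` is isolated
  -- with its coefficient `1/binom(k,i)`. The other levels, at most `k`, are each at least `-ρ` and
  -- can be discarded.
  have h2 : ∑ l ∈ range k, ((i.choose (l + 1) : ℝ) / (k.choose (l + 1) : ℝ)) *
      X.inner f (X.proj k (l + 1) f) = (∑ l ∈ (range k).erase (i - 1),
        ((i.choose (l + 1) : ℝ) / (k.choose (l + 1) : ℝ)) * X.inner f (X.proj k (l + 1) f))
        + 1 / (k.choose i : ℝ) * X.inner f (X.proj k i f) := by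
    rw [← sum_erase_add _ _ (mem_range.mpr (by omega : i - 1 < k)), Nat.sub_add_cancel hi1,
      Nat.choose_self, Nat.cast_one]
  have h3 : -(k * ρ) ≤ ∑ l ∈ (range k).erase (i - 1),
        ((i.choose (l + 1) : ℝ) / (k.choose (l + 1) : ℝ)) * X.inner f (X.proj k (l + 1) f) := by
    have h4 : ∀ l ∈ (range k).erase (i - 1), -ρ ≤
        ((i.choose (l + 1) : ℝ) / (k.choose (l + 1) : ℝ)) * X.inner f (X.proj k (l + 1) f) := by
      intro l hl
      have hl' : l + 1 ≤ k := by have := mem_range.mp (mem_erase.mp hl).2; omega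
      have hc : (0 : ℝ) < k.choose (l + 1) := by exact_mod_cast Nat.choose_pos hl'
      have h5 : (i.choose (l + 1) : ℝ) / (k.choose (l + 1) : ℝ) ≤ 1 := by
        rw [div_le_one hc]; exact_mod_cast Nat.choose_le_choose _ hi
      have h6 : 0 ≤ (i.choose (l + 1) : ℝ) / (k.choose (l + 1) : ℝ) := by positivity
      have h7 := mul_le_mul_of_nonneg_left (hq _ hl') h6
      nlinarith
    have h8 := card_nsmul_le_sum _ _ _ h4
    have h9 : (((range k).erase (i - 1)).card : ℝ) ≤ k := by
      exact_mod_cast (card_erase_le).trans (card_range k).le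
    rw [nsmul_eq_mul] at h8
    nlinarith
  rw [h2] at h1
  have hvar : X.var (X.downTo hi f) = X.inner (X.downTo hi f) (X.downTo hi f) - X.expect f ^ 2 := by
    rw [var_eq, expect_downTo]
  rw [hvar, h1]
  simp only [Nat.choose_zero_right, Nat.cast_one, div_one, one_mul]
  have h10 : X.inner f (X.proj k i f)
      = k.choose i * (1 / (k.choose i : ℝ) * X.inner f (X.proj k i f)) := by field_simp
  conv_lhs => rw [h10]
  gcongr
  linarith

/-- The quadratic form of a walk is nearly diagonal. -/
theorem ApproxComm.inner_op_le {γ : ℝ} (h : X.ApproxComm d γ X.l2) {k : ℕ} (M : WalkComb k)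
    (hM : ∀ Y ∈ M.support, Y.maxLevel ≤ d) (f : X.Fn k) :
    X.inner f (M.op X f) ≤ ∑ l ∈ range (k + 1), M.approxEigenvalue l * X.inner f (X.proj k l f)
      + M.errCoef * γ * X.inner f f := by
  have h1 := h.comb_sub_sum M hM f
  set P := ∑ l ∈ range (k + 1), M.approxEigenvalue l • X.proj k l f with hP
  have h2 : X.inner f P
      = ∑ l ∈ range (k + 1), M.approxEigenvalue l * X.inner f (X.proj k l f) := by
    rw [hP, inner_sum_right]
    exact sum_congr rfl fun l _ => inner_smul_right _ _ _ _
  have h3 := X.inner_le f (M.op X f - P)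
  have h4 : X.l2 k f * X.l2 k (M.op X f - P) ≤ X.l2 k f * (M.errCoef * γ * X.l2 k f) :=
    mul_le_mul_of_nonneg_left h1 (apply_nonneg _ _)
  rw [inner_sub_right, h2] at h3
  rw [← l2_sq]
  nlinarith

/-- Every eigenvalue of a walk is close to an approximate eigenvalue. -/
theorem ApproxComm.exists_abs_sub_le {γ : ℝ} (h : X.ApproxComm d γ X.l2) {k : ℕ} {M : WalkComb k}
    (hM : ∀ Y ∈ M.support, Y.maxLevel ≤ d)
    (hs : ∀ f g : X.Fn k, X.inner (M.op X f) g = X.inner f (M.op X g))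
    {μ : ℝ} {φ : X.Fn k} (hφ : φ ≠ 0) (hμ : M.op X φ = μ • φ) :
    ∃ p ≤ k, |μ - M.approxEigenvalue p| ≤ (k + 1) * 4 ^ k * (M.errCoef * γ) := by
  by_contra hcon
  push Not at hcon
  set u := M.errCoef * γ with hu
  have hu0 : 0 ≤ u := mul_nonneg M.errCoef_nonneg h.nonneg
  have hN : 0 < X.l2 k φ := X.l2_pos hφ
  have h1 : ∀ p ≤ k, |μ - M.approxEigenvalue p| * X.l2 k (X.proj k p φ)
      ≤ u * 4 ^ k * X.l2 k φ := by
    intro p hp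
    set v := (μ - M.approxEigenvalue p) • X.proj k p φ with hv
    have h2 : X.l2 k v = |μ - M.approxEigenvalue p| * X.l2 k (X.proj k p φ) := by
      rw [hv, map_smul_eq_mul, Real.norm_eq_abs]
    rw [← h2]
    -- The available estimate is for `M π_p`, whereas `(μ - λ_p) π_p φ` involves `π_p M`.
    -- Self-adjointness passes to the transpose, and `g = v` is inserted afterwards.
    have h3 : ∀ g, X.inner g v
        = X.inner (M.op X (X.proj k p g) - M.approxEigenvalue p • X.proj k p g) φ := by
      intro g
      rw [hv, inner_smul_right, inner_sub_left, hs, hμ, inner_smul_right, inner_smul_left,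
        inner_proj_left]
      ring
    have h4 := X.inner_le (M.op X (X.proj k p v) - M.approxEigenvalue p • X.proj k p v) φ
    rw [← h3, ← l2_sq] at h4
    have h5 := h.comb_proj hp M hM v
    rcases (apply_nonneg (X.l2 k) v).eq_or_lt with h0 | h0
    · rw [← h0]; positivity
    · refine le_of_mul_le_mul_left ?_ h0
      calc X.l2 k v * X.l2 k v = X.l2 k v ^ 2 := (sq _).symm
        _ ≤ _ := h4
        _ ≤ (u * 4 ^ k * X.l2 k v) * X.l2 k φ := by gcongr
        _ = _ := by ring
  have h6 : ∀ p ∈ range (k + 1), (k + 1 : ℝ) * 4 ^ k * u * X.l2 k (X.proj k p φ)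
      ≤ u * 4 ^ k * X.l2 k φ := by
    intro p hp
    have hp' : p ≤ k := by have := mem_range.mp hp; omega
    refine le_trans ?_ (h1 p hp')
    gcongr
    exact (hcon p hp').le
  have h7 : X.l2 k φ ≤ ∑ p ∈ range (k + 1), X.l2 k (X.proj k p φ) := by
    conv_lhs => rw [← X.sum_proj φ]
    exact le_sum_of_subadditive _ (map_zero _).le (map_add_le_add _) _ _
  rcases hu0.eq_or_lt with hz | hpos
  · -- without an error term all projections of `φ` vanish
    have h8 : ∀ p ∈ range (k + 1), X.l2 k (X.proj k p φ) ≤ 0 := by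
      intro p hp
      have hp' : p ≤ k := by have := mem_range.mp hp; omega
      have h9 := h1 p hp'
      have h10 := hcon p hp'
      rw [← hz] at h9 h10
      simp only [mul_zero, zero_mul] at h9 h10
      by_contra hneg
      exact absurd h9 (not_le.mpr (mul_pos h10 (not_le.mp hneg)))
    have := sum_nonpos h8
    linarith
  · have h8 := hcon 0 (Nat.zero_le k)
    -- The projections add up to `φ`, so one of them has at least the fraction `1/(k+1)` of its
    -- norm; `λ_p` for this `p` must be close to `μ`.
    have h9 : ∃ p ∈ range (k + 1), X.l2 k φ ≤ (k + 1 : ℝ) * X.l2 k (X.proj k p φ) := by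
      by_contra hno
      push Not at hno
      have h10 := sum_lt_sum_of_nonempty (nonempty_range_iff.mpr (Nat.succ_ne_zero k)) hno
      rw [← mul_sum, sum_const, card_range, nsmul_eq_mul] at h10
      push_cast at h10
      have : (k + 1 : ℝ) * X.l2 k φ ≤ (k + 1 : ℝ) * ∑ p ∈ range (k + 1), X.l2 k (X.proj k p φ) := by
        gcongr
      linarith
    obtain ⟨p, hp, hp2⟩ := h9
    have hp' : p ≤ k := by have := mem_range.mp hp; omega
    have h11 := h1 p hp'
    have h12 : 0 < X.l2 k (X.proj k p φ) := by
      by_contra hneg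
      have h0 : X.l2 k (X.proj k p φ) = 0 := le_antisymm (not_lt.mp hneg) (apply_nonneg _ _)
      rw [h0, mul_zero] at hp2
      linarith
    have h13 := mul_lt_mul_of_pos_right (hcon p hp') h12
    have h14 : u * 4 ^ k * X.l2 k φ ≤ u * 4 ^ k * ((k + 1 : ℝ) * X.l2 k (X.proj k p φ)) := by gcongr
    linarith

/-- The spectrum of a walk is close to `c` if some approximate eigenvector says so. -/
theorem exists_eigenvalue_l2_le {k : ℕ} (y : X.Face k) {M : X.Fn k →ₗ[ℝ] X.Fn k}
    (hs : ∀ f g : X.Fn k, X.inner (M f) g = X.inner f (M g)) (c : ℝ) :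
    ∃ (μ : ℝ) (φ : X.Fn k), φ ≠ 0 ∧ M φ = μ • φ ∧
      ∀ f : X.Fn k, |μ - c| * X.l2 k f ≤ X.l2 k (M f - c • f) := by
  have : Nonempty (X.Face k) := ⟨y⟩
  obtain ⟨μ, φ, h1, h2, h3⟩ := exists_eigenvalue_mul_le (π := fun s : X.Face k => X.prob s.1)
    X.prob_pos (T := M) hs c
  refine ⟨μ, φ, h1, h2, fun f => ?_⟩
  refine le_of_sq_le_sq ?_ (apply_nonneg _ _)
  rw [mul_pow, sq_abs, l2_sq, l2_sq]
  exact h3 f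

end WeightedComplex

/-! ### Eigenstrips -/

theorem WalkWord.approxEigenvalue_of_height_eq_zero {k l : ℕ} :
    {m : ℕ} → (w : WalkWord k m) → w.height = 0 → w.approxEigenvalue l = 1
  | _, nil, _ => rfl
  | _, up w, h => approxEigenvalue_of_height_eq_zero w h
  | _, down _, h => absurd h (Nat.succ_ne_zero _)

theorem WalkWord.approxEigenvalue_zero {k : ℕ} :
    {m : ℕ} → (w : WalkWord k m) → w.approxEigenvalue 0 = 1
  | _, nil => rfl
  | _, up w => approxEigenvalue_zero w
  | _, down w => by rw [approxEigenvalue, approxEigenvalue_zero w]; simp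

namespace WalkComb

variable {k : ℕ} {M : WalkComb k}

theorem approxEigenvalue_zero (h : (M.sum fun _ a => a) = 1) : M.approxEigenvalue 0 = 1 := by
  rw [← h, approxEigenvalue]
  exact Finsupp.sum_congr fun Y _ => by rw [Y.approxEigenvalue_zero, mul_one]

theorem one_le_weight (h : (M.sum fun _ a => a) = 1) : 1 ≤ M.weight := by
  rw [← h]
  exact sum_le_sum fun _ _ => le_abs_self _

theorem one_le_height (h : (M.sum fun _ a => a) = 1) {i : ℕ} (hi : M.approxEigenvalue i ≠ 1) :
    1 ≤ M.height := by
  by_contra hc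
  have h0 : M.height = 0 := by omega
  apply hi
  rw [← h, approxEigenvalue]
  refine Finsupp.sum_congr fun Y hY => ?_
  have : Y.height ≤ M.height := le_sup (f := WalkWord.height) hY
  rw [Y.approxEigenvalue_of_height_eq_zero (by omega), mul_one]

theorem eigDif_set_finite : {x | ∃ i j : Fin (k + 1), M.approxEigenvalue i ≠ M.approxEigenvalue j ∧
    x = |M.approxEigenvalue i - M.approxEigenvalue j|}.Finite := by
  refine (Set.finite_range fun p : Fin (k + 1) × Fin (k + 1) =>
    |M.approxEigenvalue p.1 - M.approxEigenvalue p.2|).subset ?_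
  rintro x ⟨i, j, _, rfl⟩
  exact ⟨(i, j), rfl⟩

theorem eigDif_pos {i j : Fin (k + 1)} (h : M.approxEigenvalue i ≠ M.approxEigenvalue j) :
    0 < M.eigDif := by
  have hne : {x | ∃ i j : Fin (k + 1), M.approxEigenvalue i ≠ M.approxEigenvalue j ∧
    x = |M.approxEigenvalue i - M.approxEigenvalue j|}.Nonempty := ⟨_, i, j, h, rfl⟩
  obtain ⟨a, b, hab, hx⟩ := hne.csInf_mem eigDif_set_finite
  rw [eigDif, hx]
  exact abs_pos.mpr (sub_ne_zero.mpr hab)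

theorem eigDif_le {i j : Fin (k + 1)} (h : M.approxEigenvalue i ≠ M.approxEigenvalue j) :
    M.eigDif ≤ |M.approxEigenvalue i - M.approxEigenvalue j| :=
  csInf_le eigDif_set_finite.bddBelow ⟨i, j, h, rfl⟩

theorem le_errMax (A γ : ℝ) : A * M.errCoef * γ ≤ M.errMax A γ := by
  have h := le_ciSup (f := fun l : Fin (k + 1) =>
    A * γ * M.weight * M.height * (k + M.height) * (k.choose l : ℝ))
    (Set.finite_range _).bddAbove 0
  refine le_trans (le_of_eq ?_) h
  simp [errCoef]; ring

/-- Since `λ_0 = 1` and all `λ_i` lie in `[0, 1]`, `λ_dif ≤ 1` and the ratio is at least one. The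
strips thus have width of order at least the square root of the error, which dominates every error
that is linear in `γ`. -/
theorem le_stripWidth (h1 : M.approxEigenvalue 0 = 1)
    (hle : ∀ i ≤ k, M.approxEigenvalue i ≤ 1) (hnn : ∀ i ≤ k, 0 ≤ M.approxEigenvalue i)
    {i j : Fin (k + 1)} (hij : M.approxEigenvalue i ≠ M.approxEigenvalue j) (γ : ℝ) :
    (k + 1) * √(M.errCoef * γ) ≤ M.stripWidth 1 1 γ := by
  have hd0 := eigDif_pos hij
  have hd1 : M.eigDif ≤ 1 := by
    refine (eigDif_le hij).trans (abs_le.mpr ⟨?_, ?_⟩)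
    · linarith [hle j (by omega), hnn i (by omega)]
    · linarith [hle i (by omega), hnn j (by omega)]
  have hs0 : 0 < √M.eigDif := Real.sqrt_pos.mpr hd0
  have hs1 : √M.eigDif ≤ 1 := Real.sqrt_le_one.mpr hd1
  have hr : 1 ≤ M.eigRatio := by
    rw [eigRatio, le_div_iff₀ hs0, one_mul]
    refine hs1.trans ?_
    have := le_ciSup (f := fun i : Fin (k + 1) => |M.approxEigenvalue i|)
      (Set.finite_range _).bddAbove 0
    simpa [h1] using this
  have he : √(M.errCoef * γ) ≤ √(M.errMax 1 γ) := by
    have := M.le_errMax 1 γ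
    rw [one_mul] at this
    exact Real.sqrt_le_sqrt this
  rw [stripWidth, one_mul]
  calc ((k : ℝ) + 1) * √(M.errCoef * γ) = ((k : ℝ) + 1) * 1 * √(M.errCoef * γ) := by ring
    _ ≤ _ := by gcongr

variable {n d : ℕ} {X : WeightedComplex n d}

/-- The eigenvalue of an eigenvector in an eigenstrip lies in the strip interval. -/
theorem mem_stripInterval_of_mem_eigenstrip
    (hs : ∀ f g : X.Fn k, X.inner (M.op X f) g = X.inner f (M.op X g)) {A B γ : ℝ} {i : ℕ}
    {f : X.Fn k} (hf : f ∈ M.eigenstrip X A B γ i) (hf0 : f ≠ 0) {μ : ℝ} (hμ : M.op X f = μ • f) :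
    μ ∈ M.stripInterval A B γ i := by
  by_contra hcon
  -- If `μ` were outside the interval, `f` would be orthogonal to all eigenvectors that span the
  -- strip, hence to itself.
  have h1 : ∀ g ∈ M.eigenstrip X A B γ i, X.inner f g = 0 := by
    intro g hg
    induction hg using Submodule.span_induction with
    | mem φ hφ =>
      obtain ⟨ν, hν, hφ⟩ := hφ
      have h2 := hs f φ
      rw [hμ, hφ, X.inner_smul_left, X.inner_smul_right] at h2
      have h3 : (μ - ν) * X.inner f φ = 0 := by linarith
      refine (mul_eq_zero.mp h3).resolve_left fun h4 => hcon ?_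
      rwa [sub_eq_zero.mp h4]
    | zero => simp [X.inner_eq]
    | add x y _ _ hx hy => rw [X.inner_add_right, hx, hy, add_zero]
    | smul a x _ hx => rw [X.inner_smul_right, hx, mul_zero]
  have h2 := h1 f hf
  rw [← X.l2_sq] at h2
  have := X.l2_pos hf0
  have : 0 < X.l2 k f ^ 2 := by positivity
  linarith

/-- The eigenvalues of a Markov operator are at most one. -/
theorem eigenvalue_le_one {T : X.Fn k →ₗ[ℝ] X.Fn k} (h1 : T (fun _ => 1) = fun _ => 1)
    (h0 : ∀ v y, 0 ≤ X.entry T v y) {f : X.Fn k} (hf : f ≠ 0) {μ : ℝ} (hμ : T f = μ • f) :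
    μ ≤ 1 := by
  obtain ⟨s₀, hs₀⟩ := Function.ne_iff.mp hf
  have : Nonempty (X.Face k) := ⟨s₀⟩
  -- The maximum principle, at a face where `|f|` is largest.
  obtain ⟨s, hs⟩ := Finite.exists_max fun s => |f s|
  have hpos : 0 < |f s| := (abs_pos.mpr hs₀).trans_le (hs s₀)
  have h2 := congrFun hμ s
  have h3 := congrFun h1 s
  rw [WeightedComplex.op_apply_eq_sum] at h2 h3
  simp only [Pi.smul_apply, smul_eq_mul, mul_one] at h2 h3
  have h4 : |μ * f s| ≤ |f s| := by
    rw [← h2]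
    calc _ ≤ ∑ y, |X.entry T s y * f y| := abs_sum_le_sum_abs _ _
      _ ≤ ∑ y, X.entry T s y * |f s| := by
        refine sum_le_sum fun y _ => ?_
        rw [abs_mul, abs_of_nonneg (h0 s y)]
        exact mul_le_mul_of_nonneg_left (hs y) (h0 s y)
      _ = |f s| := by rw [← sum_mul, h3, one_mul]
  rw [abs_mul] at h4
  have : |μ| ≤ 1 := le_of_mul_le_mul_right (by linarith) hpos
  exact (le_abs_self μ).trans this

/-- The levels whose eigenstrip contains an eigenvalue greater than `δ`. -/
def strSet (X : WeightedComplex n d) (A B γ : ℝ) (M : WalkComb k) (δ : ℝ) : Set (Fin (k + 1)) :=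
  {i : Fin (k + 1) | ∃ f ∈ M.eigenstrip X A B γ i, f ≠ 0 ∧ ∃ μ : ℝ, M.op X f = μ • f ∧ δ < μ}

theorem stRank_eq (A B γ δ : ℝ) : M.stRank X A B γ δ = (strSet X A B γ M δ).ncard := rfl

theorem stRank_le (A B γ δ : ℝ) : M.stRank X A B γ δ ≤ k + 1 := by
  rw [stRank_eq]
  exact (Set.ncard_le_card _).trans (by simp)

/-- More than `l` indices are counted and only `l` indices lie below `l`. The counted set need not
be an initial segment, so nothing can be said about `l` itself. -/
theorem exists_le_mem_strSet {A B γ δ : ℝ} {l : ℕ} (h1 : 1 ≤ l) (hl : l ≤ M.stRank X A B γ δ - 1) :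
    ∃ i ∈ strSet X A B γ M δ, l ≤ (i : ℕ) := by
  by_contra hcon
  push Not at hcon
  have hT : strSet X A B γ M δ ⊆ ((univ.filter fun i : Fin (k + 1) => (i : ℕ) < l : Finset _) : Set _) := by
    intro i hi
    simpa using hcon i hi
  have h2 := Set.ncard_le_ncard hT
  rw [Set.ncard_coe_finset, ← stRank_eq] at h2
  have h3 : (univ.filter fun i : Fin (k + 1) => (i : ℕ) < l).card ≤ l := by
    have := card_le_card_of_injOn (s := univ.filter fun i : Fin (k + 1) => (i : ℕ) < l)
      (t := range l) (fun i => (i : ℕ)) (by intro i hi; simpa using hi)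
      (fun i _ j _ h => Fin.ext h)
    simpa using this
  omega

/-- At most `l` indices are counted, so the `l + 1` indices `0, …, l` cannot all be. -/
theorem exists_le_notMem_strSet {A B γ δ : ℝ} {l : ℕ} (hl : M.stRank X A B γ δ - 1 < l)
    (hlk : l ≤ k) : ∃ i : Fin (k + 1), i ∉ strSet X A B γ M δ ∧ (i : ℕ) ≤ l := by
  by_contra hcon
  push Not at hcon
  have hT : ((univ.filter fun i : Fin (k + 1) => (i : ℕ) ≤ l : Finset _) : Set _)
      ⊆ strSet X A B γ M δ := by
    intro i hi
    by_contra h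
    have := hcon i h
    simp at hi
    omega
  have h2 := Set.ncard_le_ncard hT
  rw [Set.ncard_coe_finset, ← stRank_eq] at h2
  have h3 : l + 1 ≤ (univ.filter fun i : Fin (k + 1) => (i : ℕ) ≤ l).card := by
    have := card_le_card_of_injOn (s := range (l + 1))
      (t := univ.filter fun i : Fin (k + 1) => (i : ℕ) ≤ l) (fun i => (Fin.ofNat (k + 1) i))
      (by
        intro i hi
        have : i < l + 1 := by simpa using hi
        simp [Nat.mod_eq_of_lt (by omega : i < k + 1)]
        omega)
      (by
        intro i hi j hj h
        have h1 : i < l + 1 := by simpa using hi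
        have h2 : j < l + 1 := by simpa using hj
        have := congrArg Fin.val h
        simpa [Nat.mod_eq_of_lt (by omega : i < k + 1), Nat.mod_eq_of_lt (by omega : j < k + 1)]
          using this)
    simpa using this
  omega

end WalkComb

/-! ### The lower bound on the expansion -/

namespace WalkComb

variable {k n d : ℕ} {X : WeightedComplex n d} {M : WalkComb k} {γ : ℝ}

/-- Allows errors in `γ` alone, with no factor from the walk, to be absorbed into `errCoef * γ`. -/
theorem le_errCoef (h : (M.sum fun _ a => a) = 1) (hh : 1 ≤ M.height) : (k : ℝ) + 1 ≤ M.errCoef := by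
  have h1 := one_le_weight h
  have h2 : (1 : ℝ) ≤ M.height := by exact_mod_cast hh
  rw [errCoef]
  have h3 : 1 ≤ M.weight * M.height := one_le_mul_of_one_le_of_one_le h1 h2
  calc (k : ℝ) + 1 = 1 * (k + 1) := (one_mul _).symm
    _ ≤ _ := by gcongr

/-- Approximate eigenvalues below `δ` in the range of the threshold rank are close to `δ`. -/
theorem sub_approxEigenvalue_le (hX : X.ApproxComm d γ X.l2) (hM : M.IsHDWalk X)
    (hanti : ∀ i j, i ≤ j → j ≤ k → M.approxEigenvalue j ≤ M.approxEigenvalue i)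
    {A B : ℝ} (hdis : M.EigenstripsDisjoint A B γ) {δ : ℝ}
    (he : (k + 1) * 4 ^ k * (M.errCoef * γ) ≤ M.stripWidth A B γ)
    {l : ℕ} (h1 : 1 ≤ l) (hl : l ≤ M.stRank X A B γ δ - 1) :
    δ - M.approxEigenvalue l ≤ (k + 1) * 4 ^ k * (M.errCoef * γ) := by
  obtain ⟨-, hlev, hsym, -⟩ := hM
  obtain ⟨i, ⟨f, hf, hf0, μ, hμ, hδ⟩, hli⟩ := exists_le_mem_strSet h1 hl
  have hμi := mem_stripInterval_of_mem_eigenstrip hsym hf hf0 hμ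
  obtain ⟨p, hp, hpμ⟩ := hX.exists_abs_sub_le hlev hsym hf0 hμ
  have hpμ' := abs_le.mp hpμ
  have hμp : μ ∈ M.stripInterval A B γ p := ⟨by linarith, by linarith⟩
  -- The eigenvalue `μ > δ` lies in the strips of `p` and of `i`, so these strips coincide by
  -- disjointness. Then `λ_l ≥ λ_i = λ_p` is close to `μ`.
  have heq : M.approxEigenvalue p = M.approxEigenvalue i := by
    by_contra hne
    have := (hdis ⟨p, by omega⟩ i hne).2
    exact Set.disjoint_left.mp this hμp hμi
  have := hanti l i hli (by omega)
  linarith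

set_option maxHeartbeats 2000000 in
/-- The contribution of a level to the quadratic form of a pseudorandom set. -/
theorem level_contribution_le (hγ : 0 ≤ γ) (hX : X.IsLocalSpectralExpander γ) (hM : M.IsHDWalk X)
    (hanti : ∀ i j, i ≤ j → j ≤ k → M.approxEigenvalue j ≤ M.approxEigenvalue i)
    (hnn : ∀ i ≤ k, 0 ≤ M.approxEigenvalue i)
    (hdis : M.EigenstripsDisjoint 1 1 γ)
    {i₀ j₀ : Fin (k + 1)} (hij : M.approxEigenvalue i₀ ≠ M.approxEigenvalue j₀)
    (hsmall : M.errCoef * γ ≤ 1 / (2 ^ k) ^ 10)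
    {δ : ℝ} (hδ0 : 0 < δ) (hδ1 : δ < 1) {S : Finset (X.Face k)} (hS : S.Nonempty)
    {r : ℕ} (hr : r = M.stRank X 1 1 γ δ - 1) {ε : ℕ → ℝ}
    (hps : X.IsL2Pseudorandom (X.indicator S) r ε ∨ X.IsLinftyPseudorandom (X.indicator S) r ε)
    (hε : ∀ i ∈ Finset.Icc 1 r, M.approxEigenvalue i < δ → ε i ≤ 1)
    {l : ℕ} (hl1 : 1 ≤ l) (hlk : l ≤ k) :
    (M.approxEigenvalue l - δ) * X.inner (X.indicator S) (X.proj k l (X.indicator S))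
      ≤ (if l ≤ r then (M.approxEigenvalue l - δ) * (k.choose l : ℝ) * ε l else 0) * X.density S
        + (2 ^ k) ^ 7 * (M.errCoef * γ) * X.density S := by
  have hA := hX.approxComm hγ
  obtain ⟨y, hy⟩ := id hS
  have hkd : k ≤ d := y.le
  have hM' := hM
  obtain ⟨hsum, hlev, hsym, -⟩ := hM'
  have h0 := approxEigenvalue_zero hsum
  have hle : ∀ i ≤ k, M.approxEigenvalue i ≤ 1 := fun i hi => h0 ▸ hanti 0 i (Nat.zero_le i) hi
  have hheight : 1 ≤ M.height := by
    by_cases h : M.approxEigenvalue i₀ = 1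
    · exact one_le_height hsum (i := j₀) fun h' => hij (h.trans h'.symm)
    · exact one_le_height hsum h
  have hκ := le_errCoef hsum hheight
  set f := X.indicator S with hf
  set α := X.density S with hα
  have hα0 : 0 < α := WeightedComplex.density_pos hS
  have hff : X.inner f f = α := WeightedComplex.inner_indicator_self S
  have hl2f : X.l2 k f ^ 2 = α := by rw [X.l2_sq, hff]
  set q := X.inner f (X.proj k l f) with hq
  -- Every factor depending on `k` is bounded by a power of `b`; the error budget for a level is
  -- `b^7 u α`, where `u = errCoef * γ`.
  set b : ℝ := 2 ^ k with hb
  have hb2 : 2 ≤ b := by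
    calc (2 : ℝ) = 2 ^ 1 := (pow_one _).symm
      _ ≤ 2 ^ k := pow_le_pow_right₀ (by norm_num) (by omega)
  have h4 : (4 : ℝ) ^ k = b ^ 2 := by
    rw [hb, ← pow_mul, mul_comm, pow_mul]; norm_num
  have h16 : (16 : ℝ) ^ k = b ^ 4 := by
    rw [hb, ← pow_mul, mul_comm, pow_mul]; norm_num
  have hkb : (k : ℝ) + 1 ≤ b := by rw [hb]; exact_mod_cast Nat.lt_two_pow_self
  have hCb : (k.choose l : ℝ) ≤ b := by rw [hb]; exact_mod_cast Nat.choose_le_two_pow k l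
  have hC0 : (0 : ℝ) ≤ k.choose l := by positivity
  set u := M.errCoef * γ with hu
  have hku : ((k : ℝ) + 1) * γ ≤ u := by rw [hu]; gcongr
  have hk0 : (0 : ℝ) ≤ k := by positivity
  have hu0 : 0 ≤ u := le_trans (by positivity) hku
  have hγu : γ ≤ u := by nlinarith
  have hb0 : 0 < b := by linarith
  have hb1 : 1 ≤ b := by linarith
  set ρ := (k : ℝ) ^ 2 * 16 ^ k * γ with hρ
  have hρ0 : 0 ≤ ρ := by positivity
  have hρu : ρ ≤ b ^ 5 * u := by
    calc ρ = k * b ^ 4 * (k * γ) := by rw [hρ, h16]; ring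
      _ ≤ b * b ^ 4 * u := by
        have : (k : ℝ) * γ ≤ u := by nlinarith
        gcongr
        linarith
      _ = b ^ 5 * u := by ring
  -- The role of the smallness assumption: errors up to `b^5 u` stay below `√u`, hence below the
  -- half-width `e` of the strips.
  have hsqu : b ^ 5 * √u ≤ 1 := by
    have h1 : √u ≤ 1 / b ^ 5 := by
      rw [Real.sqrt_le_left (by positivity), div_pow, one_pow, ← pow_mul]
      exact hsmall
    calc b ^ 5 * √u ≤ b ^ 5 * (1 / b ^ 5) := by gcongr
      _ = 1 := by field_simp
  have huu : √u * √u = u := Real.mul_self_sqrt hu0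
  have hsq0 : 0 ≤ √u := Real.sqrt_nonneg u
  have hb5u : b ^ 5 * u ≤ √u := by
    calc b ^ 5 * u = b ^ 5 * √u * √u := by rw [mul_assoc, huu]
      _ ≤ √u := mul_le_of_le_one_left hsq0 hsqu
  have hsq1 : √u ≤ 1 := by
    have : 1 ≤ b ^ 5 := one_le_pow₀ hb1
    nlinarith
  set e := M.stripWidth 1 1 γ with he
  have hestrip := le_stripWidth h0 hle hnn hij γ
  rw [← hu, ← he] at hestrip
  have hes : √u ≤ e := by nlinarith
  have hK1 : ((k : ℝ) + 1) * 4 ^ k * u ≤ b ^ 3 * u := by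
    rw [h4]
    calc ((k : ℝ) + 1) * b ^ 2 * u ≤ b * b ^ 2 * u := by gcongr
      _ = b ^ 3 * u := by ring
  have hpow : ∀ m ≤ 7, b ^ m * u * α ≤ b ^ 7 * u * α := fun m hm => by gcongr
  have hqlow : -(ρ * α) ≤ q := by
    have h1 := (hA.le_inner_proj hkd hlk f).1
    rw [hff] at h1
    have := sq_nonneg (X.l2 k (X.proj k l f))
    linarith
  have hqQ : q ≤ X.l2 k f * X.l2 k (X.proj k l f) := X.inner_le f (X.proj k l f)
  have hqb : q ≤ b ^ 2 * α := by
    have h1 := hA.proj_le hkd hlk f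
    rw [h4] at h1
    calc q ≤ _ := hqQ
      _ ≤ X.l2 k f * (b ^ 2 * X.l2 k f) := by gcongr
      _ = b ^ 2 * X.l2 k f ^ 2 := by ring
      _ = _ := by rw [hl2f]
  set lam := M.approxEigenvalue l with hlam
  have hlam0 : 0 ≤ lam := hnn l hlk
  have hlam1 : lam ≤ 1 := hle l hlk
  by_cases hlr : l ≤ r
  · rw [if_pos hlr]
    have hvar := WeightedComplex.var_downTo_le hps hlk hl1 hlr
    have hqup := hA.inner_proj_le hkd hlk hl1 f y
    rw [hff, ← hρ] at hqup
    have hqup2 : q ≤ (k.choose l : ℝ) * (ε l * α + k * (ρ * α)) := hqup.trans (by gcongr)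
    rcases le_or_gt δ lam with hδl | hδl
    · have h1 : (lam - δ) * q ≤ (lam - δ) * ((k.choose l : ℝ) * (ε l * α + k * (ρ * α))) := by
        gcongr
      have h2 : (lam - δ) * ((k.choose l : ℝ) * (k * (ρ * α))) ≤ b ^ 7 * u * α := by
        calc (lam - δ) * ((k.choose l : ℝ) * (k * (ρ * α)))
            ≤ 1 * (b * (b * (b ^ 5 * u * α))) := by
              gcongr
              · linarith
              · linarith
          _ = b ^ 7 * u * α := by ring
      linarith
    -- Here `λ_l - δ` is negative and the upper bound on `q` points the wrong way. However `δ - λ_l`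
    -- is itself small, and `ε_l ≤ 1` bounds the quantity it multiplies.
    · have hεl := hε l (mem_Icc.mpr ⟨hl1, hlr⟩) hδl
      have hd := sub_approxEigenvalue_le hA hM hanti hdis (δ := δ) (l := l)
        (by
          refine hK1.trans (le_trans ?_ (hb5u.trans hes))
          gcongr
          norm_num)
        hl1 (hr ▸ hlr)
      have hd' : δ - lam ≤ b ^ 3 * u := hd.trans hK1
      have h1 : (k.choose l : ℝ) * ε l * α - q ≤ (2 * b) * α := by
        have h2 : (k.choose l : ℝ) * ε l ≤ b * 1 := by
          calc (k.choose l : ℝ) * ε l ≤ (k.choose l : ℝ) * 1 := by gcongr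
            _ ≤ b * 1 := by gcongr
        have h3 : (k.choose l : ℝ) * ε l * α ≤ b * 1 * α := by gcongr
        have h4 : ρ * α ≤ b * α := by
          have : ρ ≤ b := by linarith
          gcongr
        linarith
      have h2 : (δ - lam) * ((k.choose l : ℝ) * ε l * α - q) ≤ b ^ 3 * u * (2 * b * α) := by
        calc _ ≤ (δ - lam) * (2 * b * α) := by
              gcongr
          _ ≤ _ := by gcongr
      have h3 : b ^ 3 * u * (2 * b * α) ≤ b ^ 5 * u * α := by
        calc b ^ 3 * u * (2 * b * α) = b ^ 4 * u * α * 2 := by ring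
          _ ≤ b ^ 4 * u * α * b := by gcongr
          _ = _ := by ring
      have := hpow 5 (by norm_num)
      linarith
  · rw [if_neg hlr, zero_mul, zero_add]
    rcases le_or_gt lam δ with hδl | hδl
    -- The product could be positive only through a negative `q`, which is at least `-ρ α`.
    · have h1 : (lam - δ) * q ≤ 1 * (b ^ 5 * u * α) := by
        have h2 : ρ * α ≤ b ^ 5 * u * α := by gcongr
        have h3 : (δ - lam) * (-q) ≤ (δ - lam) * (b ^ 5 * u * α) := by
          gcongr
          · linarith
        have h4 : (δ - lam) * (b ^ 5 * u * α) ≤ 1 * (b ^ 5 * u * α) := by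
          gcongr
          linarith
        linarith
      have := hpow 5 (by norm_num)
      linarith
    · obtain ⟨i, hiT, hil⟩ := exists_le_notMem_strSet (l := l) (by omega : M.stRank X 1 1 γ δ - 1 < l) hlk
      have hik : (i : ℕ) ≤ k := by omega
      obtain ⟨μ, φ, hφ0, hφ, hdist⟩ :=
        WeightedComplex.exists_eigenvalue_l2_le y hsym (M.approxEigenvalue i)
      set dist := |μ - M.approxEigenvalue i| with hdistdef
      have hdist0 : 0 ≤ dist := abs_nonneg _
      -- `π_i g` is an approximate eigenvector for `λ_i`, so either `λ_i` is near the spectrum or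
      -- `π_i g` is small.
      have happ : ∀ g, dist * X.l2 k (X.proj k i g) ≤ b ^ 2 * u * X.l2 k g := by
        intro g
        have h1 := (hdist (X.proj k i g)).trans (hA.comb_proj hik M hlev g)
        rw [h4] at h1
        linarith
      -- if the strip contains the eigenvalue, then `lam - δ ≤ dist`
      have hin : dist ≤ e → lam - δ ≤ dist := by
        intro hde
        have h1 := abs_le.mp (hdistdef ▸ hde : |μ - M.approxEigenvalue i| ≤ e)
        have hμδ : μ ≤ δ := by
          by_contra hc
          refine hiT ⟨φ, Submodule.subset_span ⟨μ, ⟨by linarith, by linarith⟩, hφ⟩, hφ0, μ, hφ,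
            not_le.mp hc⟩
        have h2 := neg_abs_le (μ - M.approxEigenvalue i)
        have h3 := hanti i l hil hlk
        rw [← hdistdef] at h2
        linarith
      rcases hil.lt_or_eq with hlt | heq
      · -- a lower level
        obtain ⟨s, hsy, hsc⟩ := exists_subset_card_eq (show (i : ℕ) ≤ y.1.card by
          rw [y.card_eq]; exact hik)
        -- Needs `i < k`, which holds because `i < l`. The projection to level `k` may vanish, so
        -- the case `i = l` is treated by looking at the function `f` itself.
        obtain ⟨ψ, hψ0, hψ⟩ := hX.exists_le_l2_proj hγ (lt_of_lt_of_le hlt hlk) hkd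
          (hγu.trans hsmall) ⟨s, X.mem_level_of_subset y.2 hsy hsc⟩
        have hψp := X.l2_pos hψ0
        have hdb : dist ≤ 2 * b ^ 4 * u := by
          have h1 := happ ψ
          rw [h4] at hψ
          have h2 : dist * (1 / (2 * b ^ 2) * X.l2 k ψ) ≤ b ^ 2 * u * X.l2 k ψ :=
            le_trans (by gcongr) h1
          refine le_of_mul_le_mul_right ?_ hψp
          calc dist * X.l2 k ψ = 2 * b ^ 2 * (dist * (1 / (2 * b ^ 2) * X.l2 k ψ)) := by field_simp
            _ ≤ 2 * b ^ 2 * (b ^ 2 * u * X.l2 k ψ) := by gcongr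
            _ = _ := by ring
        have hdb5 : dist ≤ b ^ 5 * u := by
          refine hdb.trans ?_
          calc 2 * b ^ 4 * u ≤ b * b ^ 4 * u := by gcongr
            _ = _ := by ring
        have h1 := hin (hdb5.trans (hb5u.trans hes))
        calc (lam - δ) * q ≤ (lam - δ) * (b ^ 2 * α) := by
              gcongr
          _ ≤ (b ^ 5 * u) * (b ^ 2 * α) := by
              gcongr
              linarith
          _ = _ := by ring
      · -- the level itself
        have happl := happ f
        rw [heq] at happl
        rcases le_or_gt dist e with hde | hde
        · have h1 := hin hde
          have h2 : (lam - δ) * q ≤ b ^ 2 * u * α := by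
            calc (lam - δ) * q ≤ (lam - δ) * (X.l2 k f * X.l2 k (X.proj k l f)) := by
                  gcongr
              _ ≤ dist * (X.l2 k f * X.l2 k (X.proj k l f)) := by gcongr
              _ = X.l2 k f * (dist * X.l2 k (X.proj k l f)) := by ring
              _ ≤ X.l2 k f * (b ^ 2 * u * X.l2 k f) := by gcongr
              _ = b ^ 2 * u * X.l2 k f ^ 2 := by ring
              _ = _ := by rw [hl2f]
          exact h2.trans (hpow 2 (by norm_num))
        -- No eigenvalue lies within `e ≥ √u` of `λ_l`. Then `dist² ≥ u` turns `dist ‖π_l f‖ ≤ b² u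
        -- ‖f‖` into `‖π_l f‖² ≤ b^4 u α`; this is where a width of order `√γ` is needed.
        · have hd0 : 0 < dist := lt_of_le_of_lt (hsq0.trans hes) hde
          set Q := X.l2 k (X.proj k l f) with hQ
          have hQ0 : 0 ≤ Q := apply_nonneg _ _
          have hQ2 : Q ^ 2 ≤ b ^ 4 * u * α := by
            have h1 : dist ^ 2 * Q ^ 2 ≤ (b ^ 2 * u) ^ 2 * α := by
              rw [← hl2f, ← mul_pow, ← mul_pow]
              exact pow_le_pow_left₀ (by positivity) happl 2
            have h2 : u ≤ dist ^ 2 := by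
              rw [← huu, ← sq]
              exact pow_le_pow_left₀ hsq0 (hes.trans hde.le) 2
            refine le_of_mul_le_mul_left ?_ (show 0 < dist ^ 2 by positivity)
            calc dist ^ 2 * Q ^ 2 ≤ (b ^ 2 * u) ^ 2 * α := h1
              _ = u * (b ^ 4 * u * α) := by ring
              _ ≤ dist ^ 2 * (b ^ 4 * u * α) := by gcongr
          have h1 := (hA.le_inner_proj hkd hlk f).2
          rw [hff, ← hρ, ← hQ] at h1
          have h2 : ρ * α ≤ b ^ 5 * u * α := by gcongr
          have h3 : b ^ 4 * u * α + b ^ 5 * u * α ≤ b ^ 7 * u * α := by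
            have e1 : b ^ 4 * u * α ≤ b ^ 6 * u * α := by
              gcongr
              norm_num
            have e2 : b ^ 5 * u * α ≤ b ^ 6 * u * α := by
              gcongr
              norm_num
            have e3 : 2 * (b ^ 6 * u * α) ≤ b * (b ^ 6 * u * α) := by gcongr
            have e4 : b * (b ^ 6 * u * α) = b ^ 7 * u * α := by ring
            linarith
          have h4 : q ≤ b ^ 7 * u * α := by linarith
          calc (lam - δ) * q ≤ (lam - δ) * (b ^ 7 * u * α) := by
                gcongr
            _ ≤ 1 * (b ^ 7 * u * α) := by
                gcongr
                linarith
            _ = _ := one_mul _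

/-- The quadratic form of a pseudorandom set. -/
theorem inner_indicator_op_le (hγ : 0 ≤ γ) (hX : X.IsLocalSpectralExpander γ) (hM : M.IsHDWalk X)
    (hanti : ∀ i j, i ≤ j → j ≤ k → M.approxEigenvalue j ≤ M.approxEigenvalue i)
    (hnn : ∀ i ≤ k, 0 ≤ M.approxEigenvalue i)
    (hdis : M.EigenstripsDisjoint 1 1 γ)
    {i₀ j₀ : Fin (k + 1)} (hij : M.approxEigenvalue i₀ ≠ M.approxEigenvalue j₀)
    (hsmall : M.errCoef * γ ≤ 1 / (2 ^ k) ^ 10)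
    {δ : ℝ} (hδ0 : 0 < δ) (hδ1 : δ < 1) {S : Finset (X.Face k)} (hS : S.Nonempty)
    {r : ℕ} (hr : r = M.stRank X 1 1 γ δ - 1) {ε : ℕ → ℝ}
    (hps : X.IsL2Pseudorandom (X.indicator S) r ε ∨ X.IsLinftyPseudorandom (X.indicator S) r ε)
    (hε : ∀ i ∈ Finset.Icc 1 r, M.approxEigenvalue i < δ → ε i ≤ 1) :
    X.inner (X.indicator S) (M.op X (X.indicator S)) ≤
      (X.density S + (1 - X.density S) * δ
        + ∑ i ∈ Icc 1 r, (M.approxEigenvalue i - δ) * (k.choose i : ℝ) * ε i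
        + (2 ^ k) ^ 8 * (M.errCoef * γ)) * X.density S := by
  have hA := hX.approxComm hγ
  obtain ⟨y, hy⟩ := id hS
  have h0 := approxEigenvalue_zero hM.1
  have h1 := hA.inner_op_le M hM.2.1 (X.indicator S)
  have h2 := WeightedComplex.sum_inner_proj (X.indicator S)
  have h3 := WeightedComplex.inner_proj_zero (X.indicator S) y
  rw [← WeightedComplex.density] at h3
  rw [WeightedComplex.inner_indicator_self, sum_range_succ', h3] at h2
  rw [WeightedComplex.inner_indicator_self, sum_range_succ', h3, h0, one_mul] at h1
  set α := X.density S with hα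
  have hα0 : 0 < α := WeightedComplex.density_pos hS
  have hrk : r ≤ k := by
    have := stRank_le (X := X) (M := M) 1 1 γ δ
    omega
  set q : ℕ → ℝ := fun l => X.inner (X.indicator S) (X.proj k l (X.indicator S)) with hq
  set G : ℕ → ℝ := fun l => (M.approxEigenvalue l - δ) * (k.choose l : ℝ) * ε l with hG
  have h4 : ∑ l ∈ range k, (M.approxEigenvalue (l + 1) - δ) * q (l + 1)
      ≤ ∑ l ∈ range k, ((if l + 1 ≤ r then G (l + 1) else 0) * α
        + (2 ^ k) ^ 7 * (M.errCoef * γ) * α) := by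
    refine sum_le_sum fun l hl => ?_
    have := mem_range.mp hl
    exact level_contribution_le hγ hX hM hanti hnn hdis hij hsmall hδ0 hδ1 hS hr hps hε
      (by omega) (by omega)
  have h5 : ∑ l ∈ range k, (if l + 1 ≤ r then G (l + 1) else 0) = ∑ i ∈ Icc 1 r, G i := by
    rw [← sum_filter]
    refine sum_bij (fun l _ => l + 1) ?_ ?_ ?_ ?_
    · intro l hl
      simp only [mem_filter, mem_range, mem_Icc] at hl ⊢
      omega
    · intro a _ b _ h
      omega
    · intro c hc
      rw [mem_Icc] at hc
      exact ⟨c - 1, by simp only [mem_filter, mem_range]; omega, by omega⟩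
    · intro l _
      rfl
  rw [sum_add_distrib, ← sum_mul, h5, sum_const, card_range, nsmul_eq_mul] at h4
  -- Subtracting `δ` on all positive levels costs `δ ∑_{l ≥ 1} q_l = δ (α - α²)`, the source of the
  -- term `(1-α) δ`.
  have h6 : ∑ l ∈ range k, (M.approxEigenvalue (l + 1) - δ) * q (l + 1)
      = ∑ l ∈ range k, M.approxEigenvalue (l + 1) * q (l + 1) - δ * ∑ l ∈ range k, q (l + 1) := by
    rw [mul_sum, ← sum_sub_distrib]
    exact sum_congr rfl fun l _ => by ring
  have h7 : ∑ l ∈ range k, q (l + 1) = α - α ^ 2 := by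
    have h8 : ∑ l ∈ range k, q (l + 1) + α ^ 2 = α := h2
    linarith
  rw [h6, h7] at h4
  have hu0 : 0 ≤ M.errCoef * γ := mul_nonneg M.errCoef_nonneg hγ
  have h8 : (k : ℝ) * ((2 ^ k) ^ 7 * (M.errCoef * γ) * α) + M.errCoef * γ * α
      ≤ (2 ^ k) ^ 8 * (M.errCoef * γ) * α := by
    have hkb : (k : ℝ) + 1 ≤ 2 ^ k := by exact_mod_cast Nat.lt_two_pow_self
    have h9 : M.errCoef * γ * α ≤ (2 ^ k) ^ 7 * (M.errCoef * γ) * α := by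
      have h10 : (1 : ℝ) ≤ (2 ^ k) ^ 7 := one_le_pow₀ (one_le_pow₀ (by norm_num))
      calc M.errCoef * γ * α = 1 * (M.errCoef * γ) * α := by ring
        _ ≤ _ := by gcongr
    calc _ ≤ ((k : ℝ) + 1) * ((2 ^ k) ^ 7 * (M.errCoef * γ) * α) := by linarith
      _ ≤ 2 ^ k * ((2 ^ k) ^ 7 * (M.errCoef * γ) * α) := by gcongr
      _ = _ := by ring
  calc _ ≤ _ := h1
    _ ≤ _ := by linarith

/-- The lower bound on the expansion of a pseudorandom set. -/
theorem expansionBound_le_expansion (hγ : 0 ≤ γ) (hX : X.IsLocalSpectralExpander γ)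
    (hM : M.IsHDWalk X)
    (hanti : ∀ i j, i ≤ j → j ≤ k → M.approxEigenvalue j ≤ M.approxEigenvalue i)
    (hnn : ∀ i ≤ k, 0 ≤ M.approxEigenvalue i)
    (hdis : M.EigenstripsDisjoint 1 1 γ)
    {δ : ℝ} (hδ0 : 0 < δ) {S : Finset (X.Face k)} (hS : S.Nonempty)
    {r : ℕ} (hr : r = M.stRank X 1 1 γ δ - 1) {ε : ℕ → ℝ}
    (hps : X.IsL2Pseudorandom (X.indicator S) r ε ∨ X.IsLinftyPseudorandom (X.indicator S) r ε)
    (hε : ∀ i ∈ Finset.Icc 1 r, M.approxEigenvalue i < δ → ε i ≤ 1) :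
    expansionBound 20 γ δ (X.density S) M r ε ≤ X.expansion (M.op X) S := by
  obtain ⟨y, hy⟩ := id hS
  have hone := X.comb_op_const hM.1 hM.2.1 1
  have h0 := approxEigenvalue_zero hM.1
  have hle : ∀ i ≤ k, M.approxEigenvalue i ≤ 1 := fun i hi => h0 ▸ hanti 0 i (Nat.zero_le i) hi
  set α := X.density S with hα
  have hα0 : 0 < α := WeightedComplex.density_pos hS
  have hα1 : α ≤ 1 := WeightedComplex.density_le_one S
  have hrk : r ≤ k := by
    have := stRank_le (X := X) (M := M) 1 1 γ δ
    omega
  have hεnn : ∀ i ∈ Icc 1 r, 0 ≤ ε i := by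
    intro i hi
    rw [mem_Icc] at hi
    have h1 := WeightedComplex.var_downTo_le hps (hi.2.trans hrk) hi.1 hi.2
    obtain ⟨s, hsy, hsc⟩ := exists_subset_card_eq (show i ≤ y.1.card by
      rw [y.card_eq]; exact hi.2.trans hrk)
    have h2 := (WeightedComplex.var_nonneg ⟨s, X.mem_level_of_subset y.2 hsy hsc⟩ _).trans h1
    exact nonneg_of_mul_nonneg_left h2 hα0
  set c := M.weight * (M.height : ℝ) ^ 2 * (2 : ℝ) ^ ((20 : ℝ) * k) with hc
  have hpow : (2 : ℝ) ^ ((20 : ℝ) * k) = (2 ^ k) ^ 20 := by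
    rw [show (20 : ℝ) * k = ((k * 20 : ℕ) : ℝ) by push_cast; ring, Real.rpow_natCast, pow_mul]
  have hw0 := M.weight_nonneg
  have hcγ : 0 ≤ c * γ := by positivity
  -- a non-positive bound is trivial
  have htriv : expansionBound 20 γ δ α M r ε ≤ 0 →
      expansionBound 20 γ δ α M r ε ≤ X.expansion (M.op X) S := fun h =>
    h.trans (WeightedComplex.expansion_nonneg hM.2.2.2 S)
  rcases le_or_gt 1 δ with hδ1 | hδ1
  · -- there is no eigenvalue greater than `δ`
    have hr0 : r = 0 := by
      have : strSet X 1 1 γ M δ = ∅ := by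
        rw [Set.eq_empty_iff_forall_notMem]
        rintro i ⟨f, _, hf0, μ, hμ, hδμ⟩
        have := eigenvalue_le_one hone hM.2.2.2 hf0 hμ
        linarith
      rw [hr, stRank_eq, this]; simp
    refine htriv ?_
    rw [expansionBound, hr0]
    simp only [Order.lt_one_iff, Icc_eq_empty_of_lt, sum_empty, sub_zero]
    rw [← hc]
    nlinarith
  by_cases hall : ∀ i j : Fin (k + 1), M.approxEigenvalue i = M.approxEigenvalue j
  · -- all approximate eigenvalues are one
    have hone' : ∀ i ≤ k, M.approxEigenvalue i = 1 := fun i hi => by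
      rw [← h0]; exact hall ⟨i, by omega⟩ 0
    have hE : M.stripWidth 1 1 γ = 0 := by
      -- The infimum of the empty set is zero and so is a quotient by zero; these default values
      -- give the half-width zero.
      have : M.eigDif = 0 := by
        rw [eigDif, show {x | ∃ i j : Fin (k + 1), M.approxEigenvalue i ≠ M.approxEigenvalue j ∧
          x = |M.approxEigenvalue i - M.approxEigenvalue j|} = ∅ from ?_, Real.sInf_empty]
        rw [Set.eq_empty_iff_forall_notMem]
        rintro x ⟨i, j, h, _⟩
        exact h (hall i j)
      rw [stripWidth, eigRatio, this]; simp
    have hT : strSet X 1 1 γ M δ = Set.univ := by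
      rw [Set.eq_univ_iff_forall]
      intro i
      have hmem : (1 : ℝ) ∈ M.stripInterval 1 1 γ i := by
        rw [stripInterval, hE, hone' i (by omega)]; simp
      have h1 : M.op X (fun _ => 1) = (1 : ℝ) • fun _ => 1 := by rw [hone, one_smul]
      exact ⟨fun _ => 1, Submodule.subset_span ⟨1, hmem, h1⟩,
        fun h => one_ne_zero (congrFun h y), 1, h1, hδ1⟩
    have hrk' : r = k := by
      rw [hr, stRank_eq, hT, Set.ncard_univ]; simp
    refine htriv ?_
    rw [expansionBound, ← hc]
    have hterm : ∀ i ∈ Icc 1 r, 0 ≤ (M.approxEigenvalue i - δ) * (k.choose i : ℝ) * ε i := by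
      intro i hi
      have := hεnn i hi
      rw [mem_Icc] at hi
      rw [hone' i (by omega)]
      have : 0 ≤ 1 - δ := by linarith
      positivity
    rcases Nat.eq_zero_or_pos k with hk0 | hk0
    · have hα' : α = 1 := by
        subst hk0
        rw [hα, WeightedComplex.density, WeightedComplex.expect_zero _ y, WeightedComplex.indicator,
          if_pos hy]
      have := sum_nonneg hterm
      rw [hα']
      linarith
    -- All strips contain the constants, so `r = k`. The variance of `1_S` itself forces `ε_k ≥ 1 -
    -- α`, and the term `i = k` alone makes the bound non-positive.
    · have hkr : k ∈ Icc 1 r := mem_Icc.mpr ⟨hk0, hrk'.ge⟩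
      have h2 := single_le_sum hterm hkr
      rw [hone' k le_rfl, Nat.choose_self, Nat.cast_one, mul_one] at h2
      have h3 := WeightedComplex.var_downTo_le hps le_rfl hk0 hrk'.ge
      rw [X.downTo_self, LinearMap.id_apply, WeightedComplex.var_eq,
        WeightedComplex.inner_indicator_self] at h3
      replace h3 : α - α ^ 2 ≤ ε k * α := h3
      have h4 : 1 - α ≤ ε k := by
        refine le_of_mul_le_mul_right ?_ hα0
        linarith
      have h5 : (1 - δ) * (1 - α) ≤ (1 - δ) * ε k := by
        gcongr
      linarith
  push Not at hall
  obtain ⟨i₀, j₀, hij⟩ := hall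
  have hheight : 1 ≤ M.height := by
    by_cases h : M.approxEigenvalue i₀ = 1
    · exact one_le_height hM.1 (i := j₀) fun h' => hij (h.trans h'.symm)
    · exact one_le_height hM.1 h
  have hw := one_le_weight hM.1
  have hh : (1 : ℝ) ≤ M.height := by exact_mod_cast hheight
  have hk1 : 1 ≤ k := by
    by_contra hk
    have : i₀ = j₀ := Fin.ext (by omega)
    exact hij (by rw [this])
  set b : ℝ := 2 ^ k with hb
  have hb2 : 2 ≤ b := by
    calc (2 : ℝ) = 2 ^ 1 := (pow_one _).symm
      _ ≤ 2 ^ k := pow_le_pow_right₀ (by norm_num) (by omega)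
  have hkb : (k : ℝ) + 1 ≤ b := by rw [hb]; exact_mod_cast Nat.lt_two_pow_self
  -- One of the twenty powers of `b` in `c` pays for replacing `k + h(M)` by `h(M)`.
  have hu : M.errCoef * γ * b ^ 19 ≤ c * γ := by
    have h1 : M.errCoef ≤ M.weight * (M.height : ℝ) ^ 2 * b := by
      rw [errCoef]
      have : (k : ℝ) + M.height ≤ M.height * b := by nlinarith
      calc M.weight * M.height * (k + M.height) ≤ M.weight * M.height * (M.height * b) := by gcongr
        _ = _ := by ring
    calc M.errCoef * γ * b ^ 19 ≤ M.weight * (M.height : ℝ) ^ 2 * b * γ * b ^ 19 := by gcongr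
      _ = c * γ := by rw [hc, hpow]; ring
  have hu0 : 0 ≤ M.errCoef * γ := mul_nonneg M.errCoef_nonneg hγ
  rcases le_or_gt (2 * b) (c * γ) with hbig | hbig
  · -- a large error makes the bound trivial
    refine htriv ?_
    rw [expansionBound, ← hc]
    -- Only levels with `λ_i < δ` contribute negatively, and there `ε_i ≤ 1`. So the sum is at least
    -- `-b`, and `1 + b ≤ 2 b ≤ c γ`.
    have h1 : ∀ i ∈ Icc 1 r, -(k.choose i : ℝ)
        ≤ (M.approxEigenvalue i - δ) * (k.choose i : ℝ) * ε i := by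
      intro i hi
      have he0 := hεnn i hi
      have hik : i ≤ k := (mem_Icc.mp hi).2.trans hrk
      have hC : (0 : ℝ) ≤ k.choose i := by positivity
      rcases le_or_gt δ (M.approxEigenvalue i) with h | h
      · have : 0 ≤ (M.approxEigenvalue i - δ) * (k.choose i : ℝ) * ε i :=
          mul_nonneg (mul_nonneg (by linarith) hC) he0
        linarith
      · have he1 := hε i hi h
        have h2 := hnn i hik
        have h3 : (δ - M.approxEigenvalue i) * (k.choose i : ℝ) * ε i ≤ 1 * (k.choose i : ℝ) * 1 := by
          gcongr
          linarith
        linarith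
    have h2 := sum_le_sum h1
    have h3 : ∑ i ∈ Icc 1 r, (k.choose i : ℝ) ≤ b := by
      have h4 : ∑ i ∈ Icc 1 r, k.choose i ≤ 2 ^ k := by
        rw [← Nat.sum_range_choose]
        refine sum_le_sum_of_subset fun i hi => ?_
        rw [mem_Icc] at hi
        exact mem_range.mpr (by omega)
      rw [hb]
      exact_mod_cast h4
    rw [sum_neg_distrib] at h2
    have h4 : 0 ≤ (1 - α) * δ := mul_nonneg (by linarith) hδ0.le
    linarith
  · have hb0 : 0 < b := by linarith
    have hsmall : M.errCoef * γ ≤ 1 / b ^ 10 := by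
      rw [le_div_iff₀ (by positivity)]
      have h1 : M.errCoef * γ * b ^ 19 ≤ b ^ 2 := by
        have : 2 * b ≤ b ^ 2 := by nlinarith
        linarith
      have h2 : M.errCoef * γ * b ^ 10 * b ^ 9 ≤ 1 * b ^ 9 := by
        calc _ = M.errCoef * γ * b ^ 19 := by ring
          _ ≤ b ^ 2 := h1
          _ ≤ b ^ 9 := pow_le_pow_right₀ (by linarith) (by norm_num)
          _ = _ := (one_mul _).symm
      exact le_of_mul_le_mul_right h2 (by positivity)
    have hmain := inner_indicator_op_le hγ hX hM hanti hnn hdis hij hsmall hδ0 hδ1 hS hr hps hε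
    rw [WeightedComplex.expansion_eq hone hS, expansionBound, ← hc, ← hα]
    rw [← hα, ← div_le_iff₀ hα0, ← hb] at hmain
    have h8 : b ^ 8 * (M.errCoef * γ) ≤ c * γ := by
      refine le_trans ?_ hu
      rw [mul_comm]
      gcongr
      · linarith
      · norm_num
    linarith

end WalkComb

/-! ### The complete complex -/

section Complete

variable {n d : ℕ} (h : d ≤ n)

theorem completeComplex_mem_level {i : ℕ} (hi : i ≤ d) {s : Finset (Fin n)} :
    s ∈ (completeComplex n d h).level i ↔ s.card = i := by
  rw [WeightedComplex.mem_level, and_iff_left_iff_imp]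
  intro hs
  obtain ⟨t, hst, -, ht⟩ := exists_subsuperset_card_eq (subset_univ s) (by omega : s.card ≤ d)
    (by simpa using h)
  exact ⟨t, mem_powersetCard.mpr ⟨subset_univ t, ht⟩, hst⟩

/-- Downward induction from the top level through `sum_mass_insert`. -/
theorem completeComplex_mass {i : ℕ} (hi : i ≤ d) {s : Finset (Fin n)} (hs : s.card = i) :
    (completeComplex n d h).mass s = (d.choose i : ℝ) / (n.choose i : ℝ) := by
  induction hi using Nat.decreasingInduction generalizing s with
  | self =>
    have ht : s ∈ (completeComplex n d h).top := mem_powersetCard.mpr ⟨subset_univ s, hs⟩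
    have h1 := (completeComplex n d h).prob_top ht
    rw [WeightedComplex.prob_eq_mass, hs, Nat.choose_self, Nat.cast_one, div_one] at h1
    rw [h1, Nat.choose_self, Nat.cast_one]
    rfl
  | of_succ i hi ih =>
    have h1 := (completeComplex n d h).sum_mass_insert s
    rw [sum_congr rfl fun v hv => ih (s := insert v s) (by
      rw [card_insert_of_notMem (mem_compl.mp hv), hs]), sum_const, card_compl, Fintype.card_fin,
      nsmul_eq_mul, hs, Nat.cast_sub (by omega)] at h1
    have h2 : ((d.choose (i + 1) : ℕ) : ℝ) * ((i : ℝ) + 1) = (d.choose i : ℝ) * ((d : ℝ) - i) := by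
      rw [← Nat.cast_sub (by omega)]
      exact_mod_cast Nat.choose_succ_right_eq d i
    have h3 : ((n.choose (i + 1) : ℕ) : ℝ) * ((i : ℝ) + 1) = (n.choose i : ℝ) * ((n : ℝ) - i) := by
      rw [← Nat.cast_sub (by omega)]
      exact_mod_cast Nat.choose_succ_right_eq n i
    have hdi : (d : ℝ) - i ≠ 0 := by
      rw [← Nat.cast_sub (by omega)]
      exact_mod_cast (by omega : d - i ≠ 0)
    have hn1 : (n.choose (i + 1) : ℝ) ≠ 0 := by
      exact_mod_cast (Nat.choose_pos (by omega : i + 1 ≤ n)).ne'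
    have hn0 : (n.choose i : ℝ) ≠ 0 := by
      exact_mod_cast (Nat.choose_pos (by omega : i ≤ n)).ne'
    have hi1 : (i : ℝ) + 1 ≠ 0 := by positivity
    refine mul_left_cancel₀ hdi (h1.symm.trans ?_)
    field_simp
    refine mul_right_cancel₀ hi1 ?_
    linear_combination ((n : ℝ) - i) * (n.choose i : ℝ) * h2 - (d.choose i : ℝ) * ((d : ℝ) - i) * h3

/-- On the complete complex the down operator adds a uniformly random vertex, so it no longer
involves the dimension `d`. -/
theorem completeComplex_down {i : ℕ} (hi : i + 1 ≤ d) (g : (completeComplex n d h).Fn (i + 1))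
    (x : (completeComplex n d h).Face i) :
    (completeComplex n d h).down i g x
      = 1 / ((n : ℝ) - i) * ∑ u ∈ x.1ᶜ, (completeComplex n d h).extend g (insert u x.1) := by
  have h1 := WeightedComplex.down_eq_mass g x
  have hx := x.card_eq
  rw [sum_congr rfl fun u hu => by rw [completeComplex_mass h hi (s := insert u x.1) (by
      rw [card_insert_of_notMem (mem_compl.mp hu), hx])], ← mul_sum,
    completeComplex_mass h (by omega) hx] at h1
  have h2 : ((d.choose (i + 1) : ℕ) : ℝ) * ((i : ℝ) + 1) = (d.choose i : ℝ) * ((d : ℝ) - i) := by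
    rw [← Nat.cast_sub (by omega)]
    exact_mod_cast Nat.choose_succ_right_eq d i
  have h3 : ((n.choose (i + 1) : ℕ) : ℝ) * ((i : ℝ) + 1) = (n.choose i : ℝ) * ((n : ℝ) - i) := by
    rw [← Nat.cast_sub (by omega)]
    exact_mod_cast Nat.choose_succ_right_eq n i
  have hni : (n : ℝ) - i ≠ 0 := by
    rw [← Nat.cast_sub (by omega)]
    exact_mod_cast (by omega : n - i ≠ 0)
  have hdi : (d : ℝ) - i ≠ 0 := by
    rw [← Nat.cast_sub (by omega)]
    exact_mod_cast (by omega : d - i ≠ 0)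
  have hn1 : (n.choose (i + 1) : ℝ) ≠ 0 := by
    exact_mod_cast (Nat.choose_pos (by omega : i + 1 ≤ n)).ne'
  have hd1 : (d.choose (i + 1) : ℝ) ≠ 0 := by exact_mod_cast (Nat.choose_pos hi).ne'
  have hn0 : (n.choose i : ℝ) ≠ 0 := by
    exact_mod_cast (Nat.choose_pos (by omega : i ≤ n)).ne'
  have hi1 : (i : ℝ) + 1 ≠ 0 := by positivity
  set A := (completeComplex n d h).down i g x
  set B := ∑ u ∈ x.1ᶜ, (completeComplex n d h).extend g (insert u x.1)
  have h4 : ((d : ℝ) - i) * (d.choose i / n.choose i)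
      = ((n : ℝ) - i) * (d.choose (i + 1) / n.choose (i + 1)) := by
    field_simp
    refine mul_right_cancel₀ hi1 ?_
    linear_combination (d.choose i : ℝ) * ((d : ℝ) - i) * h3 - ((n : ℝ) - i) * (n.choose i : ℝ) * h2
  rw [h4] at h1
  have h5 : (d.choose (i + 1) : ℝ) / n.choose (i + 1) ≠ 0 := div_ne_zero hd1 hn1
  have h6 : ((n : ℝ) - i) * A = B := by
    refine mul_left_cancel₀ h5 ?_
    linarith
  rw [← h6]
  field_simp

theorem WeightedComplex.up_eq {X : WeightedComplex n d} {i : ℕ} (g : X.Fn i) (y : X.Face (i + 1)) :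
    X.up i g y = 1 / ((i : ℝ) + 1) * ∑ u ∈ y.1, X.extend g (y.1.erase u) := by
  rw [WeightedComplex.up_apply, WeightedComplex.sum_subfaces]

/-- The complete complex is a two-sided local-spectral expander. -/
theorem completeComplex_isLocalSpectralExpander :
    (completeComplex n d h).IsLocalSpectralExpander (1 / ((n : ℝ) - d + 1)) := by
  intro i hi s μ f hf hsum heig
  have hs := s.card_eq
  set w : ℝ := ((d.choose (i + 2) : ℝ) / (n.choose (i + 2) : ℝ))
    / ((completeComplex n d h).mass s.1 * ((d - i).choose 2 : ℝ)) with hw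
  have hw0 : 0 < w := by
    have h1 : 0 < (d.choose (i + 2) : ℝ) := by exact_mod_cast Nat.choose_pos hi
    have h2 : 0 < (n.choose (i + 2) : ℝ) := by exact_mod_cast Nat.choose_pos (hi.trans h)
    have h3 : 0 < ((d - i).choose 2 : ℝ) := by
      exact_mod_cast Nat.choose_pos (by omega : 2 ≤ d - i)
    have h4 := (completeComplex n d h).mass_pos s.2
    positivity
  have hedge : ∀ u v, ((completeComplex n d h).link s).edgeWeight u v = if u = v then 0 else w := by
    intro u v
    rw [(completeComplex n d h).link_edgeWeight]
    by_cases huv : u = v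
    · rw [if_pos huv, if_pos (by rw [huv])]
    · have huv' : u.1 ≠ v.1 := fun h => huv (Subtype.ext h)
      have hu := ((completeComplex n d h).mem_link_level_one s).mp u.2
      have hv := ((completeComplex n d h).mem_link_level_one s).mp v.2
      rw [if_neg huv, if_neg huv', completeComplex_mass h hi]
      rw [card_insert_of_notMem, card_insert_of_notMem hu.1, hs]
      rw [mem_insert, not_or]
      exact ⟨huv'.symm, hv.1⟩
  have hcard : (Fintype.card {v : Fin n // {v} ∈ ((completeComplex n d h).link s).level 1} : ℝ) = n - i := by
    have h1 := (completeComplex n d h).sum_link_vertices s (fun _ => 1) (by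
      intro v hv
      exfalso
      have h2 : (insert v s.1).card ≤ d := (card_insert_le _ _).trans (by omega)
      have h3 := (completeComplex n d h).mass_pos ((completeComplex_mem_level h h2).mpr rfl)
      exact h3.ne' hv)
    rw [sum_const, sum_const, card_compl, Fintype.card_fin, hs, card_univ, nsmul_one,
      nsmul_one, Nat.cast_sub (by omega)] at h1
    exact h1
  have hni : (i : ℝ) + 2 ≤ n := by exact_mod_cast hi.trans h
  have hdeg : ∀ u, ∑ v, ((completeComplex n d h).link s).edgeWeight u v = w * (n - i - 1) := by
    intro u
    simp only [hedge]
    rw [← hcard]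
    have h1 : ∀ v, (if u = v then (0 : ℝ) else w) = w - if u = v then w else 0 := by
      intro v; split_ifs <;> simp
    simp only [h1, sum_sub_distrib, sum_ite_eq, mem_univ, if_true, sum_const, card_univ,
      nsmul_eq_mul]
    ring
  have hD : 0 < w * (n - i - 1) := mul_pos hw0 (by linarith)
  have hf0 : ∑ u, f u = 0 := by
    simp only [hdeg, ← mul_sum] at hsum
    exact (mul_eq_zero.mp hsum).resolve_left hD.ne'
  obtain ⟨u, hu⟩ := Function.ne_iff.mp hf
  have h1 := heig u
  simp only [hdeg] at h1
  simp only [hedge] at h1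
  have h2 : ∀ v, (if u = v then (0 : ℝ) else w) / (w * (n - i - 1)) * f v
      = w / (w * (n - i - 1)) * f v - if u = v then w / (w * (n - i - 1)) * f v else 0 := by
    intro v; split_ifs <;> simp
  simp only [h2, sum_sub_distrib, ← mul_sum, hf0, mul_zero, sum_ite_eq, mem_univ, if_true,
    zero_sub] at h1
  -- The link graph is complete on `n - i` vertices; its only non-trivial eigenvalue is
  -- `-1/(n-i-1)`, and `i ≤ d - 2`.
  have h3 : -(w / (w * ((n : ℝ) - i - 1))) = μ := by
    refine mul_right_cancel₀ hu ?_
    rw [neg_mul]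
    exact h1
  have hni1 : (0 : ℝ) < n - i - 1 := by linarith
  have h4 : w / (w * ((n : ℝ) - i - 1)) = 1 / (n - i - 1) := by field_simp
  rw [← h3, h4, abs_neg, abs_of_nonneg (by positivity)]
  have hdi : (i : ℝ) + 2 ≤ d := by exact_mod_cast hi
  have hnd : (d : ℝ) ≤ n := by exact_mod_cast h
  exact one_div_le_one_div_of_le (by linarith) (by linarith)

theorem WeightedComplex.abs_extend_le {X : WeightedComplex n d} {i : ℕ} (g : X.Fn i)
    (s : Finset (Fin n)) : |X.extend g s| ≤ ‖g‖ := by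
  rw [WeightedComplex.extend]
  split_ifs with hs
  · exact norm_le_pi_norm g ⟨s, hs⟩
  · simp

/-- On the complete complex the averaging operators commute approximately with respect to the
supremum norm. -/
theorem completeComplex_approxComm {L : ℕ} (hL : L ≤ d) :
    (completeComplex n d h).ApproxComm L (2 / ((n : ℝ) - L + 1)) fun _ => normSeminorm ℝ _ where
  nonneg := by
    have : (L : ℝ) ≤ n := by exact_mod_cast hL.trans h
    have : 0 ≤ (n : ℝ) - L + 1 := by linarith
    positivity
  up_le m g hm := by
    rw [coe_normSeminorm, coe_normSeminorm, pi_norm_le_iff_of_nonneg (norm_nonneg _)]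
    intro y
    rw [WeightedComplex.up_eq, Real.norm_eq_abs, abs_mul]
    have h1 := abs_sum_le_sum_abs (fun u => (completeComplex n d h).extend g (y.1.erase u)) y.1
    have h2 := h1.trans (sum_le_sum fun u _ => WeightedComplex.abs_extend_le g (y.1.erase u))
    rw [sum_const, y.card_eq, nsmul_eq_mul] at h2
    rw [abs_of_nonneg (by positivity)]
    calc _ ≤ 1 / ((m : ℝ) + 1) * (((m + 1 : ℕ) : ℝ) * ‖g‖) := by gcongr
      _ = ‖g‖ := by push_cast; field_simp
  down_le m g hm := by
    rw [coe_normSeminorm, coe_normSeminorm, pi_norm_le_iff_of_nonneg (norm_nonneg _)]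
    intro x
    have hmn : (m : ℝ) + 1 ≤ n := by exact_mod_cast (hm.trans hL).trans h
    rw [completeComplex_down h (hm.trans hL), Real.norm_eq_abs, abs_mul]
    have h1 := abs_sum_le_sum_abs (fun u => (completeComplex n d h).extend g (insert u x.1)) x.1ᶜ
    have h2 := h1.trans (sum_le_sum fun u _ => WeightedComplex.abs_extend_le g (insert u x.1))
    rw [sum_const, card_compl, Fintype.card_fin, x.card_eq, nsmul_eq_mul,
      Nat.cast_sub (by omega)] at h2
    have h3 : (0 : ℝ) < n - m := by linarith
    rw [abs_of_nonneg (by positivity)]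
    calc _ ≤ 1 / ((n : ℝ) - m) * (((n : ℝ) - m) * ‖g‖) := by gcongr
      _ = ‖g‖ := by field_simp
  down_up_zero hl g := WeightedComplex.down_up_zero _ (hl.trans hL) g
  comm m g hm := by
    have hmL : (m : ℝ) + 2 ≤ L := by exact_mod_cast hm
    have hLn : (L : ℝ) ≤ n := by exact_mod_cast hL.trans h
    have hn1 : (0 : ℝ) < n - (m + 1) := by linarith
    have hn0 : (0 : ℝ) < n - m := by linarith
    have hnL : (0 : ℝ) < n - L + 1 := by linarith
    rw [coe_normSeminorm, pi_norm_le_iff_of_nonneg (by positivity)]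
    intro x
    have hx := x.card_eq
    -- The sum of `g` over all faces obtained from `x` by exchanging one vertex. Both compositions
    -- are combinations of `g x` and `S`, so only coefficients have to be compared.
    set S := ∑ v ∈ x.1ᶜ, ∑ u ∈ x.1, (completeComplex n d h).extend g ((insert v x.1).erase u) with hS
    have hSle : |S| ≤ ((n : ℝ) - (m + 1)) * (((m : ℝ) + 1) * ‖g‖) := by
      refine (abs_sum_le_sum_abs _ _).trans ((sum_le_sum (g := fun _ => ((m : ℝ) + 1) * ‖g‖)
        fun v _ => ?_).trans ?_)
      · refine (abs_sum_le_sum_abs _ _).trans ((sum_le_sum fun u _ =>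
          WeightedComplex.abs_extend_le g _).trans ?_)
        rw [sum_const, hx, nsmul_eq_mul]
        push_cast
        rfl
      · rw [sum_const, card_compl, Fintype.card_fin, hx, nsmul_eq_mul, Nat.cast_sub (by omega)]
        push_cast
        rfl
    have h1 : (completeComplex n d h).down (m + 1) ((completeComplex n d h).up (m + 1) g) x
        = 1 / ((n : ℝ) - (m + 1)) * (1 / ((m : ℝ) + 2) * ((((n : ℝ) - (m + 1)) * g x) + S)) := by
      rw [completeComplex_down h (by omega)]
      push_cast
      congr 1
      have h2 : ∀ v ∈ x.1ᶜ, (completeComplex n d h).extend ((completeComplex n d h).up (m + 1) g) (insert v x.1)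
          = 1 / ((m : ℝ) + 2) * (g x + ∑ u ∈ x.1, (completeComplex n d h).extend g ((insert v x.1).erase u)) := by
        intro v hv
        have hv' := mem_compl.mp hv
        have hmem : insert v x.1 ∈ (completeComplex n d h).level (m + 1 + 1) := by
          rw [completeComplex_mem_level h (by omega), card_insert_of_notMem hv', hx]
        have h3 := WeightedComplex.extend_coe ((completeComplex n d h).up (m + 1) g) ⟨_, hmem⟩
        rw [WeightedComplex.up_eq] at h3
        simp only at h3
        rw [h3, sum_insert hv', erase_insert hv', WeightedComplex.extend_coe]
        push_cast
        ring_nf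
      rw [sum_congr rfl h2, ← mul_sum, sum_add_distrib, sum_const, card_compl, Fintype.card_fin, hx,
        nsmul_eq_mul, Nat.cast_sub (by omega), ← hS]
      push_cast
      rfl
    have h2 : (completeComplex n d h).up m ((completeComplex n d h).down m g) x
        = 1 / ((m : ℝ) + 1) * (1 / ((n : ℝ) - m) * (((m : ℝ) + 1) * g x + S)) := by
      rw [WeightedComplex.up_eq]
      congr 1
      have h3 : ∀ u ∈ x.1, (completeComplex n d h).extend ((completeComplex n d h).down m g) (x.1.erase u)
          = 1 / ((n : ℝ) - m) * (g x + ∑ v ∈ x.1ᶜ, (completeComplex n d h).extend g ((insert v x.1).erase u)) := by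
        intro u hu
        have hmem : x.1.erase u ∈ (completeComplex n d h).level m :=
          (completeComplex n d h).mem_level_of_subset x.2 (erase_subset _ _) (by rw [card_erase_of_mem hu, hx]; rfl)
        have h4 := WeightedComplex.extend_coe ((completeComplex n d h).down m g) ⟨_, hmem⟩
        rw [completeComplex_down h (by omega)] at h4
        simp only at h4
        rw [h4, compl_erase, sum_insert (by simpa using hu), insert_erase hu,
          WeightedComplex.extend_coe]
        congr 2
        refine sum_congr rfl fun v hv => ?_
        rw [erase_insert_of_ne]
        rintro rfl
        exact (mem_compl.mp hv) hu
      rw [sum_congr rfl h3, ← mul_sum, sum_add_distrib, sum_const, hx, nsmul_eq_mul, sum_comm, ← hS]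
      push_cast
      rfl
    simp only [Pi.sub_apply, Pi.smul_apply, smul_eq_mul]
    rw [h1, h2, Real.norm_eq_abs]
    have h3 : 1 / ((n : ℝ) - (m + 1)) * (1 / ((m : ℝ) + 2) * ((((n : ℝ) - (m + 1)) * g x) + S))
        - 1 / ((m : ℝ) + 2) * g x
        - ((m : ℝ) + 1) / (m + 2) * (1 / ((m : ℝ) + 1) * (1 / ((n : ℝ) - m) * (((m : ℝ) + 1) * g x + S)))
        = 1 / (((m : ℝ) + 2) * (n - m)) * (S / (n - (m + 1)) - (m + 1) * g x) := by
      field_simp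
      ring
    rw [h3, abs_mul, abs_of_nonneg (by positivity)]
    have h4 : |S / (n - (m + 1)) - (m + 1) * g x| ≤ 2 * (((m : ℝ) + 1) * ‖g‖) := by
      refine (abs_sub _ _).trans ?_
      rw [abs_div, abs_mul, abs_of_pos hn1, abs_of_nonneg (by positivity : (0 : ℝ) ≤ m + 1)]
      have h5 : |S| / ((n : ℝ) - (m + 1)) ≤ ((m : ℝ) + 1) * ‖g‖ := by
        rw [div_le_iff₀ hn1]; linarith
      have h6 : |g x| ≤ ‖g‖ := norm_le_pi_norm g x
      have : ((m : ℝ) + 1) * |g x| ≤ (m + 1) * ‖g‖ := by gcongr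
      linarith
    calc _ ≤ 1 / (((m : ℝ) + 2) * (n - m)) * (2 * (((m : ℝ) + 1) * ‖g‖)) := by gcongr
      _ ≤ 1 / (((m : ℝ) + 2) * (n - L + 1)) * (2 * (((m : ℝ) + 2) * ‖g‖)) := by
        gcongr <;> linarith
      _ = _ := by field_simp

end Complete

/-! ### Walks on large complete complexes -/

/-- The coefficients of the walk that an HD-walk approaches on large complete complexes. -/
noncomputable def WalkComb.limitCoef {k : ℕ} (M : WalkComb k) (t : ℕ) : ℝ :=
  ∑ l ∈ range (k + 1), M.approxEigenvalue l * projCoef k l t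

/-- Inverts the definition of `limitCoef`: the `λ_l` are the eigenvalues of the normal form with
these coefficients. If the coefficients are non-negative, the `λ_l` inherit non-negativity and
monotonicity. -/
theorem WalkComb.approxEigenvalue_eq_sum {k : ℕ} (M : WalkComb k) {l : ℕ} (hl : l ≤ k) :
    M.approxEigenvalue l
      = ∑ t ∈ range (k + 1), M.limitCoef t * ((t.choose l : ℝ) / (k.choose l : ℝ)) := by
  have h1 : ∀ i ∈ range (k + 1), M.approxEigenvalue i * coefEigenvalue k (projCoef k i) l
      = if l = i then M.approxEigenvalue i else 0 := by
    intro i hi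
    rw [coefEigenvalue_projCoef (by have := mem_range.mp hi; omega)]
    by_cases h : i = l
    · rw [if_pos h, if_pos h.symm, mul_one]
    · rw [if_neg h, if_neg fun h' => h h'.symm, mul_zero]
  have h2 := sum_congr rfl h1
  rw [sum_ite_eq, if_pos (mem_range.mpr (by omega))] at h2
  rw [← h2]
  simp only [coefEigenvalue, limitCoef, sum_mul, mul_sum]
  rw [sum_comm]
  exact sum_congr rfl fun _ _ => sum_congr rfl fun _ _ => by ring

namespace WeightedComplex

variable {n d k : ℕ} {X : WeightedComplex n d}

theorem normalForm_limitCoef (M : WalkComb k) (g : X.Fn k) :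
    X.normalForm k k M.limitCoef g
      = ∑ l ∈ range (k + 1), M.approxEigenvalue l • X.proj k l g := by
  simp only [normalForm_apply, proj, WalkComb.limitCoef, sum_smul, smul_sum, smul_smul]
  rw [sum_comm]

theorem upTo_apply_of_forall_subset {j i : ℕ} (h : j ≤ i) {f : X.Fn j} {c : ℝ} {y : X.Face i}
    (hf : ∀ x : X.Face j, x.1 ⊆ y.1 → f x = c) : X.upTo h f y = c := by
  induction i, h using Nat.le_induction with
  | base => simpa using hf y Subset.rfl
  | succ i h ih =>
    rw [upTo_succ X h, LinearMap.comp_apply, up_apply, sum_congr rfl fun x hx =>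
      ih fun z hz => hf z (hz.trans (mem_filter.mp hx).2), sum_const, card_filter_subset,
      nsmul_eq_mul]
    push_cast
    field_simp

/-- The indicator function of the faces that meet a set in `t` vertices. -/
def meet (X : WeightedComplex n d) (v : Finset (Fin n)) (t i : ℕ) : X.Fn i :=
  fun y => if (y.1 ∩ v).card = t then 1 else 0

end WeightedComplex

/-! ### Convergence of the transition probabilities on complete complexes. -/

section Complete

variable {n d : ℕ} (h : d ≤ n)

/-- Adding a vertex changes the number of common vertices with `v` only if the vertex lies in `v`,
which has probability at most `|v|/(n-i)`. -/
theorem completeComplex_abs_down_meet_sub_le {i : ℕ} (hi : i + 1 ≤ d) (v : Finset (Fin n)) (t : ℕ)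
    (x : (completeComplex n d h).Face i) :
    |(completeComplex n d h).down i ((completeComplex n d h).meet v t (i + 1)) x
      - (completeComplex n d h).meet v t i x| ≤ v.card / ((n : ℝ) - i) := by
  have hx := x.card_eq
  have hin : (i : ℝ) + 1 ≤ n := by exact_mod_cast hi.trans h
  have hn0 : (0 : ℝ) < n - i := by linarith
  set F : Finset (Fin n) → ℝ := fun s => if (s ∩ v).card = t then 1 else 0 with hF
  have h1 : ∀ u ∈ x.1ᶜ, (completeComplex n d h).extend ((completeComplex n d h).meet v t (i + 1))
      (insert u x.1) = F (insert u x.1) := by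
    intro u hu
    have hmem : insert u x.1 ∈ (completeComplex n d h).level (i + 1) := by
      rw [completeComplex_mem_level h hi, card_insert_of_notMem (mem_compl.mp hu), hx]
    exact WeightedComplex.extend_coe _ ⟨_, hmem⟩
  have h2 : (completeComplex n d h).meet v t i x = 1 / ((n : ℝ) - i) * ∑ u ∈ x.1ᶜ, F x.1 := by
    rw [sum_const, card_compl, Fintype.card_fin, hx, nsmul_eq_mul, Nat.cast_sub (by omega),
      ← mul_assoc, one_div, inv_mul_cancel₀ hn0.ne', one_mul]
    rfl
  rw [completeComplex_down h hi, sum_congr rfl h1, h2, ← mul_sub, ← sum_sub_distrib, abs_mul,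
    abs_of_nonneg (by positivity), one_div, div_eq_inv_mul]
  refine mul_le_mul_of_nonneg_left ((abs_sum_le_sum_abs _ _).trans ?_) (by positivity)
  calc ∑ u ∈ x.1ᶜ, |F (insert u x.1) - F x.1| ≤ ∑ u ∈ x.1ᶜ, if u ∈ v then (1 : ℝ) else 0 := by
        refine sum_le_sum fun u _ => ?_
        split_ifs with huv
        · simp only [hF]
          split_ifs <;> norm_num
        · simp only [hF, insert_inter_of_notMem huv, sub_self, abs_zero, le_refl]
    _ = ((x.1ᶜ.filter fun u => u ∈ v).card : ℝ) := by rw [sum_boole]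
    _ ≤ v.card := by
        exact_mod_cast card_le_card fun u hu => (mem_filter.mp hu).2

theorem completeComplex_norm_downTo_meet_sub_le {L : ℕ} (hL : L ≤ d) (v : Finset (Fin n)) (t : ℕ)
    {j i : ℕ} (hji : j ≤ i) (hi : i ≤ L) :
    ‖(completeComplex n d h).downTo hji ((completeComplex n d h).meet v t i)
      - (completeComplex n d h).meet v t j‖ ≤ ((i : ℝ) - j) * (v.card / ((n : ℝ) - L + 1)) := by
  have hLn : (L : ℝ) ≤ n := by exact_mod_cast hL.trans h
  have hn0 : (0 : ℝ) < n - L + 1 := by linarith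
  induction i, hji using Nat.le_induction with
  | base => simp
  | succ i hji ih =>
    have hiL : (i : ℝ) + 1 ≤ L := by exact_mod_cast hi
    have h1 : (completeComplex n d h).downTo (hji.trans i.le_succ)
        ((completeComplex n d h).meet v t (i + 1)) - (completeComplex n d h).meet v t j
        = (completeComplex n d h).downTo hji
            ((completeComplex n d h).down i ((completeComplex n d h).meet v t (i + 1))
              - (completeComplex n d h).meet v t i)
          + ((completeComplex n d h).downTo hji ((completeComplex n d h).meet v t i)
            - (completeComplex n d h).meet v t j) := by
      rw [WeightedComplex.downTo_succ _ hji, map_sub, LinearMap.comp_apply]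
      abel
    have h2 := (completeComplex_approxComm h hL).downTo_le hji (by omega : i ≤ L)
      ((completeComplex n d h).down i ((completeComplex n d h).meet v t (i + 1))
        - (completeComplex n d h).meet v t i)
    rw [coe_normSeminorm, coe_normSeminorm] at h2
    have h3 : ‖(completeComplex n d h).down i ((completeComplex n d h).meet v t (i + 1))
        - (completeComplex n d h).meet v t i‖ ≤ v.card / ((n : ℝ) - L + 1) := by
      rw [pi_norm_le_iff_of_nonneg (by positivity)]
      intro x
      rw [Pi.sub_apply, Real.norm_eq_abs]
      refine (completeComplex_abs_down_meet_sub_le h (by omega) v t x).trans ?_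
      gcongr
      linarith
    rw [h1]
    refine (norm_add_le _ _).trans ((add_le_add (h2.trans h3) (ih (by omega))).trans (le_of_eq ?_))
    push_cast
    ring

/-- `D^k_j` nearly preserves the functions `meet`, and every `j`-subset of `v` meets `v` in exactly
`j` vertices. So evaluation at `v` extracts the coefficient with index `t`. -/
theorem completeComplex_abs_normalForm_meet_sub_le {k : ℕ} (a : ℕ → ℝ) {t : ℕ} (ht : t ≤ k)
    (v : (completeComplex n d h).Face k) :
    |(completeComplex n d h).normalForm k k a ((completeComplex n d h).meet v.1 t k) v - a t|
      ≤ coefNorm k a * (k * (k / ((n : ℝ) - k + 1))) := by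
  have hk := v.le
  have hkn : (k : ℝ) ≤ n := by exact_mod_cast hk.trans h
  have hn0 : (0 : ℝ) < n - k + 1 := by linarith
  have h1 : ∀ j ∈ range (k + 1),
      |(completeComplex n d h).upFrom j k ((completeComplex n d h).downFrom k j
        ((completeComplex n d h).meet v.1 t k)) v - (if j = t then 1 else 0)|
        ≤ k * (k / ((n : ℝ) - k + 1)) := by
    intro j hj
    have hj' : j ≤ k := by have := mem_range.mp hj; omega
    have h2 : (completeComplex n d h).upTo hj' ((completeComplex n d h).meet v.1 t j) v
        = if j = t then 1 else 0 := by
      refine WeightedComplex.upTo_apply_of_forall_subset hj' fun x hx => ?_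
      rw [WeightedComplex.meet, inter_eq_left.mpr hx, x.card_eq]
    have h3 := (completeComplex_approxComm h hk).upTo_le hj' le_rfl
      ((completeComplex n d h).downTo hj' ((completeComplex n d h).meet v.1 t k)
        - (completeComplex n d h).meet v.1 t j)
    rw [coe_normSeminorm, coe_normSeminorm] at h3
    have h4 := h3.trans (completeComplex_norm_downTo_meet_sub_le h hk v.1 t hj' le_rfl)
    have h5 := (norm_le_pi_norm _ v).trans h4
    rw [map_sub, Pi.sub_apply, h2, v.card_eq, Real.norm_eq_abs] at h5
    rw [WeightedComplex.upFrom_of_le _ hj', WeightedComplex.downFrom_of_le _ hj']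
    refine h5.trans ?_
    gcongr
    linarith [(Nat.cast_nonneg j : (0 : ℝ) ≤ j)]
  have h6 : a t = ∑ j ∈ range (k + 1), a j * (if j = t then 1 else 0) := by
    simp only [mul_ite, mul_one, mul_zero]
    rw [sum_ite_eq', if_pos (mem_range.mpr (by omega))]
  rw [h6, WeightedComplex.normalForm_apply, Finset.sum_apply, ← sum_sub_distrib, coefNorm, sum_mul]
  refine (abs_sum_le_sum_abs _ _).trans (sum_le_sum fun j hj => ?_)
  rw [Pi.smul_apply, smul_eq_mul, ← mul_sub, abs_mul]
  exact mul_le_mul_of_nonneg_left (h1 j hj) (abs_nonneg _)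

/-- On large complete complexes the transition probability to the faces that meet the current one
in `t` vertices approaches the limit coefficient. -/
theorem WalkComb.exists_abs_op_meet_sub_le {k : ℕ} (M : WalkComb k) {t : ℕ} (ht : t ≤ k) {η : ℝ}
    (hη : 0 < η) : ∃ N : ℕ, ∀ n ≥ N, ∀ (d : ℕ) (h : d ≤ n), (∀ Y ∈ M.support, Y.maxLevel ≤ d) →
      ∀ v : (completeComplex n d h).Face k,
        |M.op (completeComplex n d h) ((completeComplex n d h).meet v.1 t k) v - M.limitCoef t|
          ≤ η := by
  -- Completeness does not control `d`, which may be close to `n`. The walk only visits levels up to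
  -- `L`, which depends on `M` alone, so the error `2/(n-L+1)` tends to zero.
  set L := max k (M.support.sup WalkWord.maxLevel) with hL
  set C := M.errCoef * 2 + coefNorm k M.limitCoef * (k * k) with hC
  have hC0 : 0 ≤ C := by
    have := M.errCoef_nonneg
    have := coefNorm_nonneg k M.limitCoef
    positivity
  obtain ⟨N, hN⟩ := exists_nat_ge (C / η + L)
  refine ⟨N, fun n hn d h hM v => ?_⟩
  have hkL : k ≤ L := le_max_left _ _
  have hLd : L ≤ d := max_le v.le (Finset.sup_le hM)
  have hLY : ∀ Y ∈ M.support, Y.maxLevel ≤ L := fun Y hY =>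
    (le_sup (f := WalkWord.maxLevel) hY).trans (le_max_right _ _)
  have hLn : (L : ℝ) ≤ n := by exact_mod_cast hLd.trans h
  have hkL' : (k : ℝ) ≤ L := by exact_mod_cast hkL
  have hnN : (N : ℝ) ≤ n := by exact_mod_cast hn
  have hn0 : (0 : ℝ) < n - L + 1 := by linarith
  have h1 := (completeComplex_approxComm h hLd).comb_sub_sum M hLY
    ((completeComplex n d h).meet v.1 t k)
  rw [coe_normSeminorm, ← WeightedComplex.normalForm_limitCoef] at h1
  have h2 := (norm_le_pi_norm _ v).trans h1
  rw [Pi.sub_apply, Real.norm_eq_abs] at h2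
  have h3 := completeComplex_abs_normalForm_meet_sub_le h M.limitCoef ht v
  have h4 : ‖(completeComplex n d h).meet v.1 t k‖ ≤ 1 := by
    rw [pi_norm_le_iff_of_nonneg zero_le_one]
    intro y
    rw [WeightedComplex.meet]
    split_ifs <;> norm_num
  have hM0 := M.errCoef_nonneg
  have hc0 := coefNorm_nonneg k M.limitCoef
  have h5 : M.errCoef * (2 / ((n : ℝ) - L + 1)) * ‖(completeComplex n d h).meet v.1 t k‖
      + coefNorm k M.limitCoef * (k * (k / ((n : ℝ) - k + 1))) ≤ C / ((n : ℝ) - L + 1) := by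
    calc _ ≤ M.errCoef * (2 / ((n : ℝ) - L + 1)) * 1
          + coefNorm k M.limitCoef * (k * (k / ((n : ℝ) - L + 1))) := by gcongr
      _ = _ := by rw [hC]; ring
  have h6 : C / ((n : ℝ) - L + 1) ≤ η := by
    rw [div_le_iff₀ hn0]
    have h7 : C / η ≤ (n : ℝ) - L + 1 := by linarith
    rw [div_le_iff₀ hη] at h7
    linarith
  refine le_trans ?_ h6
  refine le_trans ?_ h5
  refine (abs_sub_le _ _ _).trans (add_le_add h2 h3)

theorem WeightedComplex.meet_nonneg {k : ℕ} {X : WeightedComplex n d} (v : Finset (Fin n)) (t : ℕ)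
    (y : X.Face k) : 0 ≤ X.meet v t k y := by
  rw [WeightedComplex.meet]; split_ifs <;> norm_num

/-- The limit coefficients of a complete walk are non-negative. -/
theorem WalkComb.IsComplete.limitCoef_nonneg {k : ℕ} {M : WalkComb k} (hM : M.IsComplete) {t : ℕ}
    (ht : t ≤ k) : 0 ≤ M.limitCoef t := by
  refine le_of_forall_pos_le_add fun η hη => ?_
  obtain ⟨N, hN⟩ := M.exists_abs_op_meet_sub_le ht hη
  obtain ⟨n, hn, d, h, hsum, hlev, -, hent⟩ := hM N
  have hne : M.support.Nonempty := by
    rw [Finsupp.support_nonempty_iff]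
    rintro rfl
    simp at hsum
  obtain ⟨Y, hY⟩ := hne
  have hkd : k ≤ d := Y.le_maxLevel.1.trans (hlev Y hY)
  obtain ⟨v, -, hv⟩ := exists_subset_card_eq (show k ≤ (univ : Finset (Fin n)).card by
    simpa using hkd.trans h)
  have h1 := hN n hn.le d h hlev ⟨v, (completeComplex_mem_level h hkd).mpr hv⟩
  rw [WeightedComplex.op_apply_eq_sum] at h1
  have h2 : 0 ≤ ∑ y, (completeComplex n d h).entry (M.op (completeComplex n d h))
      ⟨v, (completeComplex_mem_level h hkd).mpr hv⟩ y * (completeComplex n d h).meet v t k y :=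
    sum_nonneg fun y _ => mul_nonneg (hent _ y) (WeightedComplex.meet_nonneg v t y)
  have h3 := (abs_le.mp h1).2
  have h4 := (abs_le.mp h1).1
  simp only at h3 h4
  linarith

theorem WalkComb.IsComplete.approxEigenvalue_nonneg {k : ℕ} {M : WalkComb k} (hM : M.IsComplete)
    {l : ℕ} (hl : l ≤ k) : 0 ≤ M.approxEigenvalue l := by
  rw [M.approxEigenvalue_eq_sum hl]
  refine sum_nonneg fun t ht => mul_nonneg (hM.limitCoef_nonneg ?_) (by positivity)
  have := mem_range.mp ht
  omega

/-- The quotient of consecutive terms is `(t-l)/(k-l) ≤ 1`. -/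
theorem choose_div_choose_succ_le {k t l : ℕ} (ht : t ≤ k) (hl : l + 1 ≤ k) :
    (t.choose (l + 1) : ℝ) / (k.choose (l + 1) : ℝ) ≤ (t.choose l : ℝ) / (k.choose l : ℝ) := by
  have hk1 : (0 : ℝ) < k.choose (l + 1) := by exact_mod_cast Nat.choose_pos hl
  have hk0 : (0 : ℝ) < k.choose l := by exact_mod_cast Nat.choose_pos (by omega : l ≤ k)
  rw [div_le_div_iff₀ hk1 hk0]
  have h1 := Nat.choose_succ_right_eq k l
  have h2 := Nat.choose_succ_right_eq t l
  have h3 : t.choose (l + 1) * k.choose l * (l + 1) ≤ t.choose l * k.choose (l + 1) * (l + 1) := by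
    calc t.choose (l + 1) * k.choose l * (l + 1) = t.choose l * k.choose l * (t - l) := by
          rw [mul_right_comm, h2]; ring
      _ ≤ t.choose l * k.choose l * (k - l) := Nat.mul_le_mul_left _ (by omega)
      _ = _ := by rw [mul_assoc, ← h1]; ring
  exact_mod_cast Nat.le_of_mul_le_mul_right h3 (Nat.succ_pos l)

/-- The approximate eigenvalues of a complete walk are decreasing. -/
theorem WalkComb.IsComplete.approxEigenvalue_anti {k : ℕ} {M : WalkComb k} (hM : M.IsComplete)
    {i j : ℕ} (hij : i ≤ j) (hj : j ≤ k) : M.approxEigenvalue j ≤ M.approxEigenvalue i := by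
  induction j, hij using Nat.le_induction with
  | base => exact le_rfl
  | succ j hij ih =>
    refine le_trans ?_ (ih (by omega))
    rw [M.approxEigenvalue_eq_sum hj, M.approxEigenvalue_eq_sum (by omega)]
    refine sum_le_sum fun t ht => ?_
    have := mem_range.mp ht
    exact mul_le_mul_of_nonneg_left (choose_div_choose_succ_le (by omega) hj)
      (hM.limitCoef_nonneg (by omega))

end Complete

/-! ### Canonical walks on the complete complex -/

namespace WeightedComplex

variable {n d k : ℕ} {X : WeightedComplex n d}

theorem upTo_single {i : ℕ} (hk : k ≤ i) (y : X.Face k) (z : X.Face i) :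
    X.upTo hk (Pi.single y 1) z = if y.1 ⊆ z.1 then 1 / (i.choose k : ℝ) else 0 := by
  induction i, hk using Nat.le_induction with
  | base =>
    have h1 : y.1 ⊆ z.1 ↔ z = y := by
      constructor
      · intro h
        exact Subtype.ext (eq_of_subset_of_card_le h (by rw [y.card_eq, z.card_eq])).symm
      · rintro rfl
        exact Subset.rfl
    simp [Pi.single_apply, h1]
  | succ i hk ih =>
    rw [upTo_succ X hk, LinearMap.comp_apply, up_eq]
    have h1 : ∀ u ∈ z.1, X.extend (X.upTo hk (Pi.single y 1)) (z.1.erase u)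
        = if u ∉ y.1 then (if y.1 ⊆ z.1 then 1 / (i.choose k : ℝ) else 0) else 0 := by
      intro u hu
      have hmem : z.1.erase u ∈ X.level i :=
        X.mem_level_of_subset z.2 (erase_subset _ _) (by rw [card_erase_of_mem hu, z.card_eq]; rfl)
      have h2 := extend_coe (X.upTo hk (Pi.single y 1)) ⟨_, hmem⟩
      rw [ih] at h2
      rw [h2]
      simp only [subset_erase]
      split_ifs <;> simp_all
    rw [sum_congr rfl h1, ← sum_filter, sum_const, nsmul_eq_mul]
    split_ifs with hyz
    · have h3 : z.1.filter (fun u => u ∉ y.1) = z.1 \ y.1 := by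
        ext u; simp
      rw [h3, card_sdiff_of_subset hyz, z.card_eq, y.card_eq, Nat.cast_sub (by omega)]
      have h4 : ((i : ℝ) + 1) * (i.choose k : ℝ) = ((i + 1).choose k : ℝ) * ((i : ℝ) + 1 - k) := by
        have h5 := Nat.choose_mul_succ_eq i k
        have h6 : ((i + 1 - k : ℕ) : ℝ) = (i : ℝ) + 1 - k := by
          rw [Nat.cast_sub (by omega)]; push_cast; rfl
        rw [← h6, mul_comm]
        exact_mod_cast h5
      have h5 : ((i + 1).choose k : ℝ) ≠ 0 := by
        exact_mod_cast (Nat.choose_pos (by omega : k ≤ i + 1)).ne'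
      have h6 : (i.choose k : ℝ) ≠ 0 := by exact_mod_cast (Nat.choose_pos hk).ne'
      push_cast
      field_simp
      linear_combination -h4
    · simp

end WeightedComplex

/-! ### Exact transition probabilities of the canonical walks. -/

section Complete

variable {n d : ℕ} (h : d ≤ n)

/-- The value is the probability that a uniformly random `i`-superset of `x` contains the missing
vertices of `y`. The induction adds one vertex at a time and distinguishes whether it lies in `y`.
-/
theorem completeComplex_downTo_superset {j i : ℕ} (hji : j ≤ i) (hi : i ≤ d) (y : Finset (Fin n))
    (x : (completeComplex n d h).Face j) :
    (completeComplex n d h).downTo hji (fun z => if y ⊆ z.1 then 1 else 0) x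
      = ((i - j).choose (y \ x.1).card : ℝ) / ((n - j).choose (y \ x.1).card : ℝ) := by
  induction hji using Nat.decreasingInduction with
  | self =>
    simp only [WeightedComplex.downTo_self, LinearMap.id_apply, Nat.sub_self]
    split_ifs with hy
    · rw [sdiff_eq_empty_iff_subset.mpr hy]; simp
    · have : (y \ x.1).card ≠ 0 := by
        rw [Ne, card_eq_zero, sdiff_eq_empty_iff_subset]; exact hy
      rw [Nat.choose_eq_zero_of_lt (by omega)]; simp
  | of_succ j hj ih =>
    have hx := x.card_eq
    rw [WeightedComplex.downTo_succ_left _ hj, LinearMap.comp_apply,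
      completeComplex_down h (by omega)]
    set l := (y \ x.1).card with hl
    have hlx : l ≤ n - j := by
      have h1 : y \ x.1 ⊆ x.1ᶜ := fun u hu => mem_compl.mpr (mem_sdiff.mp hu).2
      have h2 := card_le_card h1
      rwa [card_compl, Fintype.card_fin, hx] at h2
    have h1 : ∀ u ∈ x.1ᶜ, (completeComplex n d h).extend ((completeComplex n d h).downTo hj
        (fun z => if y ⊆ z.1 then 1 else 0)) (insert u x.1)
        = if u ∈ y then ((i - (j + 1)).choose (l - 1) : ℝ) / ((n - (j + 1)).choose (l - 1) : ℝ)
          else ((i - (j + 1)).choose l : ℝ) / ((n - (j + 1)).choose l : ℝ) := by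
      intro u hu
      have hu' := mem_compl.mp hu
      have hmem : insert u x.1 ∈ (completeComplex n d h).level (j + 1) := by
        rw [completeComplex_mem_level h (by omega), card_insert_of_notMem hu', hx]
      have h2 := WeightedComplex.extend_coe ((completeComplex n d h).downTo hj
        (fun z => if y ⊆ z.1 then 1 else 0)) ⟨_, hmem⟩
      rw [ih] at h2
      rw [h2, sdiff_insert]
      split_ifs with huy
      · rw [card_erase_of_mem (mem_sdiff.mpr ⟨huy, hu'⟩)]
      · rw [erase_eq_of_notMem fun h => huy (mem_sdiff.mp h).1]
    have h3 : x.1ᶜ.filter (fun u => u ∈ y) = y \ x.1 := by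
      ext u; simp [and_comm]
    have h4 : (x.1ᶜ.filter (fun u => u ∉ y)).card = n - j - l := by
      have := card_filter_add_card_filter_not (s := x.1ᶜ) (fun u => u ∈ y)
      rw [h3, card_compl, Fintype.card_fin, hx, ← hl] at this
      omega
    rw [sum_congr rfl h1, sum_ite, sum_const, sum_const, h3, h4, ← hl, nsmul_eq_mul, nsmul_eq_mul,
      ← Nat.cast_sub (by omega)]
    obtain ⟨p, hp⟩ : ∃ p, n - j = p + 1 := ⟨n - j - 1, by omega⟩
    obtain ⟨q, hq⟩ : ∃ q, i - j = q + 1 := ⟨i - j - 1, by omega⟩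
    rw [show n - (j + 1) = p by omega, show i - (j + 1) = q by omega, hp, hq]
    have hqp : q ≤ p := by omega
    have hlp : l ≤ p + 1 := by omega
    have hC : ((p + 1).choose l : ℝ) ≠ 0 := by exact_mod_cast (Nat.choose_pos hlp).ne'
    have hp1 : ((p + 1 : ℕ) : ℝ) ≠ 0 := by positivity
    have e2 : (((p + 1 - l : ℕ) : ℝ)) * ((q.choose l : ℝ) / p.choose l)
        = ((p + 1 : ℕ) : ℝ) * ((q.choose l : ℝ) / (p + 1).choose l) := by
      rcases Nat.lt_or_ge p l with hpl | hpl
      · rw [Nat.choose_eq_zero_of_lt (by omega : q < l)]; simp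
      · have hC2 : (p.choose l : ℝ) ≠ 0 := by exact_mod_cast (Nat.choose_pos hpl).ne'
        have h5 : (p.choose l : ℝ) * ((p + 1 : ℕ) : ℝ)
            = ((p + 1).choose l : ℝ) * ((p + 1 - l : ℕ) : ℝ) := by
          exact_mod_cast Nat.choose_mul_succ_eq p l
        field_simp
        linear_combination -(q.choose l : ℝ) * h5
    have e1 : (l : ℝ) * ((q.choose (l - 1) : ℝ) / p.choose (l - 1))
        = ((p + 1 : ℕ) : ℝ) * ((((q + 1).choose l : ℝ) - q.choose l) / (p + 1).choose l) := by
      rcases l with _ | l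
      · simp
      · have hC2 : (p.choose l : ℝ) ≠ 0 := by
          exact_mod_cast (Nat.choose_pos (by omega : l ≤ p)).ne'
        have h5 : ((p + 1 : ℕ) : ℝ) * (p.choose l : ℝ)
            = ((p + 1).choose (l + 1) : ℝ) * ((l + 1 : ℕ) : ℝ) := by
          exact_mod_cast Nat.add_one_mul_choose_eq p l
        rw [Nat.add_sub_cancel, Nat.choose_succ_succ q l]
        push_cast at h5 ⊢
        field_simp
        linear_combination -(q.choose l : ℝ) * h5
    rw [e1, e2, ← mul_add, ← add_div, sub_add_cancel, ← mul_assoc, one_div,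
      inv_mul_cancel₀ hp1, one_mul]

/-- The dependence on the step number `i` is through `binom(i,l)`, up to a factor free of `l`. This
makes binomial inversion over `i` possible. -/
theorem completeComplex_entry_canonicalWalk {k i : ℕ} (hi : k + i ≤ d)
    (v y : (completeComplex n d h).Face k) :
    (completeComplex n d h).entry ((completeComplex n d h).canonicalWalk k i) v y
      = (i.choose (y.1 \ v.1).card : ℝ)
        / (((k + i).choose i : ℝ) * ((n - k).choose (y.1 \ v.1).card : ℝ)) := by
  have h1 : (completeComplex n d h).upTo (Nat.le_add_right k i) (Pi.single y 1)
      = (1 / ((k + i).choose i : ℝ)) • fun z => if y.1 ⊆ z.1 then (1 : ℝ) else 0 := by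
    funext z
    rw [WeightedComplex.upTo_single, Nat.choose_symm_add]
    simp
  rw [WeightedComplex.entry, WeightedComplex.canonicalWalk, LinearMap.comp_apply, h1, map_smul,
    Pi.smul_apply, completeComplex_downTo_superset h _ hi, Nat.add_sub_cancel_left, smul_eq_mul]
  field_simp

/-- The number of sets of a given size with a given number of elements outside a subset. -/
theorem card_filter_card_sdiff {V : Type*} [DecidableEq V] {v W : Finset V} (hv : v ⊆ W) (k j : ℕ)
    (hj : j ≤ k) :
    ((powersetCard k W).filter fun y => (y \ v).card = j).card
      = (W.card - v.card).choose j * v.card.choose (k - j) := by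
  rw [← card_sdiff_of_subset hv, ← card_powersetCard, ← card_powersetCard, ← card_product]
  refine card_nbij' (fun y => (y \ v, y ∩ v)) (fun p => p.1 ∪ p.2) ?_ ?_ ?_ ?_
  · intro y hy
    simp only [coe_filter, Set.mem_ofPred_eq, mem_powersetCard] at hy
    simp only [coe_product, Set.mem_prod, mem_coe, mem_powersetCard]
    have := card_sdiff_add_card_inter y v
    exact ⟨⟨sdiff_subset_sdiff hy.1.1 Subset.rfl, hy.2⟩, inter_subset_right, by omega⟩
  · rintro ⟨a, b⟩ hp
    simp only [coe_product, Set.mem_prod, mem_coe, mem_powersetCard, subset_sdiff] at hp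
    obtain ⟨⟨⟨haW, hav⟩, ha⟩, hbv, hb⟩ := hp
    simp only [coe_filter, Set.mem_ofPred_eq, mem_powersetCard]
    refine ⟨⟨union_subset haW (hbv.trans hv), ?_⟩, ?_⟩
    · rw [card_union_of_disjoint (hav.mono_right hbv)]; omega
    · rw [union_sdiff_distrib, sdiff_eq_empty_iff_subset.mpr hbv, union_empty,
        sdiff_eq_self_of_disjoint hav, ha]
  · intro y _
    exact sdiff_union_inter y v
  · rintro ⟨a, b⟩ hp
    simp only [coe_product, Set.mem_prod, mem_coe, mem_powersetCard, subset_sdiff] at hp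
    obtain ⟨⟨⟨haW, hav⟩, ha⟩, hbv, hb⟩ := hp
    simp only [Prod.mk.injEq]
    refine ⟨?_, ?_⟩
    · rw [union_sdiff_distrib, sdiff_eq_empty_iff_subset.mpr hbv, union_empty,
        sdiff_eq_self_of_disjoint hav]
    · rw [union_inter_distrib_right, disjoint_iff_inter_eq_empty.mp hav, empty_union,
        inter_eq_left.mpr hbv]

theorem completeComplex_card_filter_face {k j : ℕ} (hj : j ≤ k) {W : Finset (Fin n)}
    (v : (completeComplex n d h).Face k) (hv : v.1 ⊆ W) :
    (univ.filter fun y : (completeComplex n d h).Face k => y.1 ⊆ W ∧ (y.1 \ v.1).card = j).card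
      = (W.card - k).choose j * k.choose j := by
  have hx := v.card_eq
  rw [← Nat.choose_symm hj, ← card_map (Function.Embedding.subtype _)]
  have h1 := card_filter_card_sdiff hv k j hj
  rw [hx] at h1
  rw [← h1]
  congr 1
  ext y
  simp only [mem_map, mem_filter, mem_univ, true_and, mem_powersetCard,
    Function.Embedding.coe_subtype, Subtype.exists]
  constructor
  · rintro ⟨s, hs, hW, rfl⟩
    exact ⟨⟨hW.1, (WeightedComplex.mem_level _).mp hs |>.1⟩, hW.2⟩
  · rintro ⟨⟨hW, hc⟩, hl⟩
    exact ⟨y, (completeComplex_mem_level h v.le).mpr hc, ⟨hW, hl⟩, rfl⟩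

end Complete

/-! ### The partial-swap walk as a combination of canonical walks -/

/-- The partial-swap walk `S^j_k` as a combination of canonical walks. -/
noncomputable def swapComb (k j : ℕ) : WalkComb k :=
  ∑ i ∈ range (j + 1), Finsupp.single (WalkWord.canonical k i)
    ((-1 : ℝ) ^ (j + i) * (j.choose i : ℝ) * ((k + i).choose i : ℝ) / (k.choose j : ℝ))

theorem swapComb_sum {N : Type*} [AddCommMonoid N] (k j : ℕ) (F : WalkWord k k → ℝ → N)
    (h0 : ∀ Y, F Y 0 = 0) (hadd : ∀ Y a b, F Y (a + b) = F Y a + F Y b) :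
    (swapComb k j).sum F = ∑ i ∈ range (j + 1), F (WalkWord.canonical k i)
      ((-1 : ℝ) ^ (j + i) * (j.choose i : ℝ) * ((k + i).choose i : ℝ) / (k.choose j : ℝ)) := by
  rw [swapComb, ← Finsupp.sum_finsetSum_index h0 hadd]
  exact sum_congr rfl fun i _ => Finsupp.sum_single_index (h0 _)

theorem swapComb_maxLevel {k j : ℕ} {Y : WalkWord k k} (hY : Y ∈ (swapComb k j).support) :
    Y.maxLevel ≤ k + j := by
  classical
  obtain ⟨i, hi, hYi⟩ := mem_biUnion.mp (Finsupp.support_finsetSum hY)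
  have h1 := Finsupp.support_single_subset hYi
  rw [mem_singleton] at h1
  rw [h1, WalkWord.maxLevel_canonical]
  have := mem_range.mp hi
  omega

/-! ### The partial-swap walk as a complete HD-walk. -/

section Complete

variable {n d : ℕ} (h : d ≤ n)

theorem swapComb_op {k j : ℕ} (X : WeightedComplex n d) (f : X.Fn k) :
    (swapComb k j).op X f = ∑ i ∈ range (j + 1),
      ((-1 : ℝ) ^ (j + i) * (j.choose i : ℝ) * ((k + i).choose i : ℝ) / (k.choose j : ℝ))
        • X.canonicalWalk k i f := by
  rw [WeightedComplex.comb_op_apply, swapComb_sum k j (fun Y a => a • Y.op X f)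
    (fun _ => zero_smul ℝ _) (fun _ _ _ => add_smul _ _ _)]
  simp only [WeightedComplex.op_canonical]

theorem swapComb_inner {k j : ℕ} (X : WeightedComplex n d) (f g : X.Fn k) :
    X.inner ((swapComb k j).op X f) g = X.inner f ((swapComb k j).op X g) := by
  have h1 : ∀ (i : ℕ) (f g : X.Fn k),
      X.inner f (X.canonicalWalk k i g) = X.inner g (X.canonicalWalk k i f) := by
    intro i f g
    rw [WeightedComplex.canonicalWalk, LinearMap.comp_apply, LinearMap.comp_apply,
      ← WeightedComplex.inner_upTo, ← WeightedComplex.inner_upTo, WeightedComplex.inner_comm]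
  rw [WeightedComplex.inner_comm, swapComb_op, swapComb_op, WeightedComplex.inner_sum_right,
    WeightedComplex.inner_sum_right]
  refine sum_congr rfl fun i _ => ?_
  rw [WeightedComplex.inner_smul_right, WeightedComplex.inner_smul_right, h1]

/-- Inversion of `binom(i,l)` over `i` removes all pairs of faces except those with `l = j`. The
coefficients do not depend on `n` or `d`. -/
theorem swapComb_entry {k j : ℕ} (hj : j ≤ k) (hd : k + j ≤ d)
    (v y : (completeComplex n d h).Face k) :
    (completeComplex n d h).entry ((swapComb k j).op (completeComplex n d h)) v y
      = if (y.1 \ v.1).card = j then 1 / (((n - k).choose j : ℝ) * (k.choose j : ℝ)) else 0 := by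
  set l := (y.1 \ v.1).card with hl
  have h1 := sum_neg_one_pow_choose_mul_choose (le_refl j) l
  have hkj : (k.choose j : ℝ) ≠ 0 := by exact_mod_cast (Nat.choose_pos hj).ne'
  rw [WeightedComplex.entry, swapComb_op, Finset.sum_apply]
  have h2 : ∀ i ∈ range (j + 1), (((-1 : ℝ) ^ (j + i) * (j.choose i : ℝ) * ((k + i).choose i : ℝ)
      / (k.choose j : ℝ)) • (completeComplex n d h).canonicalWalk k i (Pi.single y 1)) v
      = ((-1 : ℝ) ^ (j + i) * (j.choose i : ℝ) * (i.choose l : ℝ))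
        * (1 / (((n - k).choose l : ℝ) * (k.choose j : ℝ))) := by
    intro i hi
    have h3 := completeComplex_entry_canonicalWalk h
      (by have := mem_range.mp hi; omega : k + i ≤ d) v y
    rw [WeightedComplex.entry, ← hl] at h3
    have hC : ((k + i).choose i : ℝ) ≠ 0 := by
      exact_mod_cast (Nat.choose_pos (Nat.le_add_left i k)).ne'
    rw [Pi.smul_apply, smul_eq_mul, h3]
    field_simp
  rw [sum_congr rfl h2, ← sum_mul, h1]
  by_cases hlj : j = l
  · rw [if_pos hlj, if_pos hlj.symm, one_mul, hlj]
  · rw [if_neg hlj, if_neg fun h' => hlj h'.symm, zero_mul]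

/-- The swap walk applied to an indicator of the subsets of a vertex set. -/
theorem sum_swapComb_entry {k j : ℕ} (hj : j ≤ k) (hd : k + j ≤ d) {W : Finset (Fin n)}
    (v : (completeComplex n d h).Face k) (hv : v.1 ⊆ W) :
    ∑ y : (completeComplex n d h).Face k with y.1 ⊆ W,
      (completeComplex n d h).entry ((swapComb k j).op (completeComplex n d h)) v y
      = ((W.card - k).choose j : ℝ) / ((n - k).choose j : ℝ) := by
  simp only [swapComb_entry h hj hd]
  rw [← sum_filter, filter_filter, sum_const, completeComplex_card_filter_face h hj v hv,
    nsmul_eq_mul]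
  have hkj : (k.choose j : ℝ) ≠ 0 := by exact_mod_cast (Nat.choose_pos hj).ne'
  push_cast
  field_simp

theorem sum_swapComb_entry_univ {k j : ℕ} (hj : j ≤ k) (hd : k + j ≤ d)
    (v : (completeComplex n d h).Face k) :
    ∑ y, (completeComplex n d h).entry ((swapComb k j).op (completeComplex n d h)) v y = 1 := by
  have h1 := sum_swapComb_entry h hj hd v (subset_univ _)
  rw [filter_true_of_mem fun y _ => subset_univ _, card_univ, Fintype.card_fin] at h1
  rw [h1, div_self]
  exact_mod_cast (Nat.choose_pos (by omega : j ≤ n - k)).ne'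

/-- Read off from one complex, `J(k+j, k+j)`: each canonical walk fixes the constant functions, and
the rows of the combination add up to one. -/
theorem swapComb_sum_coef {k j : ℕ} (hj : j ≤ k) : ((swapComb k j).sum fun _ a => a) = 1 := by
  have h0 := le_refl (k + j)
  obtain ⟨v, -, hv⟩ := exists_subset_card_eq (show k ≤ (univ : Finset (Fin (k + j))).card by simp)
  have hk : v ∈ (completeComplex (k + j) (k + j) h0).level k :=
    (completeComplex_mem_level h0 (Nat.le_add_right k j)).mpr hv
  have h1 := sum_swapComb_entry_univ h0 hj le_rfl ⟨v, hk⟩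
  have h2 := WeightedComplex.op_apply_eq_sum
    ((swapComb k j).op (completeComplex (k + j) (k + j) h0)) (fun _ => 1) ⟨v, hk⟩
  simp only [mul_one] at h2
  rw [h1, swapComb_op, Finset.sum_apply] at h2
  rw [swapComb_sum _ _ _ (fun _ => rfl) fun _ _ _ => rfl]
  refine Eq.trans ?_ h2
  refine sum_congr rfl fun i hi => ?_
  rw [Pi.smul_apply, ← WeightedComplex.op_canonical, WeightedComplex.op_const, smul_eq_mul, mul_one]
  rw [WalkWord.maxLevel_canonical]
  have := mem_range.mp hi
  omega

theorem swapComb_isHDWalk {k j : ℕ} (hj : j ≤ k) (hd : k + j ≤ d) :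
    (swapComb k j).IsHDWalk (completeComplex n d h) := by
  refine ⟨swapComb_sum_coef hj, fun Y hY => (swapComb_maxLevel hY).trans hd,
    swapComb_inner _, fun v y => ?_⟩
  rw [swapComb_entry h hj hd]
  split_ifs <;> positivity

theorem swapComb_isComplete {k j : ℕ} (hj : j ≤ k) : (swapComb k j).IsComplete := fun n =>
  ⟨n + 1 + (k + j), by omega, k + j, by omega, swapComb_isHDWalk _ hj le_rfl⟩

theorem swapComb_entry_eq_partialSwap {k j : ℕ} (hj : j ≤ k) (hd : k + j ≤ d)
    (s s' : (completeComplex n d h).Face k) :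
    (completeComplex n d h).entry ((swapComb k j).op (completeComplex n d h)) s s'
      = (completeComplex n d h).partialSwap k j s s' := by
  have hiff : ∀ u : (completeComplex n d h).Face k,
      (s.1 ∩ u.1).card + j = k ↔ (u.1 \ s.1).card = j := by
    intro u
    have h1 := card_sdiff_add_card_inter u.1 s.1
    rw [u.card_eq] at h1
    rw [inter_comm]
    omega
  rw [swapComb_entry h hj hd, WeightedComplex.partialSwap]
  simp only [hiff]
  split_ifs with hs
  · have hC : ((n - k).choose j : ℝ) ≠ 0 := by
      exact_mod_cast (Nat.choose_pos (by omega : j ≤ n - k)).ne'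
    have hC2 : ((k + j).choose j : ℝ) ≠ 0 := by
      exact_mod_cast (Nat.choose_pos (Nat.le_add_left j k)).ne'
    have h1 : ∀ u : (completeComplex n d h).Face k, (u.1 \ s.1).card = j →
        (completeComplex n d h).entry ((completeComplex n d h).canonicalWalk k j) s u
          = 1 / (((k + j).choose j : ℝ) * ((n - k).choose j : ℝ)) := by
      intro u hu
      rw [completeComplex_entry_canonicalWalk h hd, hu, Nat.choose_self, Nat.cast_one]
    have h2 := completeComplex_card_filter_face h hj s (subset_univ _)
    simp only [subset_univ, true_and, card_univ, Fintype.card_fin] at h2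
    rw [h1 s' hs, sum_congr rfl fun u hu => h1 u (mem_filter.mp hu).2, sum_const, h2, nsmul_eq_mul]
    push_cast
    field_simp
  · rfl

/-- The walk moves only to faces with exactly `k - j` common vertices, on every complex, so the
limit is immediate. It gives the approximate eigenvalues without an evaluation of the alternating
sum. -/
theorem swapComb_limitCoef {k j s : ℕ} (hj : j ≤ k) (hs : s ≤ k) :
    (swapComb k j).limitCoef s = if s + j = k then 1 else 0 := by
  have key : ∀ η > 0, |(if s + j = k then 1 else 0) - (swapComb k j).limitCoef s| ≤ η := by
    intro η hη
    obtain ⟨N, hN⟩ := (swapComb k j).exists_abs_op_meet_sub_le hs hη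
    have h0 : k + j ≤ N + (k + j) := Nat.le_add_left _ _
    obtain ⟨v, -, hv⟩ := exists_subset_card_eq
      (show k ≤ (univ : Finset (Fin (N + (k + j)))).card by simp; omega)
    have hk : v ∈ (completeComplex _ (k + j) h0).level k :=
      (completeComplex_mem_level h0 (Nat.le_add_right k j)).mpr hv
    have h1 := hN (N + (k + j)) (Nat.le_add_right _ _) (k + j) h0 (fun Y => swapComb_maxLevel)
      ⟨v, hk⟩
    rw [WeightedComplex.op_apply_eq_sum] at h1
    have h2 : ∀ y : (completeComplex _ (k + j) h0).Face k,
        (completeComplex _ (k + j) h0).entry ((swapComb k j).op (completeComplex _ (k + j) h0))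
          ⟨v, hk⟩ y * (completeComplex _ (k + j) h0).meet v s k y
        = (completeComplex _ (k + j) h0).entry ((swapComb k j).op (completeComplex _ (k + j) h0))
          ⟨v, hk⟩ y * if s + j = k then 1 else 0 := by
      intro y
      rw [swapComb_entry h0 hj le_rfl]
      by_cases h3 : (y.1 \ v).card = j
      · have h4 := card_sdiff_add_card_inter y.1 v
        rw [y.card_eq] at h4
        rw [WeightedComplex.meet]
        congr 1
        exact if_congr (by omega) rfl rfl
      · rw [if_neg h3, zero_mul, zero_mul]
    rw [sum_congr rfl fun y _ => h2 y, ← sum_mul, sum_swapComb_entry_univ h0 hj le_rfl,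
      one_mul] at h1
    exact h1
  have h1 : |(if s + j = k then 1 else 0) - (swapComb k j).limitCoef s| ≤ 0 :=
    le_of_forall_pos_le_add fun η hη => by rw [zero_add]; exact key η hη
  have h2 := abs_nonpos_iff.mp h1
  linarith

theorem swapComb_approxEigenvalue {k j l : ℕ} (hj : j ≤ k) (hl : l ≤ k) :
    (swapComb k j).approxEigenvalue l = ((k - j).choose l : ℝ) / (k.choose l : ℝ) := by
  rw [WalkComb.approxEigenvalue_eq_sum _ hl, sum_eq_single (k - j)]
  · rw [swapComb_limitCoef hj (Nat.sub_le k j), if_pos (by omega), one_mul]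
  · intro s hs hsj
    have := mem_range.mp hs
    rw [swapComb_limitCoef hj (by omega), if_neg (by omega), zero_mul]
  · intro hs
    exact absurd (mem_range.mpr (by omega)) hs

end Complete

/-! ### Tightness -/

theorem WalkComb.errMax_le {k : ℕ} (M : WalkComb k) {γ : ℝ} (hγ : 0 ≤ γ) :
    M.errMax 1 γ ≤ M.errCoef * 2 ^ k * γ := by
  refine ciSup_le fun l => ?_
  have h1 : (k.choose l : ℝ) ≤ 2 ^ k := by exact_mod_cast Nat.choose_le_two_pow k l
  have := M.errCoef_nonneg
  calc _ = M.errCoef * γ * (k.choose l : ℝ) := by rw [errCoef]; ring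
    _ ≤ M.errCoef * γ * 2 ^ k := by gcongr
    _ = _ := by ring

/-- The eigenstrip intervals are disjoint on sufficiently strong local-spectral expanders. -/
theorem WalkComb.exists_eigenstripsDisjoint {k : ℕ} (M : WalkComb k) :
    ∃ γ₀ : ℝ, 0 < γ₀ ∧ ∀ γ, 0 ≤ γ → γ < γ₀ → M.EigenstripsDisjoint 1 1 γ := by
  by_cases hall : ∀ i j : Fin (k + 1), M.approxEigenvalue i = M.approxEigenvalue j
  · exact ⟨1, one_pos, fun γ _ _ i j hij => absurd (hall i j) hij⟩
  push Not at hall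
  obtain ⟨i₀, j₀, hij₀⟩ := hall
  have hD := eigDif_pos hij₀
  set D := M.eigDif with hDdef
  set K := M.errCoef * 2 ^ k with hK
  set R := ((k : ℝ) + 1) * M.eigRatio with hR
  have hR0 : 0 ≤ R := by
    have : 0 ≤ M.eigRatio := by
      rw [eigRatio]
      exact div_nonneg (Real.iSup_nonneg fun _ => abs_nonneg _) (Real.sqrt_nonneg _)
    positivity
  -- As `γ` tends to zero, the strip width and `c_max` do too, while `λ_dif` is a fixed positive
  -- number.
  have h1 : Filter.Tendsto (fun γ : ℝ => 2 * (R * √(K * γ))) (nhds 0) (nhds 0) :=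
    (by fun_prop : Continuous fun γ : ℝ => 2 * (R * √(K * γ))).tendsto' 0 0 (by simp)
  have h2 : Filter.Tendsto (fun γ : ℝ => K * γ) (nhds 0) (nhds 0) :=
    (by fun_prop : Continuous fun γ : ℝ => K * γ).tendsto' 0 0 (by simp)
  have hD4 : 0 < D / (4 * ((k : ℝ) + 1)) := by positivity
  obtain ⟨γ₀, hγ₀, hball⟩ := Metric.eventually_nhds_iff.mp
    ((h1.eventually_lt_const hD).and (h2.eventually_lt_const hD4))
  refine ⟨γ₀, hγ₀, fun γ hγ hγlt i j hij => ?_⟩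
  obtain ⟨hw, hc⟩ := hball (show dist γ 0 < γ₀ by
    rwa [Real.dist_eq, sub_zero, abs_of_nonneg hγ])
  have herr := M.errMax_le hγ
  refine ⟨herr.trans hc.le, ?_⟩
  have hwidth : 2 * M.stripWidth 1 1 γ < D := by
    refine lt_of_le_of_lt ?_ hw
    rw [stripWidth, one_mul, ← hR]
    gcongr
  have hdif := eigDif_le hij
  rw [← hDdef] at hdif
  rw [Set.disjoint_left]
  rintro x ⟨hx1, hx2⟩ ⟨hx3, hx4⟩
  have : |M.approxEigenvalue i - M.approxEigenvalue j| ≤ 2 * M.stripWidth 1 1 γ :=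
    abs_le.mpr ⟨by linarith, by linarith⟩
  linarith

/-! ### Pseudorandomness and expansion of the initial faces. -/

section Complete

variable {n d : ℕ} (h : d ≤ n)

/-- Each added vertex falls into `W` with probability `(|W|-j)/(n-j) ≤ q`. A face that is not
contained in `W` stays so. -/
theorem completeComplex_downTo_subset_le {W : Finset (Fin n)} {q : ℝ} (hq0 : 0 ≤ q) (hq1 : q ≤ 1)
    (hW : (W.card : ℝ) ≤ q * n) {j i : ℕ} (hji : j ≤ i) (hi : i ≤ d)
    (x : (completeComplex n d h).Face j) :
    (completeComplex n d h).downTo hji (fun z => if z.1 ⊆ W then 1 else 0) x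
      ≤ if x.1 ⊆ W then q ^ (i - j) else 0 := by
  induction hji using Nat.decreasingInduction with
  | self => simp
  | of_succ j hj ih =>
    have hx := x.card_eq
    have hjn : (j : ℝ) + 1 ≤ n := by exact_mod_cast (Nat.succ_le_of_lt hj).trans (hi.trans h)
    have hn0 : (0 : ℝ) < n - j := by linarith
    rw [WeightedComplex.downTo_succ_left _ hj, LinearMap.comp_apply,
      completeComplex_down h (by omega)]
    have h1 : ∀ u ∈ x.1ᶜ, (completeComplex n d h).extend ((completeComplex n d h).downTo hj
        (fun z => if z.1 ⊆ W then 1 else 0)) (insert u x.1)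
        ≤ if u ∈ W then (if x.1 ⊆ W then q ^ (i - (j + 1)) else 0) else 0 := by
      intro u hu
      have hu' := mem_compl.mp hu
      have hmem : insert u x.1 ∈ (completeComplex n d h).level (j + 1) := by
        rw [completeComplex_mem_level h (by omega), card_insert_of_notMem hu', hx]
      have h2 := WeightedComplex.extend_coe ((completeComplex n d h).downTo hj
        (fun z => if z.1 ⊆ W then 1 else 0)) ⟨_, hmem⟩
      refine h2.le.trans ((ih _).trans (le_of_eq ?_))
      simp only [insert_subset_iff, ite_and]
    have h3 := sum_le_sum h1
    rw [← sum_filter, sum_const, nsmul_eq_mul] at h3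
    split_ifs at h3 ⊢ with hxW
    · have h4 : x.1ᶜ.filter (fun u => u ∈ W) = W \ x.1 := by
        ext u; simp [and_comm]
      have hcard : j ≤ W.card := hx ▸ card_le_card hxW
      rw [h4, card_sdiff_of_subset hxW, hx, Nat.cast_sub hcard] at h3
      have h5 : (W.card : ℝ) - j ≤ q * (n - j) := by
        have : q * j ≤ j := mul_le_of_le_one_left (Nat.cast_nonneg j) hq1
        linarith
      rw [one_div, inv_mul_le_iff₀ hn0]
      calc _ ≤ ((W.card : ℝ) - j) * q ^ (i - (j + 1)) := h3
        _ ≤ q * (n - j) * q ^ (i - (j + 1)) := by gcongr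
        _ = (n - j) * q ^ (i - (j + 1) + 1) := by ring
        _ = _ := by rw [show i - (j + 1) + 1 = i - j by omega]
    · rw [mul_zero] at h3
      exact mul_nonpos_of_nonneg_of_nonpos (by positivity) h3

theorem card_filter_val_lt {N : ℕ} (hN : N ≤ n) :
    (univ.filter fun v : Fin n => (v : ℕ) < N).card = N := by
  rw [Fin.card_filter_val_lt, min_eq_right hN]

theorem mem_initialFaces {k m : ℕ} {X : WeightedComplex n d} {y : X.Face k} :
    y ∈ X.initialFaces k m ↔ y.1 ⊆ univ.filter fun v : Fin n => (v : ℕ) < n / m := by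
  simp [WeightedComplex.initialFaces, subset_iff]

theorem initialFaces_nonempty {k m : ℕ} (hk : k ≤ d) (hkm : k ≤ n / m) :
    ((completeComplex n d h).initialFaces k m).Nonempty := by
  obtain ⟨v, hv, hvc⟩ := exists_subset_card_eq
    (show k ≤ (univ.filter fun v : Fin n => (v : ℕ) < n / m).card by
      rwa [card_filter_val_lt (Nat.div_le_self n m)])
  exact ⟨⟨v, (completeComplex_mem_level h hk).mpr hvc⟩, mem_initialFaces.mpr hv⟩

theorem downTo_initialFaces_le {k m : ℕ} (hm : 1 ≤ m) {i : ℕ} (hik : i ≤ k) (hk : k ≤ d)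
    (x : (completeComplex n d h).Face i) :
    (completeComplex n d h).downTo hik
      ((completeComplex n d h).indicator ((completeComplex n d h).initialFaces k m)) x
      ≤ (1 / (m : ℝ)) ^ (k - i) := by
  have hm1 : (1 : ℝ) ≤ m := by exact_mod_cast hm
  have hq0 : (0 : ℝ) ≤ 1 / m := by positivity
  have hq1 : 1 / (m : ℝ) ≤ 1 := (div_le_one (by linarith)).mpr hm1
  have hW : ((univ.filter fun v : Fin n => (v : ℕ) < n / m).card : ℝ) ≤ 1 / m * n := by
    rw [card_filter_val_lt (Nat.div_le_self n m), one_div, inv_mul_eq_div]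
    exact Nat.cast_div_le
  have h1 := completeComplex_downTo_subset_le h hq0 hq1 hW hik hk x
  have h2 : (completeComplex n d h).indicator ((completeComplex n d h).initialFaces k m)
      = fun z => if z.1 ⊆ univ.filter (fun v : Fin n => (v : ℕ) < n / m) then 1 else 0 := by
    funext z
    simp only [WeightedComplex.indicator, mem_initialFaces]
  rw [h2]
  refine h1.trans ?_
  split_ifs
  · exact le_rfl
  · positivity

theorem density_initialFaces_le {k m : ℕ} (hm : 1 ≤ m) (hk : k ≤ d) :
    (completeComplex n d h).density ((completeComplex n d h).initialFaces k m)
      ≤ (1 / (m : ℝ)) ^ k := by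
  have h0 : (∅ : Finset (Fin n)) ∈ (completeComplex n d h).level 0 :=
    (completeComplex_mem_level h (Nat.zero_le d)).mpr card_empty
  have h1 := downTo_initialFaces_le h hm (Nat.zero_le k) hk ⟨∅, h0⟩
  rwa [WeightedComplex.downTo_zero] at h1

theorem density_nonneg {k : ℕ} {X : WeightedComplex n d} (S : Finset (X.Face k)) :
    0 ≤ X.density S := by
  rw [WeightedComplex.density_eq]
  exact sum_nonneg fun s _ => (X.prob_pos s).le

theorem isLinftyPseudorandom_initialFaces {k m : ℕ} (hm : 1 ≤ m) (hk : k ≤ d) (r : ℕ) :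
    (completeComplex n d h).IsLinftyPseudorandom
      ((completeComplex n d h).indicator ((completeComplex n d h).initialFaces k m)) r
      fun i => (1 / (m : ℝ)) ^ (k - i) := by
  intro i hik _ _ s
  have hm1 : (1 : ℝ) ≤ m := by exact_mod_cast hm
  have h1 := downTo_initialFaces_le h hm hik hk s
  have h2 := WeightedComplex.downTo_nonneg hik (WeightedComplex.indicator_nonneg
    ((completeComplex n d h).initialFaces k m)) s
  have h3 := density_initialFaces_le h (k := k) hm hk
  have h4 := density_nonneg ((completeComplex n d h).initialFaces k m)
  have h5 : (1 / (m : ℝ)) ^ k ≤ (1 / (m : ℝ)) ^ (k - i) :=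
    pow_le_pow_of_le_one (by positivity) ((div_le_one (by linarith)).mpr hm1) (Nat.sub_le k i)
  rw [WeightedComplex.density] at h3 h4
  exact abs_le.mpr ⟨by linarith, by linarith⟩

/-- The second moment of `D^k_i f` is at most its maximum times its mean. -/
theorem isL2Pseudorandom_initialFaces {k m : ℕ} (hm : 1 ≤ m) (hk : k ≤ d) (r : ℕ) :
    (completeComplex n d h).IsL2Pseudorandom
      ((completeComplex n d h).indicator ((completeComplex n d h).initialFaces k m)) r
      fun i => (1 / (m : ℝ)) ^ (k - i) := by
  intro i hik _ _
  have h4 := density_nonneg ((completeComplex n d h).initialFaces k m)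
  rw [WeightedComplex.density] at h4
  rw [abs_of_nonneg h4, WeightedComplex.var_eq]
  refine (sub_le_self _ (sq_nonneg _)).trans ?_
  rw [← WeightedComplex.expect_downTo _ hik, WeightedComplex.inner_eq, WeightedComplex.expect,
    mul_sum]
  refine sum_le_sum fun s _ => ?_
  have h1 := downTo_initialFaces_le h hm hik hk s
  have h2 := WeightedComplex.downTo_nonneg hik (WeightedComplex.indicator_nonneg
    ((completeComplex n d h).initialFaces k m)) s
  have h3 := ((completeComplex n d h).prob_pos s).le
  rw [mul_left_comm]
  exact mul_le_mul_of_nonneg_right h1 (mul_nonneg h3 h2)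

/-- From a face inside `W`, the first `n/m` vertices, the walk stays inside exactly when the `j` new
vertices, chosen among `n - k`, all come from the `n/m - k` others of `W`. -/
theorem expansion_initialFaces {k j m : ℕ} (hj : j ≤ k) (hd : k + j ≤ d) (hkm : k ≤ n / m) :
    1 - (completeComplex n d h).expansion ((swapComb k j).op (completeComplex n d h))
      ((completeComplex n d h).initialFaces k m)
      = ((n / m - k).choose j : ℝ) / ((n - k).choose j : ℝ) := by
  have hne := initialFaces_nonempty h (by omega : k ≤ d) hkm
  obtain ⟨hsum, hlev, -, -⟩ := swapComb_isHDWalk h hj hd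
  rw [WeightedComplex.expansion_eq ((completeComplex n d h).comb_op_const hsum hlev 1) hne,
    sub_sub_cancel, WeightedComplex.inner_indicator]
  have h1 : ∀ s ∈ (completeComplex n d h).initialFaces k m,
      (completeComplex n d h).prob s.1 * (swapComb k j).op (completeComplex n d h)
        ((completeComplex n d h).indicator ((completeComplex n d h).initialFaces k m)) s
      = (completeComplex n d h).prob s.1
        * (((n / m - k).choose j : ℝ) / ((n - k).choose j : ℝ)) := by
    intro s hs
    have h2 := sum_swapComb_entry h hj hd s (mem_initialFaces.mp hs)
    rw [card_filter_val_lt (Nat.div_le_self n m)] at h2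
    rw [← h2, WeightedComplex.op_apply_eq_sum, WeightedComplex.sum_mul_indicator]
    congr 1
    refine sum_congr ?_ fun _ _ => rfl
    ext y
    simp [mem_initialFaces]
  rw [sum_congr rfl h1, ← sum_mul, ← WeightedComplex.density_eq]
  exact mul_div_cancel_left₀ _ (WeightedComplex.density_pos hne).ne'

end Complete

/-- As a quotient of falling factorials, the numerator has `j` factors at least `n/m - k - j` and
the denominator `j` factors at most `n`. -/
theorem sub_pow_le_choose_div_choose {n m k j : ℕ} (hm : 1 ≤ m) (hmn : m ∣ n)
    (hn : m * (k + j + 1) ≤ n) :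
    (1 / (m : ℝ) - (k + j) / n) ^ j
      ≤ ((n / m - k).choose j : ℝ) / ((n - k).choose j : ℝ) := by
  obtain ⟨N, rfl⟩ := hmn
  rw [Nat.mul_div_cancel_left N (by omega)]
  have hN : k + j + 1 ≤ N := Nat.le_of_mul_le_mul_left hn (by omega)
  have hNm : N ≤ m * N := Nat.le_mul_of_pos_left N (by omega)
  have hm0 : (0 : ℝ) < m := by exact_mod_cast hm
  have hN0 : (0 : ℝ) < N := by exact_mod_cast (by omega : 0 < N)
  have hNk : (k : ℝ) + j + 1 ≤ N := by exact_mod_cast hN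
  have h1 : ((N - k - j : ℕ) : ℝ) ^ j ≤ ((N - k).descFactorial j : ℝ) := by
    have h2 := Nat.pow_sub_le_descFactorial (N - k) j
    have h3 : (N - k - j) ^ j ≤ (N - k + 1 - j) ^ j := Nat.pow_le_pow_left (by omega) j
    exact_mod_cast h3.trans h2
  have h2 : ((m * N - k).descFactorial j : ℝ) ≤ ((m : ℝ) * N) ^ j := by
    have h3 := Nat.descFactorial_le_pow (m * N - k) j
    have h4 : (m * N - k) ^ j ≤ (m * N) ^ j := Nat.pow_le_pow_left (by omega) j
    exact_mod_cast h3.trans h4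
  have h3 : (0 : ℝ) < ((m * N - k).descFactorial j : ℝ) := by
    exact_mod_cast Nat.descFactorial_pos.mpr (by omega)
  have h4 : ((N - k).choose j : ℝ) / ((m * N - k).choose j : ℝ)
      = ((N - k).descFactorial j : ℝ) / ((m * N - k).descFactorial j : ℝ) := by
    rw [Nat.descFactorial_eq_factorial_mul_choose, Nat.descFactorial_eq_factorial_mul_choose]
    push_cast
    rw [mul_div_mul_left _ _ (by exact_mod_cast (Nat.factorial_pos j).ne')]
  rw [h4]
  have h5 : 1 / (m : ℝ) - (k + j) / ((m * N : ℕ) : ℝ) = ((N - k - j : ℕ) : ℝ) / (m * N) := by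
    rw [Nat.sub_sub, Nat.cast_sub (by omega)]
    push_cast
    field_simp
  rw [h5, div_pow]
  gcongr

theorem sum_choose_mul_pow {k t : ℕ} (ht : t ≤ k) (q : ℝ) :
    ∑ i ∈ range (k + 1), (t.choose i : ℝ) * q ^ (k - i) = q ^ (k - t) * (1 + q) ^ t := by
  have h1 : ∑ i ∈ range (t + 1), (t.choose i : ℝ) * q ^ (k - i)
      = ∑ i ∈ range (k + 1), (t.choose i : ℝ) * q ^ (k - i) := by
    refine sum_subset (fun i hi => mem_range.mpr ?_) fun i _ hi => ?_
    · have := mem_range.mp hi; omega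
    · rw [Nat.choose_eq_zero_of_lt (by simpa [Nat.lt_succ_iff] using hi), Nat.cast_zero, zero_mul]
  rw [← h1, add_pow, mul_sum]
  refine sum_congr rfl fun i hi => ?_
  have := mem_range.mp hi
  rw [one_pow, one_mul, show k - i = (k - t) + (t - i) by omega, pow_add]
  ring

/-- The bound for complete walks. -/
theorem WalkComb.IsComplete.expansionBound_le {n d k : ℕ} {X : WeightedComplex n d} {γ : ℝ}
    {M : WalkComb k} (hc : M.IsComplete) (hγ : 0 ≤ γ) (hX : X.IsLocalSpectralExpander γ)
    (hM : M.IsHDWalk X) (hdis : M.EigenstripsDisjoint 1 1 γ) {δ : ℝ} (hδ : 0 < δ)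
    {S : Finset (X.Face k)} (hS : S.Nonempty) {r : ℕ} (hr : r = M.stRank X 1 1 γ δ - 1)
    {ε : ℕ → ℝ}
    (hps : X.IsL2Pseudorandom (X.indicator S) r ε ∨ X.IsLinftyPseudorandom (X.indicator S) r ε)
    (hε : ∀ i ∈ Finset.Icc 1 r, M.approxEigenvalue i < δ → ε i ≤ 1) :
    expansionBound 20 γ δ (X.density S) M r ε ≤ X.expansion (M.op X) S :=
  expansionBound_le_expansion hγ hX hM (fun _ _ => hc.approxEigenvalue_anti)
    (fun _ => hc.approxEigenvalue_nonneg) hdis hδ hS hr hps hε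

/-- Since `λ_i binom(k,i) = binom(t,i)` and `α` is at most the term `i = 0`, the sum can be
completed to a full binomial sum, whatever the value of `r`. -/
theorem one_sub_expansionBound_swapComb_le {k t r : ℕ} (ht : t ≤ k) (hr : r ≤ k) {α γ δ q : ℝ}
    (hα0 : 0 ≤ α) (hq : 0 ≤ q) (hα : α ≤ q ^ k) (hδ : 0 < δ) :
    1 - expansionBound 20 γ δ α (swapComb k (k - t)) r (fun i => q ^ (k - i))
      ≤ q ^ (k - t) * (1 + q) ^ t + δ
        + ((swapComb k (k - t)).weight * ((swapComb k (k - t)).height : ℝ) ^ 2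
          * (2 : ℝ) ^ ((20 : ℝ) * k)) * γ := by
  have h1 : ∑ i ∈ Icc 1 r,
      ((swapComb k (k - t)).approxEigenvalue i - δ) * (k.choose i : ℝ) * q ^ (k - i)
      ≤ ∑ i ∈ Icc 1 r, (t.choose i : ℝ) * q ^ (k - i) := by
    refine sum_le_sum fun i hi => ?_
    have hik : i ≤ k := (mem_Icc.mp hi).2.trans hr
    have hC : (0 : ℝ) < k.choose i := by exact_mod_cast Nat.choose_pos hik
    rw [swapComb_approxEigenvalue (Nat.sub_le k t) hik, Nat.sub_sub_self ht]
    refine mul_le_mul_of_nonneg_right ?_ (by positivity)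
    rw [sub_mul, div_mul_cancel₀ _ hC.ne']
    have : 0 ≤ δ * (k.choose i : ℝ) := by positivity
    linarith
  have h2 : α + ∑ i ∈ Icc 1 r, (t.choose i : ℝ) * q ^ (k - i) ≤ q ^ (k - t) * (1 + q) ^ t := by
    rw [← sum_choose_mul_pow ht]
    calc α + ∑ i ∈ Icc 1 r, (t.choose i : ℝ) * q ^ (k - i)
        ≤ (t.choose 0 : ℝ) * q ^ (k - 0) + ∑ i ∈ Icc 1 r, (t.choose i : ℝ) * q ^ (k - i) := by
          simpa using hα
      _ = ∑ i ∈ insert 0 (Icc 1 r), (t.choose i : ℝ) * q ^ (k - i) :=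
          (sum_insert (f := fun i => (t.choose i : ℝ) * q ^ (k - i)) (by simp)).symm
      _ ≤ _ := by
          refine sum_le_sum_of_subset_of_nonneg (fun i hi => mem_range.mpr ?_) fun i _ _ => by
            positivity
          rw [mem_insert, mem_Icc] at hi
          omega
  have h3 : 0 ≤ α * δ := mul_nonneg hα0 hδ.le
  rw [expansionBound]
  linarith

/-- The constants in the comparison of the expansion of the initial faces with the lower bound. -/
theorem exists_forall_mul_le_sub_pow (k j t d : ℕ) (c : ℝ) {η : ℝ} (hη0 : 0 < η) :
    ∃ m₀ : ℕ, ∀ m : ℕ, m₀ ≤ m → ∃ δ₀ : ℝ, 0 < δ₀ ∧ ∀ δ : ℝ, 0 < δ → δ < δ₀ →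
      ∃ n₀ : ℕ, ∀ n : ℕ, n₀ ≤ n →
        (1 - η) * ((1 / (m : ℝ)) ^ j * (1 + 1 / (m : ℝ)) ^ t + δ + c * (1 / ((n : ℝ) - d + 1)))
          ≤ (1 / (m : ℝ) - (k + j) / n) ^ j := by
  have h1 : Filter.Tendsto (fun m : ℕ => (1 - η) * (1 + 1 / (m : ℝ)) ^ t) Filter.atTop
      (nhds ((1 - η) * (1 + 0) ^ t)) :=
    ((tendsto_one_div_atTop_nhds_zero_nat.const_add 1).pow t).const_mul _
  rw [add_zero, one_pow, mul_one] at h1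
  obtain ⟨m₁, hm₁⟩ := Filter.eventually_atTop.mp (h1.eventually_lt_const (by linarith : 1 - η < 1))
  refine ⟨max m₁ 1, fun m hm => ?_⟩
  have hm1 : 1 ≤ m := (le_max_right _ _).trans hm
  have hm0 : (0 : ℝ) < m := by exact_mod_cast hm1
  set q := 1 / (m : ℝ) with hq
  have hq0 : 0 < q := by positivity
  have hgap : (1 - η) * (q ^ j * (1 + q) ^ t) < q ^ j := by
    have h2 := hm₁ m ((le_max_left _ _).trans hm)
    rw [← hq] at h2
    have h3 : 0 < q ^ j := by positivity
    nlinarith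
  -- For large `m` the factor `(1-η) (1+1/m)^t` is below one; the resulting gap is the room for `δ`,
  -- and what remains absorbs the error terms in `n`.
  refine ⟨q ^ j - (1 - η) * (q ^ j * (1 + q) ^ t), by linarith, fun δ hδ0 hδ => ?_⟩
  have hlt : (1 - η) * (q ^ j * (1 + q) ^ t + δ + c * 0) < (q - 0) ^ j := by
    have h2 : (1 - η) * δ ≤ 1 * δ := by gcongr; linarith
    rw [sub_zero]
    linarith
  have h2 : Filter.Tendsto (fun n : ℕ => ((n : ℝ) - d + 1)) Filter.atTop Filter.atTop := by
    simp only [sub_add]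
    exact Filter.tendsto_atTop_add_const_right _ _ tendsto_natCast_atTop_atTop
  have h3 : Filter.Tendsto (fun n : ℕ => 1 / ((n : ℝ) - d + 1)) Filter.atTop (nhds 0) := by
    simp only [one_div]
    exact tendsto_inv_atTop_zero.comp h2
  have h4 : Filter.Tendsto (fun n : ℕ => (1 - η) * (q ^ j * (1 + q) ^ t + δ
      + c * (1 / ((n : ℝ) - d + 1)))) Filter.atTop
      (nhds ((1 - η) * (q ^ j * (1 + q) ^ t + δ + c * 0))) :=
    ((h3.const_mul c).const_add _).const_mul _
  have h5 : Filter.Tendsto (fun n : ℕ => (q - ((k : ℝ) + j) / n) ^ j) Filter.atTop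
      (nhds ((q - 0) ^ j)) :=
    ((tendsto_const_div_atTop_nhds_zero_nat _).const_sub q).pow j
  obtain ⟨n₀, hn₀⟩ := Filter.eventually_atTop.mp (h4.eventually_lt h5 hlt)
  exact ⟨n₀, fun n hn => (hn₀ n hn).le⟩

theorem exists_forall_one_div_lt (d : ℕ) {γ₀ : ℝ} (h : 0 < γ₀) :
    ∃ n₀ : ℕ, ∀ n : ℕ, n₀ ≤ n → 1 / ((n : ℝ) - d + 1) < γ₀ := by
  obtain ⟨N, hN⟩ := exists_nat_gt (1 / γ₀ + d)
  refine ⟨N, fun n hn => ?_⟩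
  have h1 : (N : ℝ) ≤ n := by exact_mod_cast hn
  have h2 : 0 < 1 / γ₀ := by positivity
  rw [div_lt_comm₀ (by linarith) h]
  linarith

/-- The initial faces attain the lower bound asymptotically. -/
theorem swapComb_tight {k t d : ℕ} (ht : t ≤ k) (hd : 2 * k - t ≤ d) {η : ℝ} (hη : 0 < η) :
    ∃ m₀ : ℕ, ∀ m : ℕ, m₀ ≤ m → ∃ δ₀ : ℝ, 0 < δ₀ ∧ ∀ δ : ℝ, 0 < δ → δ < δ₀ →
      ∃ n₀ : ℕ, ∀ (n : ℕ) (h : d ≤ n), n₀ ≤ n → m ∣ n →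
        ∃ (γ : ℝ) (r : ℕ) (ε : ℕ → ℝ),
          0 ≤ γ ∧ (completeComplex n d h).IsLocalSpectralExpander γ ∧
          (swapComb k (k - t)).EigenstripsDisjoint 1 1 γ ∧
          r = (swapComb k (k - t)).stRank (completeComplex n d h) 1 1 γ δ - 1 ∧
          ((completeComplex n d h).initialFaces k m).Nonempty ∧
          (completeComplex n d h).IsL2Pseudorandom
            ((completeComplex n d h).indicator ((completeComplex n d h).initialFaces k m)) r ε ∧
          (completeComplex n d h).IsLinftyPseudorandom
            ((completeComplex n d h).indicator ((completeComplex n d h).initialFaces k m)) r ε ∧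
          (∀ i ∈ Finset.Icc 1 r, ε i ≤ 1) ∧
          (1 - η) * (1 - expansionBound 20 γ δ ((completeComplex n d h).density
              ((completeComplex n d h).initialFaces k m)) (swapComb k (k - t)) r ε) ≤
            1 - (completeComplex n d h).expansion ((swapComb k (k - t)).op (completeComplex n d h))
              ((completeComplex n d h).initialFaces k m) := by
  have hj : k - t ≤ k := Nat.sub_le k t
  have hd' : k + (k - t) ≤ d := by omega
  set c := (swapComb k (k - t)).weight * ((swapComb k (k - t)).height : ℝ) ^ 2
    * (2 : ℝ) ^ ((20 : ℝ) * k) with hc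
  obtain ⟨γ₀, hγ₀, hdis⟩ := (swapComb k (k - t)).exists_eigenstripsDisjoint
  obtain ⟨n₁, hn₁⟩ := exists_forall_one_div_lt d hγ₀
  -- Replacing `η` by `min η (1/2)` makes `1 - η` positive, as is needed to multiply inequalities by
  -- it.
  obtain ⟨m₀, hm₀⟩ := exists_forall_mul_le_sub_pow k (k - t) t d c
    (lt_min hη one_half_pos : 0 < min η (1 / 2))
  refine ⟨max m₀ 1, fun m hm => ?_⟩
  have hm1 : 1 ≤ m := (le_max_right _ _).trans hm
  obtain ⟨δ₀, hδ₀, hδ⟩ := hm₀ m ((le_max_left _ _).trans hm)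
  refine ⟨δ₀, hδ₀, fun δ hδ0 hδlt => ?_⟩
  obtain ⟨n₂, hn₂⟩ := hδ δ hδ0 hδlt
  refine ⟨max (max n₁ n₂) (m * (k + (k - t) + 1)), fun n h hn hmn => ?_⟩
  rw [max_le_iff, max_le_iff] at hn
  obtain ⟨⟨hn1, hn2⟩, hn3⟩ := hn
  have hnd : (d : ℝ) ≤ n := by exact_mod_cast h
  have hγ : 0 ≤ 1 / ((n : ℝ) - d + 1) := by
    have : 0 ≤ (n : ℝ) - d + 1 := by linarith
    positivity
  have hkm : k ≤ n / m := by
    rw [Nat.le_div_iff_mul_le (by omega), mul_comm]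
    exact (Nat.mul_le_mul_left m (by omega)).trans hn3
  have hkd : k ≤ d := by omega
  have hne := initialFaces_nonempty h hkd hkm
  set r := (swapComb k (k - t)).stRank (completeComplex n d h) 1 1 (1 / ((n : ℝ) - d + 1)) δ - 1
    with hr
  have hrk : r ≤ k := by
    have := WalkComb.stRank_le (X := completeComplex n d h) (M := swapComb k (k - t)) 1 1
      (1 / ((n : ℝ) - d + 1)) δ
    omega
  have hl2 := isL2Pseudorandom_initialFaces h hm1 hkd r
  have hε : ∀ i ∈ Finset.Icc 1 r, (1 / (m : ℝ)) ^ (k - i) ≤ 1 := fun i _ =>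
    pow_le_one₀ (by positivity) ((div_le_one (by exact_mod_cast hm1)).mpr (by exact_mod_cast hm1))
  have hlse := completeComplex_isLocalSpectralExpander h
  have hdisj := hdis _ hγ (hn₁ n hn1)
  refine ⟨1 / ((n : ℝ) - d + 1), r, fun i => (1 / (m : ℝ)) ^ (k - i), hγ, hlse, hdisj, hr, hne,
    hl2, isLinftyPseudorandom_initialFaces h hm1 hkd r, hε, ?_⟩
  have hbound := (swapComb_isComplete hj).expansionBound_le hγ hlse (swapComb_isHDWalk h hj hd')
    hdisj hδ0 hne hr (Or.inl hl2) fun i hi _ => hε i hi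
  have hα0 := density_nonneg ((completeComplex n d h).initialFaces k m)
  have hup := one_sub_expansionBound_swapComb_le (γ := 1 / ((n : ℝ) - d + 1)) ht hrk hα0
    (by positivity : (0 : ℝ) ≤ 1 / m) (density_initialFaces_le h hm1 hkd) hδ0
  rw [← hc] at hup
  have hexp := expansion_initialFaces h hj hd' hkm
  have hlow := sub_pow_le_choose_div_choose (k := k) (j := k - t) hm1 hmn hn3
  rw [← hexp] at hlow
  have hn := hn₂ n hn2
  set E := 1 - expansionBound 20 (1 / ((n : ℝ) - d + 1)) δ ((completeComplex n d h).density
    ((completeComplex n d h).initialFaces k m)) (swapComb k (k - t)) r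
    fun i => (1 / (m : ℝ)) ^ (k - i) with hE
  have hratio : 0 ≤ 1 - (completeComplex n d h).expansion
      ((swapComb k (k - t)).op (completeComplex n d h))
      ((completeComplex n d h).initialFaces k m) := by
    rw [hexp]; positivity
  -- The first statement of the theorem, applied to `B_m`, gives `E ≥ 1 - φ(B_m) ≥ 0`.
  have hE0 : 0 ≤ E := by linarith
  calc (1 - η) * E ≤ (1 - min η (1 / 2)) * E := by
        gcongr
        exact min_le_left _ _
    _ ≤ (1 - min η (1 / 2)) * ((1 / (m : ℝ)) ^ (k - t) * (1 + 1 / (m : ℝ)) ^ t + δ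
        + c * (1 / ((n : ℝ) - d + 1))) := by
        have : min η (1 / 2) ≤ 1 / 2 := min_le_right _ _
        refine mul_le_mul_of_nonneg_left hup (by linarith)
    _ ≤ _ := hn
    _ ≤ _ := hlow

/-! ### The theorem, with the constants `A = B = 1` and `C = 20`. -/

theorem mainTheorem2 :
    ∃ A B C : ℝ, 0 < A ∧ 0 < B ∧ 0 < C ∧
      -- the bound
      (∀ (n d k : ℕ) (X : WeightedComplex n d) (γ : ℝ) (M : WalkComb k) (δ : ℝ)
        (S : Finset (X.Face k)) (r : ℕ) (ε : ℕ → ℝ),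
        0 ≤ γ → X.IsLocalSpectralExpander γ →
        M.IsHDWalk X → M.IsComplete →
        M.EigenstripsDisjoint A B γ →
        0 < δ → r = M.stRank X A B γ δ - 1 →
        S.Nonempty →
        (X.IsL2Pseudorandom (X.indicator S) r ε ∨ X.IsLinftyPseudorandom (X.indicator S) r ε) →
        (∀ i ∈ Finset.Icc 1 r, M.approxEigenvalue i < δ → ε i ≤ 1) →
        expansionBound C γ δ (X.density S) M r ε ≤ X.expansion (M.op X) S) ∧
      -- its tightness, on the complete complex with a partial-swap walk
      (∀ k t d : ℕ, t ≤ k → 2 * k - t ≤ d →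
        ∃ M : WalkComb k, M.IsComplete ∧
          (∀ (n : ℕ) (h : d ≤ n), M.IsHDWalk (completeComplex n d h) ∧
            ∀ s s', (completeComplex n d h).entry (M.op (completeComplex n d h)) s s' =
              (completeComplex n d h).partialSwap k (k - t) s s') ∧
          ∀ η : ℝ, 0 < η → ∃ m₀ : ℕ, ∀ m : ℕ, m₀ ≤ m →
            ∃ δ₀ : ℝ, 0 < δ₀ ∧ ∀ δ : ℝ, 0 < δ → δ < δ₀ →
              ∃ n₀ : ℕ, ∀ (n : ℕ) (h : d ≤ n), n₀ ≤ n → m ∣ n →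
                ∃ (γ : ℝ) (r : ℕ) (ε : ℕ → ℝ),
                  0 ≤ γ ∧ (completeComplex n d h).IsLocalSpectralExpander γ ∧
                  M.EigenstripsDisjoint A B γ ∧
                  r = M.stRank (completeComplex n d h) A B γ δ - 1 ∧
                  ((completeComplex n d h).initialFaces k m).Nonempty ∧
                  (completeComplex n d h).IsL2Pseudorandom
                    ((completeComplex n d h).indicator
                      ((completeComplex n d h).initialFaces k m)) r ε ∧
                  (completeComplex n d h).IsLinftyPseudorandom
                    ((completeComplex n d h).indicator
                      ((completeComplex n d h).initialFaces k m)) r ε ∧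
                  (∀ i ∈ Finset.Icc 1 r, ε i ≤ 1) ∧
                  (1 - η) * (1 - expansionBound C γ δ ((completeComplex n d h).density
                      ((completeComplex n d h).initialFaces k m)) M r ε) ≤
                    1 - (completeComplex n d h).expansion (M.op (completeComplex n d h))
                      ((completeComplex n d h).initialFaces k m)) := by
  refine ⟨1, 1, 20, one_pos, one_pos, by norm_num, ?_, ?_⟩
  · intro n d k X γ M δ S r ε hγ hX hM hc hdis hδ hr hS hps hε
    exact hc.expansionBound_le hγ hX hM hdis hδ hS hr hps hε
  · intro k t d ht hd
    have hj : k - t ≤ k := Nat.sub_le k t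
    have hd' : k + (k - t) ≤ d := by omega
    exact ⟨swapComb k (k - t), swapComb_isComplete hj,
      fun n h => ⟨swapComb_isHDWalk h hj hd', swapComb_entry_eq_partialSwap h hj hd'⟩,
      fun η hη => swapComb_tight ht hd hη⟩
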